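/- Let $n\ge 1$, let $M\subseteq\mathbb R^n$ be nonempty, open and connected, with coordinates $u^1,\dots,u^n$ and volume form $\omega=du^1\wedge\dots\wedge du^n$, and let $A=(a^1,\dots,a^{n+1}):M\to\mathbb R^{n+1}$ and $Q:M\to\mathbb R$ be smooth. On $M\times(\mathbb R^{n+1})^*$, with the flat product connection, coordinates $(u,x)$ and volume form $\Upsilon=du^1\wedge\dots\wedge du^n\wedge dx_1\wedge\dots\wedge dx_{n+1}$, put $F(u,x)=\langle A(u),x\rangle+Q(u)$. Let $A_I=\partial A/\partial u^I$, regard $dA=(A_1\ \dots\ A_n)$ as an $(n+1)\times n$ matrix, let $dA^{(i)}$ be the determinant of $dA$ with the $i$th row deleted, $|A\ dA|=\det(A\ A_1\ \dots\ A_n)$, and $$V=\sum_{i=1}^{n+1}(-1)^{i+1}dA^{(i)}\,\partial_{x_i}.$$ Let $U^{ij}$ be the adjugate of the Hessian $F_{ij}$ in these coordinates, $N^i=U^{ij}F_j$, $\mathcal U(F)=U^{ij}F_iF_j$, $\beta=\sum_i a^i\,dx_i$, $\Omega=d\beta$, and $\mu=\iota(\mathbb E)\Psi$, where $\mathbb E$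 is the radial field and $\Psi$ the determinant form on $\mathbb R^{n+1}$. $A$ is a centroaffine immersion if it is an immersion with $A(u)\ne0$ and $A(u)\notin dA_u(\mathbb R^n)$ for all $u\in M$. An equiaffine normal of a $2n$-dimensional hypersurface $\Sigma$ is a smooth transversal field $W$ along $\Sigma$ such that, writing $D_XY=\nabla_XY+h(X,Y)W$ and $D_XW=-S(X)+\tau(X)W$ for $X,Y$ tangent to $\Sigma$ (with $\nabla_XY$ and $S(X)$ tangent), the volume density $|\iota(W)\Upsilon|$ equals the density $|\det h|^{1/2}$ of $h$, and $\iota(W)\Upsilon$ is $\nabla$-parallel; then $h$ is the equiaffine metric, $S$ the equiaffine shape operator, and $\frac1{2n}\operatorname{tr}S$ the equiaffine mean curvature. Then: 1. $V$ lies in the radical of $\operatorname{Hess}F$ everywhere. 2. $\operatorname{adj}\operatorname{Hess}F=(-1)^nV\otimes V$, $N=(-1)^n|A\ dA|\,V$ and $\mathcal U(F)=(-1)^n|A\ dA|^2$. 3. $A$ is an immersion if and only if $\operatorname{Hess}F$ has rank $2n$ everywhere. In this case, at every point, the radical of $\operatorname{Hess}F$ is the span of $V$. 4. The following are equivalent: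 (a) $A$ is a centroaffine immersion; (b) $\mathcal U(F)$ vanishes nowhere on $M\times(\mathbb R^{n+1})^*$; (c) $\beta$ is a contact form, i.e. $\beta\wedge\Omega^n$ vanishes nowhere. In this case $\operatorname{adj}\operatorname{Hess}F=(-1)^n|A\ dA|^{-2}N\otimes N$, and every nonempty level set $\Sigma=\{F=t\}$ is a smooth nondegenerate hypersurface (its second fundamental form is nondegenerate) to which $N$ is transverse, and $\Omega$ restricts to a symplectic form on $\Sigma$. 5. Let $\kappa\neq0$ be a constant. Then $A^*(\mu)=\kappa\,\omega$ if and only if $\beta\wedge\Omega^n=(-1)^{n(n+1)/2}\,n!\,\kappa\,\Upsilon$. Suppose this holds. Then $A$ is a centroaffine immersion, and: (a) Every nonempty level set $\Sigma$ of $F$ has zero equiaffine mean curvature. Its equiaffine normal with the co-orientation of $-\operatorname{sign}(\mathcal U(F))N$ is, uniquely, $$W=(-1)^{n+1}|\kappa|^{-(2n+1)/(n+1)}N=-\operatorname{sign}(\kappa)\,|\kappa|^{-n/(n+1)}\,V .$$ (b) The equiaffine shape operator $S$ of $\Sigma$ satisfies $S^2=0$, and $\ker S$ contains the tangent distribution of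 a smooth ruling of $\Sigma$ by affine $n$-planes that are Lagrangian for $\Omega|_\Sigma$. (c) This ruling is not cylindrical, i.e. its leaves are not all parallel. (d) The equiaffine metric of $\Sigma$ has split signature $(n,n)$. (e) The Reeb field of $\beta$ (the unique $R$ with $\beta(R)=1$, $\iota(R)\Omega=0$) is $\kappa^{-1}V$. (f) For $t\in\mathbb R$, $r\in M$, $s\in\mathbb R^n$ put $$\Phi(t,r,s)=\Big(r,\ \kappa^{-1}(t-Q(r))V(r)+\sum_{I=1}^ns^I\big(a^{I+1}(r)\,\partial_{x_I}-a^I(r)\,\partial_{x_{I+1}}\big)\Big).$$ Then $F(\Phi(t,r,s))=t$. Let $M'\subseteq M$ be the set of points at which none of $a^2,\dots,a^n$ vanishes (so $M'=M$ if $n=1$). Then $M'$ is dense in $M$, and for every $t$ the map $\Phi(t,\cdot,\cdot):M'\times\mathbb R^n\to\{F=t\}\cap(M'\times(\mathbb R^{n+1})^*)$ is a parameterization: a smooth bijection, with $M'$ open, whose inverse is the restriction of a map that is smooth near every point of its image. In particular, if $a^2,\dots,a^n$ vanish nowhere, it parameterizes the whole level set. (g) $\varphi(t,r,s)=\Phi(-|\kappa|^{1/(n+1)}t,r,s)$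 solves the affine normal flow: $\frac{d}{dt}\varphi(t,r,s)=W_{\varphi(t,r,s)}$ for all $t\in\mathbb R$, $r\in M$, $s\in\mathbb R^n$. -/

import Mathlib

open Set Filter Topology
open scoped ContDiff Matrix

namespace RuledHypersurface

noncomputable section

/-! Exterior algebra of alternating forms. -/

/-- The wedge product of real-valued alternating forms: the sum over shuffles, with the convention
`(dx ∧ dy) (∂x, ∂y) = 1`. -/
def wedge {E : Type*} [AddCommGroup E] [Module ℝ E] {k l : ℕ}
    (a : E [⋀^Fin k]→ₗ[ℝ] ℝ) (b : E [⋀^Fin l]→ₗ[ℝ] ℝ) : E [⋀^Fin (k + l)]→ₗ[ℝ] ℝ :=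
  ((LinearMap.mul' ℝ ℝ).compAlternatingMap (a.domCoprod b)).domDomCongr finSumFinEquiv

/-- The wedge powers `b ^ k` of a two-form `b`. -/
def wedgePow {E : Type*} [AddCommGroup E] [Module ℝ E]
    (b : E [⋀^Fin 2]→ₗ[ℝ] ℝ) : (k : ℕ) → E [⋀^Fin (2 * k)]→ₗ[ℝ] ℝ
  | 0 => AlternatingMap.constOfIsEmpty ℝ E (Fin 0) (1 : ℝ)
  | k + 1 => wedge (wedgePow b k) b

/-! Hypersurfaces of a flat affine space with a parallel volume form.

A vector field along a hypersurface `S` is given by a vector field of the ambient space which is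
smooth near every point of `S`; only its values on `S` matter. The flat connection is the directional
derivative `fderiv`. -/

section Hypersurface

variable {E : Type*} [NormedAddCommGroup E] [NormedSpace ℝ E]

/-- `S` is a smooth (embedded) hypersurface: near each of its points it is the zero set of a smooth
function with nonvanishing differential. -/
def IsSmoothHypersurface (S : Set E) : Prop :=
  ∀ p ∈ S, ∃ (W : Set E) (f : E → ℝ), IsOpen W ∧ p ∈ W ∧ ContDiffOn ℝ ∞ f W ∧
    (∀ q ∈ W, fderiv ℝ f q ≠ 0) ∧ S ∩ W = {q ∈ W | f q = 0}

/-- The tangent space of `S` at `p`: the span of the velocities of smooth curves in `S` through `p`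
(for a smooth hypersurface these velocities already form a linear subspace). -/
def tangentSpaceAt (S : Set E) (p : E) : Submodule ℝ E :=
  Submodule.span ℝ {v | ∃ γ : ℝ → E, ContDiffAt ℝ ∞ γ 0 ∧ γ 0 = p ∧ (∀ᶠ s in 𝓝 0, γ s ∈ S) ∧
    deriv γ 0 = v}

/-- A smooth vector field tangent to `S`. -/
def IsTangentField (S : Set E) (Y : E → E) : Prop :=
  ∀ p ∈ S, ContDiffAt ℝ ∞ Y p ∧ Y p ∈ tangentSpaceAt S p

/-- A smooth vector field transverse to the hypersurface `S`. -/
def IsTransversal (S : Set E) (ξ : E → E) : Prop :=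
  ∀ p ∈ S, ContDiffAt ℝ ∞ ξ p ∧ ξ p ∉ tangentSpaceAt S p

/-- `h` represents the second fundamental form of `S` with respect to `ξ`: for `X`, `Y` tangent,
`D_X Y = ∇_X Y + h(X, Y) ξ` with `∇_X Y` tangent. -/
def IsSecondFundamentalForm (S : Set E) (ξ : E → E)
    (h : (p : E) → LinearMap.BilinForm ℝ (tangentSpaceAt S p)) : Prop :=
  ∀ p (hp : p ∈ S) (X : tangentSpaceAt S p) (Y : E → E) (hY : IsTangentField S Y),
    fderiv ℝ Y p X - h p X ⟨Y p, (hY p hp).2⟩ • ξ p ∈ tangentSpaceAt S p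

/-- `A` is the shape operator and `τ` the connection one-form of `S` with respect to `ξ`:
`D_X ξ = - A X + τ(X) ξ`. -/
def IsShapeOperator (S : Set E) (ξ : E → E)
    (A : (p : E) → Module.End ℝ (tangentSpaceAt S p))
    (τ : (p : E) → Module.Dual ℝ (tangentSpaceAt S p)) : Prop :=
  ∀ p ∈ S, ∀ X : tangentSpaceAt S p, fderiv ℝ ξ p X = -(A p X : E) + τ p X • ξ p

/-- The hypersurface `S` is nondegenerate: it admits a transversal, with respect to which the second
fundamental form is nondegenerate at every point. -/
def IsNondegenerate (S : Set E) : Prop :=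
  ∃ (ξ : E → E) (h : (p : E) → LinearMap.BilinForm ℝ (tangentSpaceAt S p)),
    IsTransversal S ξ ∧ IsSecondFundamentalForm S ξ h ∧ ∀ p ∈ S, (h p).Nondegenerate

/-- `ξ` is an equiaffine normal of the `m`-dimensional hypersurface `S`, with equiaffine metric `h`
and equiaffine shape operator `A`. The induced volume form is `θ = i(ξ)Ψ`; its density equals the
volume density `|det h|^{1/2}` of `h`, and `θ` is parallel for the induced connection
`∇_X Y = D_X Y - h(X, Y) ξ`. -/
structure IsEquiaffineNormal {m : ℕ} (Ψ : E [⋀^Fin (m + 1)]→ₗ[ℝ] ℝ) (S : Set E) (ξ : E → E)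
    (h : (p : E) → LinearMap.BilinForm ℝ (tangentSpaceAt S p))
    (A : (p : E) → Module.End ℝ (tangentSpaceAt S p)) : Prop where
  transversal : IsTransversal S ξ
  secondForm : IsSecondFundamentalForm S ξ h
  shape : ∃ τ, IsShapeOperator S ξ A τ
  volume : ∀ p ∈ S, ∀ X : Fin m → tangentSpaceAt S p,
    |Ψ (Fin.cons (ξ p) fun i => (X i : E))| = √|(Matrix.of fun i j => h p (X i) (X j)).det|
  parallel : ∀ p (hp : p ∈ S) (X : tangentSpaceAt S p) (Y : Fin m → E → E)
    (hY : ∀ i, IsTangentField S (Y i)),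
    fderiv ℝ (fun q => Ψ (Fin.cons (ξ q) fun i => Y i q)) p X =
      ∑ i, Ψ (Fin.cons (ξ p) (Function.update (fun j => Y j p) i
        (fderiv ℝ (Y i) p X - h p X ⟨Y i p, (hY i p hp).2⟩ • ξ p)))

/-- `ξ` and `η` point to the same side of `S`: they induce the same co-orientation. -/
def SameCoorientation (S : Set E) (ξ η : E → E) : Prop :=
  ∀ p ∈ S, ∃ c : ℝ, 0 < c ∧ ξ p - c • η p ∈ tangentSpaceAt S p

/-- The mean curvature of an `m`-dimensional hypersurface with shape operator `A`. -/
def meanCurvature (m : ℕ) {S : Set E} (A : (p : E) → Module.End ℝ (tangentSpaceAt S p)) (p : E) : ℝ :=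
  (m : ℝ)⁻¹ * LinearMap.trace ℝ (tangentSpaceAt S p) (A p)

/-- `L` is a ruling of `S` by `k`-planes: `L p` is the leaf through `p`; the leaves are affine
`k`-planes contained in `S`, they partition `S`, and their tangent distribution is smooth. -/
structure IsRuling (k : ℕ) (S : Set E) (L : E → AffineSubspace ℝ E) : Prop where
  mem : ∀ p ∈ S, p ∈ L p
  subset : ∀ p ∈ S, (L p : Set E) ⊆ S
  finrank : ∀ p ∈ S, Module.finrank ℝ (L p).direction = k
  eq_of_mem : ∀ p ∈ S, ∀ q ∈ L p, L q = L p
  smooth : ∀ p ∈ S, ∃ T : Fin k → E → E, (∀ i, ContDiffAt ℝ ∞ (T i) p) ∧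
    ∀ᶠ q in 𝓝[S] p, Submodule.span ℝ (range fun i => T i q) = (L q).direction

/-- A ruling is cylindrical if its leaves are parallel. -/
def IsCylindrical (S : Set E) (L : E → AffineSubspace ℝ E) : Prop :=
  ∀ p ∈ S, ∀ q ∈ S, (L p).Parallel (L q)

/-- The subspace `W` of `T` is Lagrangian for the two-form `w` on `T`: it is its own orthogonal. -/
def IsLagrangian (w : E [⋀^Fin 2]→L[ℝ] ℝ) (T W : Submodule ℝ E) : Prop :=
  W ≤ T ∧ ∀ X ∈ T, X ∈ W ↔ ∀ Y ∈ W, w ![X, Y] = 0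

/-- The restriction of the two-form `w` to the hypersurface `S` is symplectic: closed and
nondegenerate on tangent spaces. -/
def IsSymplecticOn (S : Set E) (w : E → E [⋀^Fin 2]→L[ℝ] ℝ) : Prop :=
  ∀ p ∈ S, (∀ X ∈ tangentSpaceAt S p, ∀ Y ∈ tangentSpaceAt S p, ∀ Z ∈ tangentSpaceAt S p,
      extDeriv w p ![X, Y, Z] = 0) ∧
    ∀ X ∈ tangentSpaceAt S p, (∀ Y ∈ tangentSpaceAt S p, w p ![X, Y] = 0) → X = 0

/-- The one-form `b` is a contact form on the open subset `W` of a `(2 n + 1)`-dimensional space. -/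
def IsContactOn (n : ℕ) (W : Set E) (b : E → E [⋀^Fin 1]→L[ℝ] ℝ) : Prop :=
  ∀ p ∈ W, wedge (b p).toAlternatingMap (wedgePow (extDeriv b p).toAlternatingMap n) ≠ 0

/-- `R` is the Reeb field of `b` on `W`: `b(R) = 1` and `i(R) db = 0`. -/
def IsReebOn (W : Set E) (b : E → E [⋀^Fin 1]→L[ℝ] ℝ) (R : E → E) : Prop :=
  ∀ p ∈ W, b p ![R p] = 1 ∧ ∀ Y, extDeriv b p ![R p, Y] = 0

/-- `f` is a parameterization of `S` by the open set `D`: a smooth bijection of `D` onto `S` whose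
inverse extends smoothly near every point of `S`. -/
def IsParameterization {P : Type*} [NormedAddCommGroup P] [NormedSpace ℝ P]
    (D : Set P) (S : Set E) (f : P → E) : Prop :=
  IsOpen D ∧ ContDiffOn ℝ ∞ f D ∧ f '' D = S ∧
    ∃ g : E → P, (∀ y ∈ S, ContDiffAt ℝ ∞ g y) ∧ ∀ z ∈ D, g (f z) = z

end Hypersurface

/-! The function `F(u, x) = ⟨A(u), x⟩ + Q(u)` and the objects attached to it. -/

/-- The space `ℝⁿ × (ℝⁿ⁺¹)*` in equiaffine coordinates `(u, x)`; the pairing of `ℝⁿ⁺¹` with its dual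
is the dot product. -/
abbrev Space (n : ℕ) : Type := (Fin n → ℝ) × (Fin (n + 1) → ℝ)

/-- The coordinate frame `∂_{u¹}, …, ∂_{uⁿ}, ∂_{x₁}, …, ∂_{xₙ₊₁}`. -/
def frame (n : ℕ) : Module.Basis (Fin n ⊕ Fin (n + 1)) ℝ (Space n) :=
  (Pi.basisFun ℝ (Fin n)).prod (Pi.basisFun ℝ (Fin (n + 1)))

/-- The volume form `Υ = du¹ ∧ … ∧ duⁿ ∧ dx₁ ∧ … ∧ dxₙ₊₁`. -/
def volumeForm (n : ℕ) : Space n [⋀^Fin (n + (n + 1))]→ₗ[ℝ] ℝ :=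
  ((frame n).reindex finSumFinEquiv).det

/-- The Hessian of `F` as a bilinear form. -/
def hess {n : ℕ} (F : Space n → ℝ) (p X Y : Space n) : ℝ :=
  fderiv ℝ (fderiv ℝ F) p X Y

/-- The matrix of the Hessian in the coordinate frame. -/
def hessMatrix {n : ℕ} (F : Space n → ℝ) (p : Space n) :
    Matrix (Fin n ⊕ Fin (n + 1)) (Fin n ⊕ Fin (n + 1)) ℝ :=
  Matrix.of fun i j => hess F p (frame n i) (frame n j)

/-- The components of `dF`. -/
def gradient {n : ℕ} (F : Space n → ℝ) (p : Space n) : Fin n ⊕ Fin (n + 1) → ℝ :=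
  fun i => fderiv ℝ F p (frame n i)

/-- The vector field `Nⁱ = Uⁱʲ F_j`, where `U` is the adjugate of the Hessian. -/
def fieldN {n : ℕ} (F : Space n → ℝ) (p : Space n) : Space n :=
  (frame n).equivFun.symm ((hessMatrix F p).adjugate *ᵥ gradient F p)

/-- `𝒰(F) = Uⁱʲ F_i F_j`. -/
def fnU {n : ℕ} (F : Space n → ℝ) (p : Space n) : ℝ :=
  gradient F p ⬝ᵥ ((hessMatrix F p).adjugate *ᵥ gradient F p)

/-- `F(u, x) = ⟨A(u), x⟩ + Q(u)`. -/
def fnF {n : ℕ} (A : (Fin n → ℝ) → Fin (n + 1) → ℝ) (Q : (Fin n → ℝ) → ℝ) (p : Space n) : ℝ :=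
  A p.1 ⬝ᵥ p.2 + Q p.1

/-- The level set `{(u, x) ∈ M × (ℝⁿ⁺¹)* : F(u, x) = t}`. -/
def levelSet {n : ℕ} (M : Set (Fin n → ℝ)) (F : Space n → ℝ) (t : ℝ) : Set (Space n) :=
  {p | p.1 ∈ M ∧ F p = t}

/-- The `(n + 1) × n` matrix of `dA`, with columns `A_I = ∂A / ∂u^I`. -/
def jacobian {n : ℕ} (A : (Fin n → ℝ) → Fin (n + 1) → ℝ) (u : Fin n → ℝ) :
    Matrix (Fin (n + 1)) (Fin n) ℝ :=
  Matrix.of fun i I => fderiv ℝ A u (Pi.single I 1) i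

/-- The determinant `|A dA| = |A A₁ … Aₙ|`. -/
def detA {n : ℕ} (A : (Fin n → ℝ) → Fin (n + 1) → ℝ) (u : Fin n → ℝ) : ℝ :=
  (Matrix.of fun i => (Fin.cons (A u i) (jacobian A u i) : Fin (n + 1) → ℝ)).det

/-- The vector field `V = ∑ᵢ (-1)^(i+1) dA^(i) ∂_{xᵢ}` (here the index starts from `0`), with `dA^(i)`
the determinant of `dA` with its `i`-th row deleted. -/
def fieldV {n : ℕ} (A : (Fin n → ℝ) → Fin (n + 1) → ℝ) (p : Space n) : Space n :=
  (0, fun i => (-1) ^ (i : ℕ) * ((jacobian A p.1).submatrix i.succAbove id).det)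

/-- The pullback `A^*(μ)` at `u` of the `n`-form `μ = i(𝔼)Ψ`, where `𝔼` is the radial field. -/
def pullbackMu {n : ℕ} (A : (Fin n → ℝ) → Fin (n + 1) → ℝ) (u : Fin n → ℝ) :
    (Fin n → ℝ) [⋀^Fin n]→ₗ[ℝ] ℝ :=
  ((Pi.basisFun ℝ (Fin (n + 1))).det.curryLeft (A u)).compLinearMap
    (fderiv ℝ A u : (Fin n → ℝ) →ₗ[ℝ] Fin (n + 1) → ℝ)

/-- `A` is an immersion of `M`. -/
def IsImmersionOn {n : ℕ} (M : Set (Fin n → ℝ)) (A : (Fin n → ℝ) → Fin (n + 1) → ℝ) : Prop :=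
  ∀ u ∈ M, Function.Injective (fderiv ℝ A u)

/-- `A` is a centroaffine immersion of `M`: an immersion whose image avoids the origin and is
transverse to the radial field. -/
def IsCentroaffineOn {n : ℕ} (M : Set (Fin n → ℝ)) (A : (Fin n → ℝ) → Fin (n + 1) → ℝ) : Prop :=
  IsImmersionOn M A ∧ ∀ u ∈ M, A u ≠ 0 ∧ A u ∉ range (fderiv ℝ A u)

/-- The one-form `β = ⟨A, dx⟩ = ∑ᵢ aⁱ dxᵢ`. -/
def formBeta {n : ℕ} (A : (Fin n → ℝ) → Fin (n + 1) → ℝ) (p : Space n) :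
    Space n [⋀^Fin 1]→L[ℝ] ℝ :=
  ContinuousAlternatingMap.ofSubsingleton ℝ (Space n) ℝ (0 : Fin 1)
    (∑ i, A p.1 i • (ContinuousLinearMap.proj i ∘L
      ContinuousLinearMap.snd ℝ (Fin n → ℝ) (Fin (n + 1) → ℝ)))

/-- The two-form `Ω = dβ`. -/
def formOmega {n : ℕ} (A : (Fin n → ℝ) → Fin (n + 1) → ℝ) (p : Space n) :
    Space n [⋀^Fin 2]→L[ℝ] ℝ :=
  extDeriv (formBeta A) p

/-- The map `Φ(t, r, s) = (r, κ⁻¹ (t - Q(r)) V + ∑_I s^I (a^(I+1) ∂_{x_I} - a^I ∂_{x_(I+1)}))`. -/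
def mapPhi {n : ℕ} (A : (Fin n → ℝ) → Fin (n + 1) → ℝ) (Q : (Fin n → ℝ) → ℝ) (κ t : ℝ)
    (r s : Fin n → ℝ) : Space n :=
  (r, (κ⁻¹ * (t - Q r)) • (fieldV A (r, 0)).2 +
    ∑ I : Fin n, s I • (A r I.succ • Pi.single I.castSucc 1 - A r I.castSucc • Pi.single I.succ 1))

/-- The points of `M` at which none of the components `a², …, aⁿ` of `A` vanishes. -/
def goodSet {n : ℕ} (M : Set (Fin n → ℝ)) (A : (Fin n → ℝ) → Fin (n + 1) → ℝ) : Set (Fin n → ℝ) :=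
  {u ∈ M | ∀ i : Fin (n + 1), i ≠ 0 → i ≠ Fin.last n → A u i ≠ 0}

end

end RuledHypersurface

open RuledHypersurface

namespace RuledHypersurface

noncomputable section

/-! ### Evaluation of wedge products -/

section Wedge

open Equiv

variable {E : Type*} [AddCommGroup E] [Module ℝ E]

/-! Since `F` is affine in `x`, its Hessian is a bordered matrix `[[H, Jᵀ], [J, 0]]` with `J = dA`,
and `H` turns out to be irrelevant. The key identity is `det_fromBlocks_vecMulVec`: putting the rank
one matrix `a bᵀ` into the zero block gives determinant `(-1)ⁿ |a J| |b J|`. Taking `a` and `b` to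
be unit vectors yields the adjugate; taking `a = b = A` gives the relation between the Hessian and
the volume form. The vector `w` of signed maximal minors of `J` (the `x`-part of `V`) annihilates
the image of `J` and satisfies `⟨a, w⟩ = |a J|`. Hence `V` lies in the radical and `dF(V) = |A dA|`,
and being centroaffine means exactly that this number does not vanish.

The forms `β` and `Ω` at a point are pullbacks of the standard contact form and its differential at
the origin under the linear map `id × Kᵀ`, `K = (A | dA)`. So `β ∧ Ωⁿ` is `det K = |A dA|` times a
universal constant, the sign of a shuffle times `n!`.

On a level set the tangent space is `ker dF`, and the second fundamental form for a transversal `ξ`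
is `-Hess F / dF(ξ)`. By `sq_volumeForm_cons_fieldV`, `det Hess F(Xᵢ, Xⱼ) = (-1)ⁿ Υ(V, X)²`, so when
`|A dA| = κ` the volume condition on `ξ` becomes `|dF(ξ)|^(n+1) = |κ|`. As `κ` is constant, `DV` is
tangent, and a suitable constant multiple of `V` is an equiaffine normal. For uniqueness, the volume
condition and the co-orientation fix `dF(W)`; parallelism then makes `W` Hessian-orthogonal to the
tangent space, on which the Hessian is nondegenerate.

Finally `V` depends only on `u` and has only `x`-components. Therefore `S` kills tangent vectors
with zero `u`-part and takes values among them, so `S² = 0` and `tr S = 0`. These vectors are the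
directions of the leaves `{u} × {⟨A(u), x⟩ = const}`; they are isotropic for the metric, which
forces split signature, and Lagrangian for `Ω`. The map `Φ` uses explicit vectors annihilated by `A`
to coordinatize each leaf. -/

theorem modSumCongr_mk_eq_iff {α β : Type*} [Finite α] [Finite β] {σ τ : Perm (α ⊕ β)} :
    (Quotient.mk'' τ : Perm.ModSumCongr α β) = Quotient.mk'' σ ↔
      ∀ s, ∃ s', σ (Sum.inr s) = τ (Sum.inr s') := by
  rw [Quotient.eq'', QuotientGroup.leftRel_apply]
  constructor
  · rintro ⟨⟨sl, sr⟩, h⟩ s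
    refine ⟨sr s, ?_⟩
    have h' := Equiv.congr_fun h (Sum.inr s)
    simp only [Perm.sumCongrHom_apply, Equiv.sumCongr_apply, Sum.map_inr, Perm.coe_mul,
      Function.comp_apply] at h'
    rw [h']
    simp
  · intro h
    apply Perm.mem_sumCongrHom_range_of_perm_mapsTo_inl
    rw [Perm.perm_mapsTo_inl_iff_mapsTo_inr]
    rintro _ ⟨s, rfl⟩
    obtain ⟨s', hs'⟩ := h s
    refine ⟨s', ?_⟩
    simp [hs']

/-- The wedge is a sum over cosets of permutations modulo those preserving the two blocks, and a
coset is determined by the image of the right block. If `τ` hits every coset with a nonzero summand,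
and none twice, the sum may be taken over `τ` alone. -/
theorem wedge_apply_eq_sum {k l : ℕ} (a : E [⋀^Fin k]→ₗ[ℝ] ℝ) (b : E [⋀^Fin l]→ₗ[ℝ] ℝ)
    (v : Fin k ⊕ Fin l → E) {ι : Type*} [Fintype ι] (τ : ι → Perm (Fin k ⊕ Fin l))
    (hτ : ∀ i j, (∀ s, ∃ s', τ j (Sum.inr s) = τ i (Sum.inr s')) → i = j)
    (h0 : ∀ σ : Perm (Fin k ⊕ Fin l), a (fun j => v (σ (Sum.inl j))) ≠ 0 →
      b (fun j => v (σ (Sum.inr j))) ≠ 0 → ∃ i, ∀ s, ∃ s', σ (Sum.inr s) = τ i (Sum.inr s')) :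
    wedge a b (v ∘ finSumFinEquiv.symm) = ∑ i, ((Perm.sign (τ i) : ℤ) : ℝ) *
      (a (fun j => v (τ i (Sum.inl j))) * b (fun j => v (τ i (Sum.inr j)))) := by
  classical
  have key : ∀ σ : Perm (Fin k ⊕ Fin l), LinearMap.mul' ℝ ℝ
      (AlternatingMap.domCoprod.summand a b (Quotient.mk'' σ) v) = ((Perm.sign σ : ℤ) : ℝ) *
        (a (fun j => v (σ (Sum.inl j))) * b (fun j => v (σ (Sum.inr j)))) := by
    intro σ
    rw [AlternatingMap.domCoprod.summand_mk'']
    rcases Int.units_eq_one_or (Perm.sign σ) with h | h <;> simp [h]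
  have h1 : wedge a b (v ∘ finSumFinEquiv.symm) = ∑ σ : Perm.ModSumCongr (Fin k) (Fin l),
      LinearMap.mul' ℝ ℝ (AlternatingMap.domCoprod.summand a b σ v) := by
    simp only [wedge, AlternatingMap.domDomCongr_apply, LinearMap.compAlternatingMap_apply,
      AlternatingMap.domCoprod_apply, sum_apply, map_sum]
    simp [Function.comp_def]
  rw [h1]
  simp_rw [← key]
  have hinj : Function.Injective
      (fun i => (Quotient.mk'' (τ i) : Perm.ModSumCongr (Fin k) (Fin l))) := by
    intro i j hij
    exact hτ i j (modSumCongr_mk_eq_iff.1 hij)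
  rw [← Finset.sum_image (s := Finset.univ) (f := fun σ => LinearMap.mul' ℝ ℝ
    (AlternatingMap.domCoprod.summand a b σ v))
    (g := fun i => (Quotient.mk'' (τ i) : Perm.ModSumCongr (Fin k) (Fin l))) hinj.injOn]
  symm
  apply Finset.sum_subset (Finset.subset_univ _)
  intro σ _ hσ
  induction σ using Quotient.inductionOn' with
  | h σ =>
    rw [key]
    by_contra hne
    have hne' := right_ne_zero_of_mul hne
    obtain ⟨i, hi⟩ := h0 σ (left_ne_zero_of_mul hne') (right_ne_zero_of_mul hne')
    exact hσ (Finset.mem_image.2 ⟨i, Finset.mem_univ _, modSumCongr_mk_eq_iff.2 hi⟩)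

/-- The standard symplectic matrix, for a basis listed as `e₀, f₀, e₁, f₁, …`. -/
def stdSymplectic (i j : ℕ) : ℝ :=
  if i % 2 = 0 ∧ j = i + 1 then 1 else if j % 2 = 0 ∧ i = j + 1 then -1 else 0

theorem stdSymplectic_ne_zero {i j : ℕ} (h : stdSymplectic i j ≠ 0) :
    (i % 2 = 0 ∧ j = i + 1) ∨ (j % 2 = 0 ∧ i = j + 1) := by
  unfold stdSymplectic at h
  split_ifs at h <;> tauto

/-- The even permutation exchanging the `m`-th pair and the last pair. -/
def pairSwap {k : ℕ} : Option (Fin k) → Perm (Fin (2 * k) ⊕ Fin 2)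
  | none => 1
  | some m => swap (Sum.inl ⟨2 * m, by omega⟩) (Sum.inr 0) *
      swap (Sum.inl ⟨2 * m + 1, by omega⟩) (Sum.inr 1)

theorem sign_pairSwap {k : ℕ} (m : Option (Fin k)) : Perm.sign (pairSwap m) = 1 := by
  rcases m with _ | m <;> simp [pairSwap]

theorem pairSwap_some_inr {k : ℕ} (m : Fin k) (s : Fin 2) :
    pairSwap (some m) (Sum.inr s) = Sum.inl ⟨2 * m + s, by omega⟩ := by
  fin_cases s
  · simp [pairSwap, swap_apply_def]
  · simp [pairSwap, swap_apply_def]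

theorem pairSwap_some_inl {k : ℕ} (m : Fin k) (j : Fin (2 * k)) :
    pairSwap (some m) (Sum.inl j) =
      if (j : ℕ) = 2 * m then Sum.inr 0 else if (j : ℕ) = 2 * m + 1 then Sum.inr 1
      else Sum.inl j := by
  simp only [pairSwap, Perm.coe_mul, Function.comp_apply, swap_apply_def, Sum.inl.injEq,
    Fin.ext_iff]
  split_ifs <;> grind

/-- Induction on `k`: the last factor `b` is nonzero only when its two slots hold one of the `k + 1`
symplectic pairs. Each choice contributes `k!`, because exchanging pairs is even and leaves a
symplectic list for the other slots. -/
theorem wedgePow_apply_of_stdSymplectic (b : E [⋀^Fin 2]→ₗ[ℝ] ℝ) (k : ℕ) (v : ℕ → E)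
    (hv : ∀ i j, i < 2 * k → j < 2 * k → b ![v i, v j] = stdSymplectic i j) :
    wedgePow b k (fun i => v i) = k.factorial := by
  induction k generalizing v with
  | zero => simp [wedgePow]
  | succ k ih =>
    let w : Fin (2 * k) ⊕ Fin 2 → E := Sum.elim (fun i => v i) (fun s => v (2 * k + s))
    have hw : (fun i : Fin (2 * (k + 1)) => v i) = w ∘ finSumFinEquiv.symm := by
      rw [Equiv.eq_comp_symm]
      ext1 x
      rcases x with x | x
      · exact congrArg v (congrArg Fin.val (finSumFinEquiv_apply_left x))
      · exact congrArg v (congrArg Fin.val (finSumFinEquiv_apply_right x))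
    let pos : Fin (2 * k) ⊕ Fin 2 → ℕ := Sum.elim (fun i => i) (fun s => 2 * k + s)
    have hpos : ∀ x, w x = v (pos x) := by rintro (x | x) <;> rfl
    have hlt : ∀ x, pos x < 2 * (k + 1) := by
      rintro (x | x) <;> simp only [pos, Sum.elim_inl, Sum.elim_inr] <;> omega
    have h2 : ∀ f : Fin 2 → E, f = ![f 0, f 1] := fun f => by
      ext i; fin_cases i <;> rfl
    have hb : ∀ x y, b ![w x, w y] = stdSymplectic (pos x) (pos y) := fun x y => by
      rw [hpos, hpos, hv _ _ (hlt x) (hlt y)]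
    have main := wedge_apply_eq_sum (wedgePow b k) b w pairSwap ?_ ?_
    · rw [hw]
      refine Eq.trans main ?_
      have hterm : ∀ m : Option (Fin k), ((Perm.sign (pairSwap m) : ℤ) : ℝ) *
          (wedgePow b k (fun j => w (pairSwap m (Sum.inl j))) *
            b (fun j => w (pairSwap m (Sum.inr j)))) = k.factorial := by
        rintro (_ | m)
        · rw [sign_pairSwap, h2 fun j => w (pairSwap none (Sum.inr j))]
          have h3 : b ![w (pairSwap none (Sum.inr 0)), w (pairSwap none (Sum.inr 1))] = 1 := by
            rw [hb]
            simp [pairSwap, stdSymplectic, pos]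
          have h4 := ih v fun i j hi hj => hv i j (by omega) (by omega)
          rw [h3, mul_one, Units.val_one, Int.cast_one, one_mul, ← h4]
          rfl
        · rw [sign_pairSwap, h2 fun j => w (pairSwap (some m) (Sum.inr j))]
          have h3 : b ![w (pairSwap (some m) (Sum.inr 0)), w (pairSwap (some m) (Sum.inr 1))]
              = 1 := by
            rw [hb, pairSwap_some_inr, pairSwap_some_inr]
            simp [stdSymplectic, pos]
          -- The list remaining on the left after the exchange: the `m`-th pair is replaced by the
          -- last one, and the list is still standard symplectic.
          have h4 := ih (fun i => if i = 2 * m then v (2 * k) else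
            if i = 2 * m + 1 then v (2 * k + 1) else v i) ?_
          · rw [h3, mul_one, Units.val_one, Int.cast_one, one_mul, ← h4]
            congr 1
            ext1 j
            rw [pairSwap_some_inl]
            split_ifs <;> rfl
          · intro i j hi hj
            have hm := m.2
            split_ifs <;> rw [hv _ _ (by omega) (by omega)] <;> unfold stdSymplectic <;>
              refine if_congr (by omega) rfl (if_congr (by omega) rfl rfl)
      rw [Finset.sum_congr rfl fun m _ => hterm m]
      simp [Nat.factorial_succ]
    · rintro (_ | i) (_ | j) hij
      · rfl
      · obtain ⟨s', hs'⟩ := hij 0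
        rw [pairSwap_some_inr] at hs'
        simp [pairSwap] at hs'
      · obtain ⟨s', hs'⟩ := hij 0
        rw [pairSwap_some_inr] at hs'
        simp [pairSwap] at hs'
      · obtain ⟨s', hs'⟩ := hij 0
        rw [pairSwap_some_inr, pairSwap_some_inr] at hs'
        simp only [Sum.inl.injEq, Fin.ext_iff] at hs'
        have := s'.2
        have h0 : ((0 : Fin 2) : ℕ) = 0 := rfl
        congr 1
        ext
        omega
    · intro σ _ hσ
      rw [h2 fun j => w (σ (Sum.inr j)), hb] at hσ
      have hpinj : ∀ x y, pos x = pos y → x = y := by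
        rintro (x | x) (y | y) h <;> simp only [pos, Sum.elim_inl, Sum.elim_inr] at h
        · exact congrArg _ (Fin.ext h)
        · have := x.2; omega
        · have := y.2; omega
        · exact congrArg _ (Fin.ext (by omega))
      have hl0 := hlt (σ (Sum.inr 0))
      have hl1 := hlt (σ (Sum.inr 1))
      -- A nonzero value of `b` forces the right block to hold a pair `2m, 2m + 1` in some order;
      -- the order does not affect the coset.
      have hex : ∃ m, (pos (σ (Sum.inr 0)) = 2 * m ∧ pos (σ (Sum.inr 1)) = 2 * m + 1) ∨
          (pos (σ (Sum.inr 0)) = 2 * m + 1 ∧ pos (σ (Sum.inr 1)) = 2 * m) := by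
        rcases stdSymplectic_ne_zero hσ with h | h
        · exact ⟨pos (σ (Sum.inr 0)) / 2, by omega⟩
        · exact ⟨pos (σ (Sum.inr 1)) / 2, by omega⟩
      obtain ⟨m, hm⟩ := hex
      have hrep : ∃ i : Option (Fin k), ∀ s, pos (pairSwap i (Sum.inr s)) = 2 * m + s := by
        rcases Nat.lt_or_ge m k with hmk | hmk
        · refine ⟨some ⟨m, hmk⟩, fun s => ?_⟩
          rw [pairSwap_some_inr]
          rfl
        · obtain rfl : m = k := by omega
          exact ⟨none, fun s => rfl⟩
      obtain ⟨i, hi⟩ := hrep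
      have e0 : pos (pairSwap i (Sum.inr 0)) = 2 * m := hi 0
      have e1 : pos (pairSwap i (Sum.inr 1)) = 2 * m + 1 := hi 1
      refine ⟨i, ?_⟩
      rw [Fin.forall_fin_two]
      rcases hm with ⟨h0, h1⟩ | ⟨h0, h1⟩
      · exact ⟨⟨0, hpinj _ _ (by omega)⟩, ⟨1, hpinj _ _ (by omega)⟩⟩
      · exact ⟨⟨1, hpinj _ _ (by omega)⟩, ⟨0, hpinj _ _ (by omega)⟩⟩

/-- As `a` kills every listed vector except the first, only the identity coset survives, and it
contributes the value of the wedge power. -/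
theorem wedge_wedgePow_apply_of_stdSymplectic (a : E [⋀^Fin 1]→ₗ[ℝ] ℝ) (b : E [⋀^Fin 2]→ₗ[ℝ] ℝ)
    (n : ℕ) (v : ℕ → E) (ha0 : a ![v 0] = 1) (ha : ∀ i < 2 * n, a ![v (1 + i)] = 0)
    (hb : ∀ i j, i < 2 * n → j < 2 * n → b ![v (1 + i), v (1 + j)] = stdSymplectic i j) :
    wedge a (wedgePow b n) (fun i => v i) = n.factorial := by
  let w : Fin 1 ⊕ Fin (2 * n) → E := Sum.elim (fun i => v i) (fun s => v (1 + s))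
  have hw : (fun i : Fin (1 + 2 * n) => v i) = w ∘ finSumFinEquiv.symm := by
    rw [Equiv.eq_comp_symm]
    ext1 x
    rcases x with x | x
    · exact congrArg v (congrArg Fin.val (finSumFinEquiv_apply_left x))
    · exact congrArg v (congrArg Fin.val (finSumFinEquiv_apply_right x))
  rw [hw, wedge_apply_eq_sum a (wedgePow b n) w (fun _ : Unit => 1)]
  · have h4 := wedgePow_apply_of_stdSymplectic b n (fun i => v (1 + i)) hb
    have h5 : a (fun j => w (Sum.inl j)) = 1 := by
      rw [← ha0]
      congr 1
      ext1 j
      fin_cases j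
      rfl
    simp only [Finset.univ_unique, Perm.sign_one, Units.val_one, Int.cast_one, one_mul,
      Perm.coe_one, id_eq, Finset.sum_singleton, h5]
    exact h4
  · intro i j _
    rfl
  · intro σ hσ _
    refine ⟨(), ?_⟩
    have h0 : σ (Sum.inl 0) = Sum.inl 0 := by
      rcases hx : σ (Sum.inl 0) with x | x
      · rw [Subsingleton.elim x 0]
      · refine absurd ?_ hσ
        rw [← ha x x.2]
        congr 1
        ext1 j
        fin_cases j
        simp [hx, w]
    intro s
    rcases hx : σ (Sum.inr s) with x | x
    · rw [Subsingleton.elim x 0, ← h0] at hx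
      exact absurd (σ.injective hx) (by simp)
    · exact ⟨x, rfl⟩

theorem wedge_compLinearMap {E' : Type*} [AddCommGroup E'] [Module ℝ E'] {k l : ℕ}
    (a : E [⋀^Fin k]→ₗ[ℝ] ℝ) (b : E [⋀^Fin l]→ₗ[ℝ] ℝ) (f : E' →ₗ[ℝ] E) :
    wedge (a.compLinearMap f) (b.compLinearMap f) = (wedge a b).compLinearMap f := by
  ext v
  simp only [wedge, AlternatingMap.domDomCongr_apply, LinearMap.compAlternatingMap_apply,
    AlternatingMap.domCoprod_apply, sum_apply, map_sum, AlternatingMap.compLinearMap_apply]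
  refine Finset.sum_congr rfl fun σ _ => ?_
  induction σ using Quotient.inductionOn' with
  | h σ =>
    rw [AlternatingMap.domCoprod.summand_mk'', AlternatingMap.domCoprod.summand_mk'']
    rfl

theorem wedgePow_compLinearMap {E' : Type*} [AddCommGroup E'] [Module ℝ E']
    (b : E [⋀^Fin 2]→ₗ[ℝ] ℝ) (f : E' →ₗ[ℝ] E) (k : ℕ) :
    wedgePow (b.compLinearMap f) k = (wedgePow b k).compLinearMap f := by
  induction k with
  | zero => ext v; simp [wedgePow]
  | succ k ih => rw [wedgePow, wedgePow, ih]; exact wedge_compLinearMap _ _ _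

end Wedge

/-! ### The sign of the shuffle `x₀, u₁, x₁, …, uₙ, xₙ` of `u₁, …, uₙ, x₀, …, xₙ` -/

section Shuffle

open Equiv

def shuffleFun (n : ℕ) (i : Fin (1 + 2 * n)) : Fin (1 + 2 * n) :=
  if h : (i : ℕ) < n then ⟨2 * i + 1, by omega⟩ else ⟨2 * (i - n), by omega⟩

theorem shuffleFun_injective (n : ℕ) : Function.Injective (shuffleFun n) := by
  intro i j h
  unfold shuffleFun at h
  split_ifs at h <;> simp only [Fin.ext_iff] at h ⊢ <;> omega

def shuffle (n : ℕ) : Perm (Fin (1 + 2 * n)) :=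
  Equiv.ofBijective (shuffleFun n) (Finite.injective_iff_bijective.1 (shuffleFun_injective n))

theorem shuffle_apply (n : ℕ) (i : Fin (1 + 2 * n)) :
    (shuffle n i : ℕ) = if (i : ℕ) < n then 2 * (i : ℕ) + 1 else 2 * (i - n) := by
  show (shuffleFun n i : ℕ) = _
  unfold shuffleFun
  split_ifs <;> rfl

/-- Counting inversions: the `u`-vector at position `i < n` has to pass the `i + 1` vectors `x₀, …,
xᵢ`, and the `x`-vectors keep their order. The total is `1 + … + n`. -/
theorem sign_shuffle (n : ℕ) : Perm.sign (shuffle n) = (-1) ^ (n * (n + 1) / 2) := by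
  rw [Perm.sign_eq_prod_prod_Ioi]
  have h1 : ∀ i : Fin (1 + 2 * n), (∏ j ∈ Finset.Ioi i,
      if shuffle n i < shuffle n j then (1 : ℤˣ) else -1) =
      if (i : ℕ) < n then (-1) ^ ((i : ℕ) + 1) else 1 := by
    intro i
    rw [Finset.prod_ite, Finset.prod_const_one, one_mul, Finset.prod_const]
    split_ifs with hi
    · congr 1
      have : Finset.filter (fun j => ¬ shuffle n i < shuffle n j) (Finset.Ioi i) =
          Finset.Icc ⟨n, by omega⟩ ⟨n + i, by omega⟩ := by
        ext j
        simp only [Finset.mem_filter, Finset.mem_Ioi, Finset.mem_Icc, Fin.lt_def, Fin.le_def,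
          shuffle_apply, if_pos hi]
        split_ifs <;> omega
      rw [this, Fin.card_Icc]
      simp only
      omega
    · rw [Finset.card_eq_zero.2, pow_zero]
      ext j
      simp only [Finset.mem_filter, Finset.mem_Ioi, Fin.lt_def, shuffle_apply, if_neg hi,
        Finset.notMem_empty, iff_false]
      split_ifs <;> omega
  rw [Finset.prod_congr rfl fun i _ => h1 i,
    Fin.prod_univ_eq_prod_range (fun i => if i < n then (-1 : ℤˣ) ^ (i + 1) else 1) (1 + 2 * n),
    ← Finset.prod_filter]
  have h2 : (Finset.range (1 + 2 * n)).filter (fun i => i < n) = Finset.range n := by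
    ext i
    simp only [Finset.mem_filter, Finset.mem_range]
    omega
  rw [h2, Finset.prod_pow_eq_pow_sum]
  congr 1
  have h3 := Finset.sum_range_id (n + 1)
  rw [Finset.sum_range_succ'] at h3
  simpa [mul_comm] using h3

end Shuffle

/-! ### Linear algebra of the bordered matrices `[[H, Jᵀ], [J, 0]]` -/

section Bordered

variable {n : ℕ}

theorem mulVec_fun_zero {m k : Type*} [Fintype k] (B : Matrix m k ℝ) :
    (B *ᵥ fun _ => 0) = 0 :=
  Matrix.mulVec_zero B

/-- The square matrix with columns `a, J₁, …, Jₙ`. -/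
def consCol (a : Fin (n + 1) → ℝ) (J : Matrix (Fin (n + 1)) (Fin n) ℝ) :
    Matrix (Fin (n + 1)) (Fin (n + 1)) ℝ :=
  Matrix.of fun i => (Fin.cons (a i) (J i) : Fin (n + 1) → ℝ)

/-- The vector of signed maximal minors of `J`. -/
def minorVec (J : Matrix (Fin (n + 1)) (Fin n) ℝ) : Fin (n + 1) → ℝ :=
  fun i => (-1) ^ (i : ℕ) * (J.submatrix i.succAbove id).det

theorem det_consCol (a : Fin (n + 1) → ℝ) (J : Matrix (Fin (n + 1)) (Fin n) ℝ) :
    (consCol a J).det = a ⬝ᵥ minorVec J := by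
  rw [Matrix.det_succ_column_zero]
  refine Finset.sum_congr rfl fun i _ => ?_
  have : (consCol a J).submatrix i.succAbove Fin.succ = J.submatrix i.succAbove id := by
    ext r c
    simp [consCol]
  rw [this]
  simp only [consCol, Matrix.of_apply, Fin.cons_zero, minorVec]
  ring

theorem consCol_mulVec (a : Fin (n + 1) → ℝ) (J : Matrix (Fin (n + 1)) (Fin n) ℝ) (z : Fin (n + 1) → ℝ) :
    consCol a J *ᵥ z = z 0 • a + J *ᵥ (fun I => z I.succ) := by
  ext i
  simp [consCol, Matrix.mulVec, dotProduct, Fin.sum_univ_succ, mul_comm]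

/-- The pairing is the determinant of `(J v | J)`, whose first column depends on the others. -/
theorem mulVec_dotProduct_minorVec (J : Matrix (Fin (n + 1)) (Fin n) ℝ) (v : Fin n → ℝ) :
    (J *ᵥ v) ⬝ᵥ minorVec J = 0 := by
  rw [← det_consCol]
  apply Matrix.exists_mulVec_eq_zero_iff.1
  refine ⟨Fin.cons (-1) v, fun h => ?_, ?_⟩
  · simpa using congrFun h 0
  · rw [consCol_mulVec]
    simp

theorem det_consCol_ne_zero_iff (a : Fin (n + 1) → ℝ) (J : Matrix (Fin (n + 1)) (Fin n) ℝ) :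
    (consCol a J).det ≠ 0 ↔ Function.Injective J.mulVec ∧ ∀ v, J *ᵥ v ≠ a := by
  constructor
  · intro h
    have hz : ∀ z, consCol a J *ᵥ z = 0 → z = 0 := fun z hz => by
      by_contra hne
      exact h (Matrix.exists_mulVec_eq_zero_iff.1 ⟨z, hne, hz⟩)
    constructor
    · intro v v' hv
      have := hz (Fin.cons 0 (v - v')) (by
        rw [consCol_mulVec]
        simp only [Fin.cons_zero, zero_smul, Fin.cons_succ, zero_add]
        exact (Matrix.mulVec_sub _ _ _).trans (sub_eq_zero.2 hv))
      ext i
      have h2 := congrFun this i.succ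
      simpa [sub_eq_zero] using h2
    · intro v hv
      have := hz (Fin.cons (-1) v) (by rw [consCol_mulVec]; simp [hv])
      simpa using congrFun this 0
  · rintro ⟨hJ, ha⟩ h
    obtain ⟨z, hz, h0⟩ := Matrix.exists_mulVec_eq_zero_iff.2 h
    rw [consCol_mulVec] at h0
    by_cases hz0 : z 0 = 0
    · rw [hz0, zero_smul, zero_add] at h0
      have := @hJ (fun I => z I.succ) 0 (by rw [h0, Matrix.mulVec_zero])
      apply hz
      ext i
      refine Fin.cases hz0 (fun I => congrFun this I) i
    · apply ha (-(z 0)⁻¹ • fun I => z I.succ)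
      rw [Matrix.mulVec_smul, eq_neg_of_add_eq_zero_right h0, smul_neg, neg_smul, neg_neg, smul_smul,
        inv_mul_cancel₀ hz0, one_smul]

theorem exists_forall_mulVec_ne (J : Matrix (Fin (n + 1)) (Fin n) ℝ) : ∃ a, ∀ v, J *ᵥ v ≠ a := by
  by_contra! h
  have h1 : Function.Surjective J.mulVecLin := fun a => h a
  have := LinearMap.finrank_le_finrank_of_surjective h1
  simp at this

theorem exists_transpose_mulVec_eq_zero (J : Matrix (Fin (n + 1)) (Fin n) ℝ) :
    ∃ y ≠ 0, Jᵀ *ᵥ y = 0 := by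
  have h := LinearMap.ker_ne_bot_of_finrank_lt (f := Jᵀ.mulVecLin) (by simp)
  obtain ⟨y, hy, hy0⟩ := Submodule.exists_mem_ne_zero_of_ne_bot h
  exact ⟨y, hy0, hy⟩

theorem minorVec_ne_zero {J : Matrix (Fin (n + 1)) (Fin n) ℝ} (hJ : Function.Injective J.mulVec) :
    minorVec J ≠ 0 := by
  obtain ⟨a, ha⟩ := exists_forall_mulVec_ne J
  intro h
  apply (det_consCol_ne_zero_iff a J).2 ⟨hJ, ha⟩
  rw [det_consCol, h, dotProduct_zero]

/-- The annihilator of the image of an injective `J` is a line. For `a` outside the image, `(a | J)`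
is invertible, so such a `y` is determined by its pairing with `a`. -/
theorem eq_smul_minorVec {J : Matrix (Fin (n + 1)) (Fin n) ℝ} (hJ : Function.Injective J.mulVec)
    {y : Fin (n + 1) → ℝ} (hy : ∀ v, (J *ᵥ v) ⬝ᵥ y = 0) : ∃ c : ℝ, y = c • minorVec J := by
  obtain ⟨a, ha⟩ := exists_forall_mulVec_ne J
  have hdet := (det_consCol_ne_zero_iff a J).2 ⟨hJ, ha⟩
  have haw : a ⬝ᵥ minorVec J ≠ 0 := by rwa [← det_consCol]
  refine ⟨(a ⬝ᵥ y) / (a ⬝ᵥ minorVec J), ?_⟩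
  rw [← sub_eq_zero]
  refine dotProduct_eq_zero _ fun x => ?_
  obtain ⟨z, rfl⟩ : ∃ z, consCol a J *ᵥ z = x :=
    ⟨(consCol a J)⁻¹ *ᵥ x, by
      rw [Matrix.mulVec_mulVec, Matrix.mul_nonsing_inv _ (isUnit_iff_ne_zero.2 hdet),
        Matrix.one_mulVec]⟩
  rw [consCol_mulVec, dotProduct_comm, add_dotProduct, smul_dotProduct, dotProduct_sub,
    dotProduct_sub, hy, dotProduct_smul, dotProduct_smul, mulVec_dotProduct_minorVec]
  simp only [smul_eq_mul]
  field_simp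
  ring

theorem eq_smul_of_orthogonal {a : Fin (n + 1) → ℝ} (ha : a ≠ 0) {b : Fin (n + 1) → ℝ}
    (h : ∀ y, a ⬝ᵥ y = 0 → b ⬝ᵥ y = 0) : ∃ c : ℝ, b = c • a := by
  have haa : a ⬝ᵥ a ≠ 0 := fun h => ha (dotProduct_self_eq_zero.1 h)
  refine ⟨(a ⬝ᵥ b) / (a ⬝ᵥ a), ?_⟩
  rw [← sub_eq_zero, ← dotProduct_self_eq_zero]
  set y := b - ((a ⬝ᵥ b) / (a ⬝ᵥ a)) • a with hy
  have h1 : a ⬝ᵥ y = 0 := by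
    rw [hy, dotProduct_sub, dotProduct_smul, smul_eq_mul]
    field_simp
    ring
  have h2 := h y h1
  conv_lhs => rw [hy]
  rw [sub_dotProduct, h2, smul_dotProduct, h1]
  simp

/-- With `P` the inclusion of `ℝⁿ` as the last `n` coordinates and `e = e₀ e₀ᵀ`, one has `(a | J) P
= J` and `(a | J) e₀ = a`. So the matrix is `diag(1, (a | J)) [[H, Pᵀ], [P, e]] diag(1, (b | J)ᵀ)`,
with no invertibility assumed, and only the universal middle factor remains to be evaluated. -/
theorem det_fromBlocks_vecMulVec (H : Matrix (Fin n) (Fin n) ℝ) (J : Matrix (Fin (n + 1)) (Fin n) ℝ)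
    (a b : Fin (n + 1) → ℝ) :
    (Matrix.fromBlocks H Jᵀ J (Matrix.vecMulVec a b)).det =
      (-1) ^ n * (consCol a J).det * (consCol b J).det := by
  let P : Matrix (Fin (n + 1)) (Fin n) ℝ := Matrix.of fun i I => if i = I.succ then 1 else 0
  let e : Matrix (Fin (n + 1)) (Fin (n + 1)) ℝ := Matrix.vecMulVec (Pi.single 0 1) (Pi.single 0 1)
  have hKP : ∀ c, consCol c J * P = J := by
    intro c
    ext i I
    simp [Matrix.mul_apply, P, consCol]
  have hKe : consCol a J * e * (consCol b J)ᵀ = Matrix.vecMulVec a b := by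
    rw [Matrix.mul_vecMulVec, Matrix.vecMulVec_mul, Matrix.vecMul_transpose, consCol_mulVec,
      consCol_mulVec]
    simp [mulVec_fun_zero]
  have hPe : Pᵀ * e = 0 := by
    rw [Matrix.mul_vecMulVec]
    have : Pᵀ *ᵥ (Pi.single 0 1) = 0 := by
      ext I
      simp [P, (Fin.succ_ne_zero I).symm]
    rw [this, Matrix.zero_vecMulVec]
  have heP : e * P = 0 := by
    have := congrArg Matrix.transpose hPe
    simpa [Matrix.transpose_mul, e, Matrix.transpose_vecMulVec] using this
  have hPP : Pᵀ * P = 1 := by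
    ext I I'
    simp [Matrix.mul_apply, P, Matrix.one_apply, eq_comm]
  have hfac : Matrix.fromBlocks H Jᵀ J (Matrix.vecMulVec a b) =
      Matrix.fromBlocks 1 0 0 (consCol a J) * Matrix.fromBlocks H Pᵀ P e *
        Matrix.fromBlocks 1 0 0 (consCol b J)ᵀ := by
    rw [Matrix.fromBlocks_multiply, Matrix.fromBlocks_multiply]
    simp only [Matrix.one_mul, Matrix.zero_mul, add_zero, Matrix.mul_one, Matrix.mul_zero, zero_add,
      hKP, hKe]
    rw [← Matrix.transpose_mul, hKP]
  -- Since `Pᵀ P = 1` and `Pᵀ e = 0`, the left factor clears `H`; the right one then puts `1` in the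
  -- corner, so that the Schur complement `e - P Pᵀ = diag(1, -1, …, -1)` gives the determinant.
  have hH : Matrix.fromBlocks 1 (-H * Pᵀ) 0 1 * Matrix.fromBlocks H Pᵀ P e *
      Matrix.fromBlocks 1 0 P 1 = Matrix.fromBlocks 1 Pᵀ P e := by
    rw [Matrix.fromBlocks_multiply, Matrix.fromBlocks_multiply]
    simp only [Matrix.one_mul, Matrix.zero_mul, add_zero, Matrix.mul_one, Matrix.mul_zero, zero_add,
      Matrix.mul_assoc, hPP, hPe, heP]
    simp
  have hdiag : e - P * Pᵀ = Matrix.diagonal (Fin.cons 1 fun _ => -1) := by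
    ext i j
    refine Fin.cases ?_ (fun i => ?_) i <;> refine Fin.cases ?_ (fun j => ?_) j <;>
      simp [e, P, Matrix.mul_apply, Matrix.vecMulVec_apply, Matrix.diagonal_apply, eq_comm]
    split_ifs <;> simp
  have hdet : (Matrix.fromBlocks H Pᵀ P e).det = (-1) ^ n := by
    have := congrArg Matrix.det hH
    rw [Matrix.det_mul, Matrix.det_mul, Matrix.det_fromBlocks_zero₂₁, Matrix.det_fromBlocks_zero₁₂,
      Matrix.det_fromBlocks_one₁₁, hdiag, Matrix.det_diagonal] at this
    simpa [Fin.prod_univ_succ] using this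
  rw [hfac, Matrix.det_mul, Matrix.det_mul, hdet, Matrix.det_fromBlocks_zero₂₁,
    Matrix.det_fromBlocks_zero₂₁, Matrix.det_transpose]
  simp only [Matrix.det_one, one_mul]
  ring

/-- A vector `y ≠ 0` in the kernel of `Jᵀ` gives a left null vector `(0, y)`. It is supported on the
`x`-rows, so it survives the replacement of a `u`-row that defines this adjugate entry. -/
theorem adjugate_inl_right (H : Matrix (Fin n) (Fin n) ℝ) (J : Matrix (Fin (n + 1)) (Fin n) ℝ)
    (i : Fin n ⊕ Fin (n + 1)) (j : Fin n) :
    (Matrix.fromBlocks H Jᵀ J 0).adjugate i (Sum.inl j) = 0 := by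
  rw [Matrix.adjugate_apply]
  obtain ⟨y, hy, h0⟩ := exists_transpose_mulVec_eq_zero J
  apply Matrix.exists_vecMul_eq_zero_iff.1
  refine ⟨Sum.elim (0 : Fin n → ℝ) y, fun h => hy ?_, ?_⟩
  · ext k
    exact congrFun h (Sum.inr k)
  · rw [Matrix.mulVec_transpose] at h0
    ext c
    have h1 : ∀ k, Matrix.updateRow (Matrix.fromBlocks H Jᵀ J 0) (Sum.inl j) (Pi.single i 1)
        (Sum.inr k) c = Matrix.fromBlocks H Jᵀ J 0 (Sum.inr k) c := fun k => by
      rw [Matrix.updateRow_ne (by simp)]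
    rcases c with c | c
    · simpa [Matrix.vecMul, dotProduct, h1] using congrFun h0 c
    · simp [Matrix.vecMul, dotProduct, h1]

theorem det_fromBlocks_transpose_zero (H : Matrix (Fin n) (Fin n) ℝ) (J : Matrix (Fin (n + 1)) (Fin n) ℝ) :
    (Matrix.fromBlocks H Jᵀ J 0).det = 0 := by
  have := det_fromBlocks_vecMulVec H J 0 0
  rw [det_consCol 0, zero_dotProduct, Matrix.zero_vecMulVec] at this
  simpa using this

/-- By symmetry only the `xx`-entries can be nonzero. Adding `eⱼ eᵢᵀ` to the zero block changes the
determinant by the adjugate entry `(i, j)`; as the unperturbed determinant is zero, the entry is the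
perturbed determinant, a product of two signed minors. -/
theorem adjugate_fromBlocks {H : Matrix (Fin n) (Fin n) ℝ} (hH : Hᵀ = H)
    (J : Matrix (Fin (n + 1)) (Fin n) ℝ) :
    (Matrix.fromBlocks H Jᵀ J 0).adjugate = (-1 : ℝ) ^ n •
      Matrix.vecMulVec (Sum.elim (0 : Fin n → ℝ) (minorVec J)) (Sum.elim (0 : Fin n → ℝ) (minorVec J)) := by
  have hsymm : (Matrix.fromBlocks H Jᵀ J 0)ᵀ = Matrix.fromBlocks H Jᵀ J 0 := by
    rw [Matrix.fromBlocks_transpose, hH]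
    simp
  ext i j
  rcases j with j | j
  · rw [adjugate_inl_right]
    simp [Matrix.vecMulVec_apply]
  rcases i with i | i
  · have : (Matrix.fromBlocks H Jᵀ J 0).adjugate (Sum.inl i) (Sum.inr j) = 0 := by
      rw [← hsymm, ← Matrix.adjugate_transpose, Matrix.transpose_apply, adjugate_inl_right]
    rw [this]
    simp [Matrix.vecMulVec_apply]
  have h1 := det_fromBlocks_vecMulVec H J (Pi.single j 1) (Pi.single i 1)
  have h2 : Matrix.fromBlocks H Jᵀ J (Matrix.vecMulVec (Pi.single j 1) (Pi.single i 1)) =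
      Matrix.updateRow (Matrix.fromBlocks H Jᵀ J 0) (Sum.inr j)
        (Matrix.fromBlocks H Jᵀ J 0 (Sum.inr j) + Pi.single (Sum.inr i) 1) := by
    ext r c
    rw [Matrix.updateRow_apply]
    split_ifs with h
    · subst h
      rcases c with c | c <;> simp [Matrix.vecMulVec_apply, Pi.single_apply]
    · rcases r with r | r
      · rcases c with c | c <;> simp
      · have hr : r ≠ j := fun h' => h (congrArg _ h')
        rcases c with c | c <;> simp [Matrix.vecMulVec_apply, hr]
  rw [h2, Matrix.det_updateRow_add, Matrix.updateRow_eq_self, det_fromBlocks_transpose_zero, zero_add,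
    ← Matrix.adjugate_apply, det_consCol, det_consCol] at h1
  rw [h1]
  simp [Matrix.vecMulVec_apply]
  ring

/-- The lower block row and injectivity force the `u`-part to vanish; the upper one then places the
`x`-part in the annihilator of the image of `J`. -/
theorem fromBlocks_mulVec_eq_zero_iff (H : Matrix (Fin n) (Fin n) ℝ)
    {J : Matrix (Fin (n + 1)) (Fin n) ℝ} (hJ : Function.Injective J.mulVec)
    (x : Fin n ⊕ Fin (n + 1) → ℝ) :
    Matrix.fromBlocks H Jᵀ J 0 *ᵥ x = 0 ↔ ∃ c : ℝ, x = c • Sum.elim (0 : Fin n → ℝ) (minorVec J) := by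
  have hx : x = Sum.elim (fun i => x (Sum.inl i)) (fun i => x (Sum.inr i)) := by
    ext (i | i) <;> rfl
  have hJ0 : ∀ y, Jᵀ *ᵥ y = 0 ↔ ∀ v, (J *ᵥ v) ⬝ᵥ y = 0 := by
    intro y
    constructor
    · intro h v
      rw [Matrix.mulVec_transpose] at h
      rw [dotProduct_comm, Matrix.dotProduct_mulVec, h, zero_dotProduct]
    · intro h
      refine dotProduct_eq_zero _ fun v => ?_
      rw [Matrix.mulVec_transpose, ← Matrix.dotProduct_mulVec, dotProduct_comm, h]
  rw [hx, Matrix.fromBlocks_mulVec]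
  constructor
  · intro h
    have h2 : J *ᵥ (fun i => x (Sum.inl i)) = 0 := by
      ext i
      simpa using congrFun h (Sum.inr i)
    have h3 : (fun i => x (Sum.inl i)) = 0 := hJ (by rw [h2, Matrix.mulVec_zero])
    have h1 : Jᵀ *ᵥ (fun i => x (Sum.inr i)) = 0 := by
      ext i
      have := congrFun h (Sum.inl i)
      simpa [Function.comp_def, h3, ← Pi.zero_def] using this
    obtain ⟨c, hc⟩ := eq_smul_minorVec hJ ((hJ0 _).1 h1)
    refine ⟨c, ?_⟩
    rw [hc, h3]
    ext (i | i) <;> simp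
  · rintro ⟨c, hc⟩
    rw [← hx] at hc
    have h3 : (fun i => x (Sum.inl i)) = 0 := by ext i; simp [hc]
    have h4 : (fun i => x (Sum.inr i)) = c • minorVec J := by ext i; simp [hc]
    have h5 : Jᵀ *ᵥ minorVec J = 0 := (hJ0 _).2 fun v => mulVec_dotProduct_minorVec J v
    rw [h3, h4, Sum.elim_comp_inl, Sum.elim_comp_inr, Matrix.mulVec_smul, h5]
    ext (i | i) <;> simp

theorem rank_fromBlocks (H : Matrix (Fin n) (Fin n) ℝ) (J : Matrix (Fin (n + 1)) (Fin n) ℝ) :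
    Function.Injective J.mulVec ↔ (Matrix.fromBlocks H Jᵀ J 0).rank = 2 * n := by
  have hrk := LinearMap.finrank_range_add_finrank_ker (Matrix.fromBlocks H Jᵀ J 0).mulVecLin
  have hcard : Module.finrank ℝ (Fin n ⊕ Fin (n + 1) → ℝ) = 2 * n + 1 := by
    simp; ring
  rw [hcard] at hrk
  change (Matrix.fromBlocks H Jᵀ J 0).rank + _ = _ at hrk
  constructor
  · intro hJ
    have hker : LinearMap.ker (Matrix.fromBlocks H Jᵀ J 0).mulVecLin =
        Submodule.span ℝ {Sum.elim (0 : Fin n → ℝ) (minorVec J)} := by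
      ext x
      rw [LinearMap.mem_ker, Matrix.mulVecLin_apply, fromBlocks_mulVec_eq_zero_iff H hJ,
        Submodule.mem_span_singleton]
      exact exists_congr fun c => eq_comm
    rw [hker, finrank_span_singleton] at hrk
    · omega
    · intro h
      apply minorVec_ne_zero hJ
      ext i
      exact congrFun h (Sum.inr i)
  · intro hr
    have hker1 : Module.finrank ℝ (LinearMap.ker (Matrix.fromBlocks H Jᵀ J 0).mulVecLin) = 1 := by
      omega
    -- The kernel of the bordered matrix contains `0 × ker Jᵀ`. As it is a line, `ker Jᵀ` has
    -- dimension at most one, so `J` has rank at least `n`.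
    let f : LinearMap.ker Jᵀ.mulVecLin →ₗ[ℝ] LinearMap.ker (Matrix.fromBlocks H Jᵀ J 0).mulVecLin :=
      LinearMap.codRestrict _
        ((LinearEquiv.sumArrowLequivProdArrow (Fin n) (Fin (n + 1)) ℝ ℝ).symm.toLinearMap ∘ₗ
          LinearMap.inr ℝ (Fin n → ℝ) (Fin (n + 1) → ℝ) ∘ₗ Submodule.subtype _) (by
        rintro ⟨y, hy⟩
        rw [LinearMap.mem_ker, Matrix.mulVecLin_apply] at hy ⊢
        have : ((LinearEquiv.sumArrowLequivProdArrow (Fin n) (Fin (n + 1)) ℝ ℝ).symm.toLinearMap ∘ₗ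
          LinearMap.inr ℝ (Fin n → ℝ) (Fin (n + 1) → ℝ) ∘ₗ
            Submodule.subtype (LinearMap.ker Jᵀ.mulVecLin)) ⟨y, hy⟩ = Sum.elim (0 : Fin n → ℝ) y := by
          ext (i | i) <;> rfl
        rw [this, Matrix.fromBlocks_mulVec]
        ext (i | i) <;> simp [hy])
    have hf : Function.Injective f := by
      rintro ⟨y, hy⟩ ⟨z, hz⟩ h
      ext i
      exact congrFun (congrArg Subtype.val h) (Sum.inr i)
    have h1 := LinearMap.finrank_le_finrank_of_injective hf
    have h2 := LinearMap.finrank_range_add_finrank_ker Jᵀ.mulVecLin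
    change Jᵀ.rank + _ = _ at h2
    rw [Matrix.rank_transpose] at h2
    have h3 := LinearMap.finrank_range_add_finrank_ker J.mulVecLin
    change J.rank + _ = _ at h3
    simp only [Module.finrank_fintype_fun_eq_card, Fintype.card_fin] at h2 h3
    have h4 : Module.finrank ℝ (LinearMap.ker J.mulVecLin) = 0 := by omega
    rw [Submodule.finrank_eq_zero] at h4
    exact LinearMap.ker_eq_bot.1 h4

end Bordered

/-! ### First and second derivatives of `F` -/

section Derivatives

theorem differentiableAt_and_fderiv_dotProduct {E : Type*} [NormedAddCommGroup E] [NormedSpace ℝ E] {m : ℕ}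
    {f g : E → Fin m → ℝ} {p : E} (hf : DifferentiableAt ℝ f p) (hg : DifferentiableAt ℝ g p) :
    DifferentiableAt ℝ (fun q => f q ⬝ᵥ g q) p ∧ ∀ X, fderiv ℝ (fun q => f q ⬝ᵥ g q) p X =
      fderiv ℝ f p X ⬝ᵥ g p + f p ⬝ᵥ fderiv ℝ g p X := by
  have h := HasFDerivAt.fun_sum (u := Finset.univ) fun i _ =>
    ((hasFDerivAt_pi'.1 hf.hasFDerivAt) i).mul ((hasFDerivAt_pi'.1 hg.hasFDerivAt) i)
  refine ⟨h.differentiableAt, fun X => ?_⟩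
  change fderiv ℝ (fun y => ∑ i, ((fun x => f x i) * fun x => g x i) y) p X = _
  rw [h.fderiv]
  simp only [sum_apply, add_apply, smul_apply, ContinuousLinearMap.comp_apply,
    ContinuousLinearMap.proj_apply, smul_eq_mul, dotProduct, ← Finset.sum_add_distrib]
  refine Finset.sum_congr rfl fun i _ => by ring

theorem two_le_infty : (2 : WithTop ℕ∞) ≤ ∞ := by
  exact WithTop.coe_le_coe.2 (le_top : (2 : ℕ∞) ≤ ⊤)

theorem contDiffAt_dotProduct {E : Type*} [NormedAddCommGroup E] [NormedSpace ℝ E] {m : ℕ}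
    {f g : E → Fin m → ℝ} {p : E} {N : WithTop ℕ∞} (hf : ContDiffAt ℝ N f p)
    (hg : ContDiffAt ℝ N g p) : ContDiffAt ℝ N (fun q => f q ⬝ᵥ g q) p := by
  unfold dotProduct
  exact ContDiffAt.sum fun i _ => ((contDiffAt_pi.1 hf) i).mul ((contDiffAt_pi.1 hg) i)

theorem contDiffAt_det {E : Type*} [NormedAddCommGroup E] [NormedSpace ℝ E] {ι : Type*} [Fintype ι]
    [DecidableEq ι] {f : E → Matrix ι ι ℝ} {p : E} {N : WithTop ℕ∞}
    (hf : ∀ i j, ContDiffAt ℝ N (fun q => f q i j) p) : ContDiffAt ℝ N (fun q => (f q).det) p := by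
  simp_rw [Matrix.det_apply]
  exact ContDiffAt.sum fun σ _ => ContDiffAt.const_smul _ (contDiffAt_prod fun i _ => hf _ _)

theorem contDiffAt_adjugate_mulVec {E : Type*} [NormedAddCommGroup E] [NormedSpace ℝ E] {m : ℕ}
    {f : E → Matrix (Fin m) (Fin m) ℝ} {g : E → Fin m → ℝ} {p : E} {N : WithTop ℕ∞}
    (hf : ∀ i j, ContDiffAt ℝ N (fun q => f q i j) p) (hg : ContDiffAt ℝ N g p) :
    ContDiffAt ℝ N (fun q => (f q).adjugate *ᵥ g q) p := by
  rw [contDiffAt_pi]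
  intro i
  refine contDiffAt_dotProduct (contDiffAt_pi.2 fun j => ?_) hg
  simp_rw [Matrix.adjugate_apply]
  refine contDiffAt_det fun r c => ?_
  by_cases hr : r = j
  · subst hr
    simp only [Matrix.updateRow_self]
    exact contDiffAt_const
  · simp only [Matrix.updateRow_ne hr]
    exact hf r c

/-- The regularity assumptions on the data `A` and `Q`. -/
structure SmoothData {n : ℕ} (M : Set (Fin n → ℝ)) (A : (Fin n → ℝ) → Fin (n + 1) → ℝ)
    (Q : (Fin n → ℝ) → ℝ) : Prop where
  isOpen : IsOpen M
  smoothA : ContDiffOn ℝ ∞ A M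
  smoothQ : ContDiffOn ℝ ∞ Q M

variable {n : ℕ} {M : Set (Fin n → ℝ)} {A : (Fin n → ℝ) → Fin (n + 1) → ℝ} {Q : (Fin n → ℝ) → ℝ}
  {u : Fin n → ℝ} {p : Space n}

theorem jacobian_mulVec (A : (Fin n → ℝ) → Fin (n + 1) → ℝ) (u v : Fin n → ℝ) :
    jacobian A u *ᵥ v = fderiv ℝ A u v := by
  conv_rhs => rw [← Finset.univ_sum_single v]
  ext i
  rw [map_sum, Finset.sum_apply, Matrix.mulVec, dotProduct]
  refine Finset.sum_congr rfl fun I _ => ?_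
  have : (Pi.single I (v I) : Fin n → ℝ) = v I • Pi.single I 1 := by
    rw [← Pi.single_smul, smul_eq_mul, mul_one]
  rw [this, map_smul]
  simp [jacobian, mul_comm]

theorem fieldV_eq (A : (Fin n → ℝ) → Fin (n + 1) → ℝ) (p : Space n) :
    fieldV A p = (0, minorVec (jacobian A p.1)) := rfl

theorem detA_eq (A : (Fin n → ℝ) → Fin (n + 1) → ℝ) (u : Fin n → ℝ) :
    detA A u = A u ⬝ᵥ minorVec (jacobian A u) := det_consCol _ _

theorem fderiv_dotProduct_minorVec (A : (Fin n → ℝ) → Fin (n + 1) → ℝ) (u v : Fin n → ℝ) :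
    fderiv ℝ A u v ⬝ᵥ minorVec (jacobian A u) = 0 := by
  rw [← jacobian_mulVec, mulVec_dotProduct_minorVec]

theorem injective_mulVec_jacobian (A : (Fin n → ℝ) → Fin (n + 1) → ℝ) (u : Fin n → ℝ) :
    Function.Injective (jacobian A u).mulVec ↔ Function.Injective (fderiv ℝ A u) := by
  have : (jacobian A u).mulVec = fderiv ℝ A u := funext fun v => jacobian_mulVec A u v
  rw [this]

theorem detA_ne_zero_iff (A : (Fin n → ℝ) → Fin (n + 1) → ℝ) (u : Fin n → ℝ) :
    detA A u ≠ 0 ↔ Function.Injective (fderiv ℝ A u) ∧ A u ∉ range (fderiv ℝ A u) := by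
  rw [← injective_mulVec_jacobian]
  refine (det_consCol_ne_zero_iff (A u) (jacobian A u)).trans (and_congr Iff.rfl ?_)
  simp [jacobian_mulVec]

theorem isCentroaffineOn_iff (M : Set (Fin n → ℝ)) (A : (Fin n → ℝ) → Fin (n + 1) → ℝ) :
    IsCentroaffineOn M A ↔ ∀ u ∈ M, detA A u ≠ 0 := by
  simp only [detA_ne_zero_iff]
  constructor
  · rintro ⟨h1, h2⟩ u hu
    exact ⟨h1 u hu, (h2 u hu).2⟩
  · intro h
    refine ⟨fun u hu => (h u hu).1, fun u hu => ⟨fun h0 => (h u hu).2 ⟨0, ?_⟩, (h u hu).2⟩⟩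
    rw [h0, map_zero]

namespace SmoothData

theorem contDiffAt_A (h : SmoothData M A Q) (hu : u ∈ M) : ContDiffAt ℝ ∞ A u :=
  h.smoothA.contDiffAt (h.isOpen.mem_nhds hu)

theorem contDiffAt_Q (h : SmoothData M A Q) (hu : u ∈ M) : ContDiffAt ℝ ∞ Q u :=
  h.smoothQ.contDiffAt (h.isOpen.mem_nhds hu)

theorem contDiffAt_fderivA (h : SmoothData M A Q) (hu : u ∈ M) : ContDiffAt ℝ ∞ (fderiv ℝ A) u :=
  (h.contDiffAt_A hu).fderiv_right (by simp)

theorem contDiffAt_fderivQ (h : SmoothData M A Q) (hu : u ∈ M) : ContDiffAt ℝ ∞ (fderiv ℝ Q) u :=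
  (h.contDiffAt_Q hu).fderiv_right (by simp)

theorem contDiffAt_A_fst (h : SmoothData M A Q) (hp : p.1 ∈ M) :
    ContDiffAt ℝ ∞ (fun q : Space n => A q.1) p :=
  (h.contDiffAt_A hp).comp p contDiffAt_fst

theorem contDiffAt_Q_fst (h : SmoothData M A Q) (hp : p.1 ∈ M) :
    ContDiffAt ℝ ∞ (fun q : Space n => Q q.1) p :=
  (h.contDiffAt_Q hp).comp p contDiffAt_fst

theorem contDiffAt_fnF (h : SmoothData M A Q) (hp : p.1 ∈ M) : ContDiffAt ℝ ∞ (fnF A Q) p :=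
  (contDiffAt_dotProduct (h.contDiffAt_A_fst hp) contDiffAt_snd).add (h.contDiffAt_Q_fst hp)

theorem contDiffAt_minorVec (h : SmoothData M A Q) (hu : u ∈ M) :
    ContDiffAt ℝ ∞ (fun q => minorVec (jacobian A q)) u := by
  rw [contDiffAt_pi]
  intro i
  refine contDiffAt_const.mul (contDiffAt_det fun r c => ?_)
  exact (contDiffAt_pi.1 ((h.contDiffAt_fderivA hu).clm_apply contDiffAt_const)) _

theorem contDiffAt_fieldV (h : SmoothData M A Q) (hp : p.1 ∈ M) : ContDiffAt ℝ ∞ (fieldV A) p :=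
  contDiffAt_const.prodMk ((h.contDiffAt_minorVec hp).comp p contDiffAt_fst)

theorem isOpen_preimage (h : SmoothData M A Q) : IsOpen {q : Space n | q.1 ∈ M} :=
  h.isOpen.preimage continuous_fst

theorem eventually_mem (h : SmoothData M A Q) (hp : p.1 ∈ M) : ∀ᶠ q : Space n in 𝓝 p, q.1 ∈ M :=
  h.isOpen_preimage.mem_nhds hp

theorem fderiv_comp_fst {G : Type*} [NormedAddCommGroup G] [NormedSpace ℝ G] {f : (Fin n → ℝ) → G}
    (hf : DifferentiableAt ℝ f p.1) (X : Space n) :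
    fderiv ℝ (fun q : Space n => f q.1) p X = fderiv ℝ f p.1 X.1 := by
  have := (HasFDerivAt.comp p hf.hasFDerivAt (hasFDerivAt_fst (𝕜 := ℝ) (p := p))).fderiv
  change fderiv ℝ (f ∘ Prod.fst) p X = _
  rw [this]
  rfl

theorem fderiv_fnF (h : SmoothData M A Q) (hp : p.1 ∈ M) (X : Space n) :
    fderiv ℝ (fnF A Q) p X =
      fderiv ℝ A p.1 X.1 ⬝ᵥ p.2 + A p.1 ⬝ᵥ X.2 + fderiv ℝ Q p.1 X.1 := by
  have hA := (h.contDiffAt_A_fst hp).differentiableAt (by simp)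
  have hQ := (h.contDiffAt_Q_fst hp).differentiableAt (by simp)
  have h1 := differentiableAt_and_fderiv_dotProduct hA (differentiableAt_snd (𝕜 := ℝ) (p := p))
  change fderiv ℝ (fun q : Space n => A q.1 ⬝ᵥ q.2 + Q q.1) p X = _
  rw [fderiv_fun_add h1.1 hQ, add_apply, h1.2,
    fderiv_comp_fst ((h.contDiffAt_A hp).differentiableAt (by simp)),
    fderiv_comp_fst ((h.contDiffAt_Q hp).differentiableAt (by simp)), fderiv_snd]
  rfl

theorem fderiv_fnF_fieldV (h : SmoothData M A Q) (hp : p.1 ∈ M) :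
    fderiv ℝ (fnF A Q) p (fieldV A p) = detA A p.1 := by
  rw [h.fderiv_fnF hp, fieldV_eq, detA_eq]
  simp

/-- The `uu`-block of the Hessian of `F`. -/
def hessU (A : (Fin n → ℝ) → Fin (n + 1) → ℝ) (Q : (Fin n → ℝ) → ℝ) (p : Space n)
    (v v' : Fin n → ℝ) : ℝ :=
  fderiv ℝ (fderiv ℝ A) p.1 v v' ⬝ᵥ p.2 + fderiv ℝ (fderiv ℝ Q) p.1 v v'

theorem hess_fnF (h : SmoothData M A Q) (hp : p.1 ∈ M) (X Y : Space n) :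
    hess (fnF A Q) p X Y = hessU A Q p X.1 Y.1 + fderiv ℝ A p.1 X.1 ⬝ᵥ Y.2 +
      fderiv ℝ A p.1 Y.1 ⬝ᵥ X.2 := by
  have hd : DifferentiableAt ℝ (fderiv ℝ (fnF A Q)) p :=
    ((h.contDiffAt_fnF hp).fderiv_right (m := ∞) (by simp)).differentiableAt (by simp)
  have hdA : DifferentiableAt ℝ (fderiv ℝ A) p.1 :=
    (h.contDiffAt_fderivA hp).differentiableAt (by simp)
  have hdQ : DifferentiableAt ℝ (fderiv ℝ Q) p.1 :=
    (h.contDiffAt_fderivQ hp).differentiableAt (by simp)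
  have hA := (h.contDiffAt_A_fst hp).differentiableAt (by simp)
  have h1 : hess (fnF A Q) p X Y = fderiv ℝ (fun q => fderiv ℝ (fnF A Q) q Y) p X := by
    rw [fderiv_clm_apply hd (differentiableAt_const Y)]
    simp [hess]
  have h2 : (fun q => fderiv ℝ (fnF A Q) q Y) =ᶠ[𝓝 p] fun q =>
      fderiv ℝ A q.1 Y.1 ⬝ᵥ q.2 + A q.1 ⬝ᵥ Y.2 + fderiv ℝ Q q.1 Y.1 := by
    filter_upwards [h.eventually_mem hp] with q hq
    rw [h.fderiv_fnF hq]
  have hdAY : DifferentiableAt ℝ (fun u => fderiv ℝ A u Y.1) p.1 :=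
    hdA.clm_apply (differentiableAt_const _)
  have hdQY : DifferentiableAt ℝ (fun u => fderiv ℝ Q u Y.1) p.1 :=
    hdQ.clm_apply (differentiableAt_const _)
  have hdAY' : DifferentiableAt ℝ (fun q : Space n => fderiv ℝ A q.1 Y.1) p :=
    hdAY.comp p differentiableAt_fst
  have hdQY' : DifferentiableAt ℝ (fun q : Space n => fderiv ℝ Q q.1 Y.1) p :=
    hdQY.comp p differentiableAt_fst
  have h3 := differentiableAt_and_fderiv_dotProduct hdAY' (differentiableAt_snd (𝕜 := ℝ) (p := p))
  have h4 := differentiableAt_and_fderiv_dotProduct hA (differentiableAt_const (x := p) Y.2)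
  rw [h1, h2.fderiv_eq, fderiv_fun_add (h3.1.fun_add h4.1) hdQY', fderiv_fun_add h3.1 h4.1]
  simp only [add_apply]
  rw [h3.2, h4.2, fderiv_comp_fst hdAY,
    fderiv_comp_fst hdQY, fderiv_comp_fst ((h.contDiffAt_A hp).differentiableAt (by simp)),
    fderiv_clm_apply hdA (differentiableAt_const _), fderiv_clm_apply hdQ (differentiableAt_const _),
    fderiv_snd]
  simp [hessU]
  ring

theorem hess_symm (h : SmoothData M A Q) (hp : p.1 ∈ M) (X Y : Space n) :
    hess (fnF A Q) p X Y = hess (fnF A Q) p Y X :=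
  ((h.contDiffAt_fnF hp).isSymmSndFDerivAt (by simpa using two_le_infty)) X Y

theorem hess_fieldV (h : SmoothData M A Q) (hp : p.1 ∈ M) (Y : Space n) :
    hess (fnF A Q) p (fieldV A p) Y = 0 := by
  rw [h.hess_fnF hp, fieldV_eq]
  simp [hessU, fderiv_dotProduct_minorVec]

theorem hess_fieldV_right (h : SmoothData M A Q) (hp : p.1 ∈ M) (Y : Space n) :
    hess (fnF A Q) p Y (fieldV A p) = 0 := by
  rw [h.hess_symm hp, h.hess_fieldV hp]

end SmoothData

theorem frame_inl (i : Fin n) : frame n (Sum.inl i) = (Pi.single i 1, 0) := by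
  simp [frame]

theorem frame_inr (i : Fin (n + 1)) : frame n (Sum.inr i) = (0, Pi.single i 1) := by
  simp [frame]

theorem frame_equivFun (X : Space n) : (frame n).equivFun X = Sum.elim X.1 X.2 := by
  ext (i | i) <;> simp [frame]

namespace SmoothData

theorem hessMatrix_fnF (h : SmoothData M A Q) (hp : p.1 ∈ M) :
    ∃ H : Matrix (Fin n) (Fin n) ℝ, Hᵀ = H ∧
      hessMatrix (fnF A Q) p = Matrix.fromBlocks H (jacobian A p.1)ᵀ (jacobian A p.1) 0 := by
  refine ⟨Matrix.of fun i j => hess (fnF A Q) p (frame n (Sum.inl i)) (frame n (Sum.inl j)), ?_, ?_⟩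
  · ext i j
    exact h.hess_symm hp _ _
  · ext (i | i) (j | j)
    · rfl
    · simp [hessMatrix, h.hess_fnF hp, frame_inl, frame_inr, hessU, jacobian]
    · simp [hessMatrix, h.hess_fnF hp, frame_inl, frame_inr, hessU, jacobian]
    · simp [hessMatrix, h.hess_fnF hp, frame_inr, hessU]

theorem adjugate_hessMatrix (h : SmoothData M A Q) (hp : p.1 ∈ M) :
    (hessMatrix (fnF A Q) p).adjugate = (-1 : ℝ) ^ n •
      Matrix.vecMulVec ((frame n).equivFun (fieldV A p)) ((frame n).equivFun (fieldV A p)) := by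
  obtain ⟨H, hH, hM⟩ := h.hessMatrix_fnF hp
  rw [hM, adjugate_fromBlocks hH, frame_equivFun]
  rfl

theorem dotProduct_gradient (p X : Space n) (F : Space n → ℝ) :
    (frame n).equivFun X ⬝ᵥ gradient F p = fderiv ℝ F p X := by
  conv_rhs => rw [← (frame n).sum_equivFun X, map_sum]
  simp [dotProduct, gradient]

theorem fieldN_eq (h : SmoothData M A Q) (hp : p.1 ∈ M) :
    fieldN (fnF A Q) p = ((-1) ^ n * detA A p.1) • fieldV A p := by
  rw [fieldN, h.adjugate_hessMatrix hp, Matrix.smul_mulVec, Matrix.vecMulVec_mulVec,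
    dotProduct_gradient, h.fderiv_fnF_fieldV hp, LinearEquiv.symm_apply_eq, map_smul]
  ext i
  simp
  ring

theorem fnU_eq (h : SmoothData M A Q) (hp : p.1 ∈ M) :
    fnU (fnF A Q) p = (-1) ^ n * detA A p.1 ^ 2 := by
  have : (hessMatrix (fnF A Q) p).adjugate *ᵥ gradient (fnF A Q) p =
      (frame n).equivFun (fieldN (fnF A Q) p) := by
    rw [fieldN, LinearEquiv.apply_symm_apply]
  rw [fnU, this, dotProduct_comm, dotProduct_gradient, h.fieldN_eq hp, map_smul,
    h.fderiv_fnF_fieldV hp]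
  simp only [smul_eq_mul]
  ring

theorem rank_hessMatrix (h : SmoothData M A Q) (hp : p.1 ∈ M) :
    (hessMatrix (fnF A Q) p).rank = 2 * n ↔ Function.Injective (fderiv ℝ A p.1) := by
  obtain ⟨H, hH, hM⟩ := h.hessMatrix_fnF hp
  rw [hM, ← rank_fromBlocks, injective_mulVec_jacobian]

/-- Testing against `x`-directions gives `dA(X.1) = 0`; testing against `u`-directions then makes
`X.2` annihilate the image of `dA`. -/
theorem radical_hess (h : SmoothData M A Q) (hp : p.1 ∈ M)
    (hinj : Function.Injective (fderiv ℝ A p.1)) (X : Space n) :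
    (∀ Y, hess (fnF A Q) p X Y = 0) ↔ ∃ c : ℝ, X = c • fieldV A p := by
  constructor
  · intro hX
    have h1 : fderiv ℝ A p.1 X.1 = 0 := dotProduct_eq_zero _ fun y => by
      simpa [h.hess_fnF hp, hessU] using hX (0, y)
    have h2 : X.1 = 0 := hinj (by rw [h1, map_zero])
    obtain ⟨c, hc⟩ := eq_smul_minorVec ((injective_mulVec_jacobian A p.1).2 hinj) (y := X.2)
      fun v => by simpa [h.hess_fnF hp, hessU, h2, jacobian_mulVec] using hX (v, 0)
    exact ⟨c, Prod.ext (by simp [h2, fieldV_eq]) hc⟩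
  · rintro ⟨c, rfl⟩ Y
    have := h.hess_fieldV hp Y
    simp only [hess] at this ⊢
    simp [this]

end SmoothData

/-! ### The forms `β` and `Ω` -/

theorem formBeta_apply (A : (Fin n → ℝ) → Fin (n + 1) → ℝ) (p : Space n) (v : Fin 1 → Space n) :
    formBeta A p v = A p.1 ⬝ᵥ (v 0).2 := by
  simp [formBeta, dotProduct]

theorem formBeta_eq_sum (A : (Fin n → ℝ) → Fin (n + 1) → ℝ) (p : Space n) :
    formBeta A p = ∑ i, A p.1 i • ContinuousAlternatingMap.ofSubsingleton ℝ (Space n) ℝ (0 : Fin 1)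
      (ContinuousLinearMap.proj i ∘L
        ContinuousLinearMap.snd ℝ (Fin n → ℝ) (Fin (n + 1) → ℝ)) := by
  ext v
  rw [formBeta_apply]
  simp [dotProduct]

namespace SmoothData

theorem contDiffAt_formBeta (h : SmoothData M A Q) (hp : p.1 ∈ M) :
    ContDiffAt ℝ ∞ (formBeta A) p := by
  have : formBeta A = fun p => _ := funext fun p => formBeta_eq_sum A p
  rw [this]
  exact ContDiffAt.sum fun i _ =>
    ((contDiffAt_pi.1 (h.contDiffAt_A_fst hp)) i).smul contDiffAt_const

theorem formOmega_apply (h : SmoothData M A Q) (hp : p.1 ∈ M) (X Y : Space n) :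
    formOmega A p ![X, Y] = fderiv ℝ A p.1 X.1 ⬝ᵥ Y.2 - fderiv ℝ A p.1 Y.1 ⬝ᵥ X.2 := by
  have hA := (h.contDiffAt_A_fst hp).differentiableAt (by simp)
  have hA' := (h.contDiffAt_A hp).differentiableAt (by simp)
  have key : ∀ X Y : Space n, fderiv ℝ (fun q : Space n => A q.1 ⬝ᵥ Y.2) p X =
      fderiv ℝ A p.1 X.1 ⬝ᵥ Y.2 := fun X Y => by
    rw [(differentiableAt_and_fderiv_dotProduct hA (differentiableAt_const (x := p) Y.2)).2, fderiv_comp_fst hA']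
    simp
  rw [formOmega, extDeriv_apply ((h.contDiffAt_formBeta hp).differentiableAt (by simp))]
  simp only [formBeta_apply]
  simp [Fin.removeNth, key]
  ring

theorem extDeriv_formOmega (h : SmoothData M A Q) (hp : p.1 ∈ M) :
    extDeriv (formOmega A) p = 0 :=
  extDeriv_extDeriv_apply (h.contDiffAt_formBeta hp) (by simpa using two_le_infty)

end SmoothData

end Derivatives

/-! ### The top form `β ∧ Ωⁿ` -/

section Contact

variable {n : ℕ} {M : Set (Fin n → ℝ)} {A : (Fin n → ℝ) → Fin (n + 1) → ℝ} {Q : (Fin n → ℝ) → ℝ}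
  {u : Fin n → ℝ} {p : Space n}

/-- The map `u ↦ (1, u)`, whose form `β` is the standard contact form. -/
def stdA (n : ℕ) (u : Fin n → ℝ) : Fin (n + 1) → ℝ := Fin.cons 1 u

theorem smoothData_stdA (n : ℕ) : SmoothData univ (stdA n) 0 where
  isOpen := isOpen_univ
  smoothA := by
    rw [contDiffOn_univ, contDiff_pi]
    intro i
    refine Fin.cases ?_ (fun i => ?_) i
    · exact contDiff_const
    · exact contDiff_apply ℝ ℝ i
  smoothQ := contDiffOn_const

theorem fderiv_stdA (n : ℕ) (u v : Fin n → ℝ) : fderiv ℝ (stdA n) u v = Fin.cons 0 v := by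
  have hd : DifferentiableAt ℝ (stdA n) u :=
    ((smoothData_stdA n).contDiffAt_A (mem_univ u)).differentiableAt (by simp)
  ext i
  have h1 : fderiv ℝ (stdA n) u v i = fderiv ℝ (fun q => stdA n q i) u v := by
    rw [fderiv_pi (differentiableAt_pi.1 hd)]
    rfl
  rw [h1]
  refine Fin.cases ?_ (fun i => ?_) i
  · have : (fun q => stdA n q 0) = fun _ => 1 := rfl
    simp [this]
  · have : (fun q => stdA n q i.succ) = fun q => (ContinuousLinearMap.proj i : (Fin n → ℝ) →L[ℝ] ℝ) q := rfl
    rw [this, ContinuousLinearMap.fderiv]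
    rfl

/-- The coordinate vector with index `k`, or `0` if `k` is out of range. -/
def coordVec (m k : ℕ) : Fin m → ℝ := fun r => if (r : ℕ) = k then 1 else 0

/-- The coordinate frame in the order `∂x₀, ∂u₁, ∂x₁, …, ∂uₙ, ∂xₙ`. -/
def shuffledFrame (n j : ℕ) : Space n :=
  if j % 2 = 1 then (coordVec n (j / 2), 0) else (0, coordVec (n + 1) (j / 2))

theorem frame_eq_shuffledFrame (n : ℕ) (hn : n + (n + 1) = 1 + 2 * n) (x : Fin n ⊕ Fin (n + 1)) :
    frame n x = shuffledFrame n (shuffle n (finCongr hn (finSumFinEquiv x))) := by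
  have hcoord : ∀ (m : ℕ) (i : Fin m), (Pi.single i 1 : Fin m → ℝ) = coordVec m i := by
    intro m i
    ext r
    simp [coordVec, Pi.single_apply, Fin.ext_iff]
  rcases x with i | i
  · have : (shuffle n (finCongr hn (finSumFinEquiv (Sum.inl i : Fin n ⊕ Fin (n + 1)))) : ℕ)
        = 2 * i + 1 := by
      rw [shuffle_apply]
      simp
    rw [this, frame_inl, hcoord, shuffledFrame, if_pos (by omega)]
    congr 2
    omega
  · have : (shuffle n (finCongr hn (finSumFinEquiv (Sum.inr i : Fin n ⊕ Fin (n + 1)))) : ℕ)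
        = 2 * i := by
      rw [shuffle_apply]
      simp
    rw [this, frame_inr, hcoord, shuffledFrame, if_neg (by omega)]
    congr 2
    omega

theorem coordVec_dotProduct (m a b : ℕ) (ha : a < m) :
    coordVec m a ⬝ᵥ coordVec m b = if a = b then 1 else 0 := by
  rw [dotProduct, Finset.sum_eq_single ⟨a, ha⟩]
  · simp [coordVec]
  · intro r _ hr
    have : (r : ℕ) ≠ a := fun h => hr (Fin.ext h)
    simp [coordVec, this]
  · simp

theorem cons_zero_coordVec (m a : ℕ) :
    (Fin.cons 0 (coordVec m a) : Fin (m + 1) → ℝ) = coordVec (m + 1) (a + 1) := by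
  ext r
  refine Fin.cases ?_ (fun r => ?_) r <;> simp [coordVec]

theorem stdA_zero (n : ℕ) : stdA n 0 = coordVec (n + 1) 0 := by
  ext r
  refine Fin.cases ?_ (fun r => ?_) r <;> simp [coordVec, stdA]

/-- At the origin `β = dx₀` and `Ω = ∑ duᵢ ∧ dxᵢ`, so the shuffled coordinate frame is a Darboux
frame. -/
theorem wedge_stdA_shuffledFrame (n : ℕ) :
    wedge (formBeta (stdA n) 0).toAlternatingMap
      (wedgePow (formOmega (stdA n) 0).toAlternatingMap n) (fun i => shuffledFrame n i) =
        n.factorial := by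
  have hΩ : ∀ X Y : Space n, formOmega (stdA n) 0 ![X, Y] =
      (Fin.cons 0 X.1 : Fin (n + 1) → ℝ) ⬝ᵥ Y.2 - (Fin.cons 0 Y.1 : Fin (n + 1) → ℝ) ⬝ᵥ X.2 := by
    intro X Y
    rw [(smoothData_stdA n).formOmega_apply (mem_univ _), fderiv_stdA, fderiv_stdA]
  apply wedge_wedgePow_apply_of_stdSymplectic
  · change formBeta (stdA n) 0 _ = 1
    rw [formBeta_apply]
    simp [shuffledFrame, stdA_zero, coordVec_dotProduct]
  · intro i hi
    change formBeta (stdA n) 0 _ = 0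
    rw [formBeta_apply]
    simp only [shuffledFrame, Prod.fst_zero, stdA_zero]
    split_ifs with h
    · simp
    · simp only [Matrix.cons_val_fin_one]
      rw [coordVec_dotProduct _ _ _ (by omega), if_neg (by omega)]
  · intro i j hi hj
    change formOmega (stdA n) 0 _ = _
    rw [hΩ]
    have h0 : (Fin.cons 0 0 : Fin (n + 1) → ℝ) = 0 := by
      ext r
      refine Fin.cases ?_ (fun r => ?_) r <;> rfl
    simp only [shuffledFrame, stdSymplectic]
    split_ifs <;>
      (try simp only [cons_zero_coordVec, dotProduct_zero, sub_zero, zero_sub, sub_self]) <;>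
      (try rw [coordVec_dotProduct _ _ _ (by omega)]) <;> (try split_ifs) <;>
      first | rfl | omega | exact neg_zero | simp [h0]

/-- With `K = (A | dA)`, the map `f = id × Kᵀ` pulls the standard `β` and `Ω` at the origin back to
those of `A` at `p`, because `K e₀ = A` and `K (0, v) = dA(v)`. A top form is thereby multiplied by
`det f = |A dA|`; the shuffle sign and `n!` come from the standard model. -/
theorem SmoothData.wedge_formBeta_wedgePow_formOmega (h : SmoothData M A Q) (hp : p.1 ∈ M)
    (hn : n + (n + 1) = 1 + 2 * n) :
    wedge (formBeta A p).toAlternatingMap (wedgePow (formOmega A p).toAlternatingMap n) =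
      ((-1) ^ (n * (n + 1) / 2) * (n.factorial : ℝ) * detA A p.1) •
        (volumeForm n).domDomCongr (finCongr hn) := by
  let K := consCol (A p.1) (jacobian A p.1)
  let f : Space n →ₗ[ℝ] Space n := LinearMap.prodMap LinearMap.id Kᵀ.mulVecLin
  have hK : ∀ z y, (K *ᵥ z) ⬝ᵥ y = z ⬝ᵥ (Kᵀ *ᵥ y) := fun z y => by
    rw [Matrix.mulVec_transpose, dotProduct_comm, Matrix.dotProduct_mulVec, dotProduct_comm]
  have hβ : (formBeta A p).toAlternatingMap =
      (formBeta (stdA n) 0).toAlternatingMap.compLinearMap f := by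
    ext v
    change formBeta A p v = formBeta (stdA n) 0 (fun i => f (v i))
    rw [formBeta_apply, formBeta_apply]
    change _ = stdA n 0 ⬝ᵥ (Kᵀ *ᵥ (v 0).2)
    rw [← hK, consCol_mulVec]
    simp [stdA, mulVec_fun_zero]
  have hvec : ∀ v : Fin 2 → Space n, v = ![v 0, v 1] := fun v => by
    ext1 i
    fin_cases i <;> rfl
  have hΩ : (formOmega A p).toAlternatingMap =
      (formOmega (stdA n) 0).toAlternatingMap.compLinearMap f := by
    ext v
    change formOmega A p v = formOmega (stdA n) 0 (fun i => f (v i))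
    rw [hvec v, hvec fun i => f _, h.formOmega_apply hp,
      (smoothData_stdA n).formOmega_apply (mem_univ _), fderiv_stdA, fderiv_stdA]
    change _ = (Fin.cons 0 (v 0).1 : Fin (n + 1) → ℝ) ⬝ᵥ (Kᵀ *ᵥ (v 1).2) -
      (Fin.cons 0 (v 1).1 : Fin (n + 1) → ℝ) ⬝ᵥ (Kᵀ *ᵥ (v 0).2)
    rw [← hK, ← hK, consCol_mulVec, consCol_mulVec]
    simp [jacobian_mulVec]
  let e : Module.Basis (Fin (1 + 2 * n)) ℝ (Space n) :=
    (frame n).reindex (finSumFinEquiv.trans (finCongr hn))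
  have he : ∀ x, e (finCongr hn (finSumFinEquiv x)) = frame n x := fun x => by
    have : finCongr hn (finSumFinEquiv x) =
      (finSumFinEquiv.trans (finCongr hn)) x := rfl
    rw [this, Module.Basis.reindex_apply, Equiv.symm_apply_apply]
  have hvol : (volumeForm n).domDomCongr (finCongr hn) = e.det := by
    rw [AlternatingMap.eq_smul_basis_det e ((volumeForm n).domDomCongr _)]
    convert one_smul ℝ _
    have : (fun i => e (finCongr hn i)) =
        (frame n).reindex finSumFinEquiv := by
      ext1 i
      obtain ⟨x, rfl⟩ := finSumFinEquiv.surjective i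
      rw [he, Module.Basis.reindex_apply, Equiv.symm_apply_apply]
    rw [AlternatingMap.domDomCongr_apply]
    change volumeForm n (fun i => e (finCongr hn i)) = 1
    rw [this, volumeForm, Module.Basis.det_self]
  have hdet : LinearMap.det f = detA A p.1 := by
    rw [LinearMap.det_prodMap, LinearMap.det_id, one_mul, ← Matrix.toLin'_apply',
      LinearMap.det_toLin', Matrix.det_transpose]
    rfl
  have hc : wedge (formBeta (stdA n) 0).toAlternatingMap
      (wedgePow (formOmega (stdA n) 0).toAlternatingMap n) e =
        (-1) ^ (n * (n + 1) / 2) * (n.factorial : ℝ) := by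
    have : (e : Fin (1 + 2 * n) → Space n) =
        (fun i : Fin (1 + 2 * n) => shuffledFrame n i) ∘ shuffle n := by
      ext1 i
      obtain ⟨i', rfl⟩ := (finCongr hn).surjective i
      obtain ⟨x, rfl⟩ := finSumFinEquiv.surjective i'
      rw [he, frame_eq_shuffledFrame]
      rfl
    rw [this, AlternatingMap.map_perm, wedge_stdA_shuffledFrame, sign_shuffle]
    simp [Units.smul_def]
  rw [hvol, hβ, hΩ, wedgePow_compLinearMap, wedge_compLinearMap,
    AlternatingMap.eq_smul_basis_det e (AlternatingMap.compLinearMap _ f)]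
  congr 1
  rw [AlternatingMap.compLinearMap_apply, AlternatingMap.eq_smul_basis_det e (wedge _ _), hc]
  change _ * e.det (f ∘ e) = _
  rw [Module.Basis.det_comp, hdet, Module.Basis.det_self, mul_one]

end Contact

/-! ### The level sets of `F` and their tangent spaces -/

section Tangent

theorem fderiv_eq_zero_of_mem_tangentSpaceAt {E G : Type*} [NormedAddCommGroup E] [NormedSpace ℝ E]
    [NormedAddCommGroup G] [NormedSpace ℝ G] {S : Set E} {p : E} {f : E → G} {c : G}
    (hf : DifferentiableAt ℝ f p) (hc : ∀ q ∈ S, f q = c) {X : E} (hX : X ∈ tangentSpaceAt S p) :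
    fderiv ℝ f p X = 0 := by
  induction hX using Submodule.span_induction with
  | mem x hx =>
    obtain ⟨γ, hγ, rfl, hS, rfl⟩ := hx
    have h1 : HasDerivAt (f ∘ γ) (fderiv ℝ f (γ 0) (deriv γ 0)) 0 :=
      hf.hasFDerivAt.comp_hasDerivAt 0 (hγ.differentiableAt (by simp)).hasDerivAt
    have h2 : f ∘ γ =ᶠ[𝓝 0] fun _ => c := by
      filter_upwards [hS] with s hs using hc _ hs
    exact (h1.congr_of_eventuallyEq h2.symm).unique (hasDerivAt_const 0 c)
  | zero => simp
  | add x y _ _ hx hy => rw [map_add, hx, hy, add_zero]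
  | smul a x _ hx => rw [map_smul, hx, smul_zero]

variable {n : ℕ} {M : Set (Fin n → ℝ)} {A : (Fin n → ℝ) → Fin (n + 1) → ℝ} {Q : (Fin n → ℝ) → ℝ}
  {u : Fin n → ℝ} {p : Space n} {t : ℝ}

theorem fnF_add_smul (A : (Fin n → ℝ) → Fin (n + 1) → ℝ) (Q : (Fin n → ℝ) → ℝ) (q : Space n) (c : ℝ)
    (y : Fin (n + 1) → ℝ) : fnF A Q (q + c • (0, y)) = fnF A Q q + c * (A q.1 ⬝ᵥ y) := by
  simp [fnF]
  ring

namespace SmoothData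

theorem mem_tangentSpaceAt_iff (h : SmoothData M A Q) (hd : ∀ u ∈ M, detA A u ≠ 0)
    (hp : p ∈ levelSet M (fnF A Q) t) (X : Space n) :
    X ∈ tangentSpaceAt (levelSet M (fnF A Q) t) p ↔ fderiv ℝ (fnF A Q) p X = 0 := by
  have hF := h.contDiffAt_fnF hp.1
  refine ⟨fun hX => fderiv_eq_zero_of_mem_tangentSpaceAt (hF.differentiableAt (by simp))
    (fun q hq => hq.2) hX, fun hX => Submodule.subset_span ?_⟩
  -- To realize `X ∈ ker dF` as a velocity, the line `p + s X` is pushed back to the level set along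
  -- the fixed direction `(0, w)`, in which `F` is affine with slope `⟨A, w⟩`. The correction `num /
  -- den` vanishes to first order because `dF(X) = 0`.
  let w := minorVec (jacobian A p.1)
  let ℓ : ℝ → Space n := fun s => p + s • X
  have hℓ : ContDiff ℝ ∞ ℓ := contDiff_const.add (contDiff_id.smul contDiff_const)
  have hℓ0 : ℓ 0 = p := by simp [ℓ]
  have hℓd : HasDerivAt ℓ X 0 :=
    (((hasDerivAt_id (0 : ℝ)).smul_const X).const_add p).congr_deriv (one_smul _ _)
  let num : ℝ → ℝ := fun s => fnF A Q (ℓ s) - t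
  let den : ℝ → ℝ := fun s => A (ℓ s).1 ⬝ᵥ w
  have hnum : ContDiffAt ℝ ∞ num 0 :=
    (ContDiffAt.comp 0 (by rwa [hℓ0]) hℓ.contDiffAt).sub contDiffAt_const
  have hden : ContDiffAt ℝ ∞ den 0 :=
    contDiffAt_dotProduct (ContDiffAt.comp 0 (g := fun q : Space n => A q.1)
      (by rw [hℓ0]; exact h.contDiffAt_A_fst hp.1) hℓ.contDiffAt) contDiffAt_const
  have hden0 : den 0 ≠ 0 := by
    have := hd p.1 hp.1
    rw [detA_eq] at this
    simpa [den, hℓ0] using this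
  have hnumd : HasDerivAt num 0 0 := by
    have h1 : HasDerivAt (fnF A Q ∘ ℓ) (fderiv ℝ (fnF A Q) (ℓ 0) X) 0 :=
      HasFDerivAt.comp_hasDerivAt 0
        (by rw [hℓ0]; exact (hF.differentiableAt (by simp)).hasFDerivAt) hℓd
    rw [hℓ0, hX] at h1
    exact h1.sub_const t
  have hnum0 : num 0 = 0 := by simp [num, hℓ0, hp.2]
  refine ⟨fun s => ℓ s + (-(num s / den s)) • (0, w), ?_, ?_, ?_, ?_⟩
  · exact hℓ.contDiffAt.add ((hnum.div hden hden0).neg.smul contDiffAt_const)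
  · simp [hnum0, hℓ0]
  · have e1 : ∀ᶠ s in 𝓝 (0 : ℝ), (ℓ s).1 ∈ M := by
      have : Tendsto ℓ (𝓝 0) (𝓝 p) := by
        have := hℓ.continuous.tendsto 0
        rwa [hℓ0] at this
      exact this.eventually (h.eventually_mem hp.1)
    filter_upwards [e1, hden.continuousAt.eventually_ne hden0] with s h1 h2
    refine ⟨?_, ?_⟩
    · simpa using h1
    · rw [fnF_add_smul]
      change fnF A Q (ℓ s) + -(num s / den s) * den s = t
      simp only [num]
      field_simp
      ring
  · have h1 := hnumd.fun_div (hden.differentiableAt (by simp)).hasDerivAt hden0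
    have h2 := hℓd.fun_add (h1.fun_neg.smul_const ((0, w) : Space n))
    rw [h2.deriv, hnum0]
    simp

theorem isSmoothHypersurface (h : SmoothData M A Q) (hd : ∀ u ∈ M, detA A u ≠ 0) (t : ℝ) :
    IsSmoothHypersurface (levelSet M (fnF A Q) t) := by
  intro p hp
  refine ⟨{q | q.1 ∈ M}, fun q => fnF A Q q - t, h.isOpen_preimage, hp.1, ?_, ?_, ?_⟩
  · intro q hq
    exact ((h.contDiffAt_fnF hq).sub contDiffAt_const).contDiffWithinAt
  · intro q hq h0
    apply hd q.1 hq
    rw [← h.fderiv_fnF_fieldV hq, ← fderiv_sub_const t, h0]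
    rfl
  · ext q
    simp only [levelSet, mem_inter_iff, mem_ofPred_eq, sub_eq_zero]
    tauto

theorem isTransversal_of (h : SmoothData M A Q) (hd : ∀ u ∈ M, detA A u ≠ 0) (t : ℝ)
    {ξ : Space n → Space n} (hs : ∀ p ∈ levelSet M (fnF A Q) t, ContDiffAt ℝ ∞ ξ p)
    (hξ : ∀ p ∈ levelSet M (fnF A Q) t, fderiv ℝ (fnF A Q) p (ξ p) ≠ 0) :
    IsTransversal (levelSet M (fnF A Q) t) ξ := fun p hp =>
  ⟨hs p hp, fun hT => hξ p hp ((h.mem_tangentSpaceAt_iff hd hp _).1 hT)⟩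

theorem contDiffAt_fderiv_fnF (h : SmoothData M A Q) (hp : p.1 ∈ M) :
    ContDiffAt ℝ ∞ (fderiv ℝ (fnF A Q)) p :=
  (h.contDiffAt_fnF hp).fderiv_right (by simp)

/-- Differentiation of `dF(Y) = c` along the level set. It is used with `c = 0` for tangent fields
and with a nonzero constant for equiaffine normals. -/
theorem fderiv_fnF_fderiv (h : SmoothData M A Q) (hp : p ∈ levelSet M (fnF A Q) t)
    {Y : Space n → Space n} {c : ℝ} (hY : ContDiffAt ℝ ∞ Y p)
    (hc : ∀ q ∈ levelSet M (fnF A Q) t, fderiv ℝ (fnF A Q) q (Y q) = c) {X : Space n}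
    (hX : X ∈ tangentSpaceAt (levelSet M (fnF A Q) t) p) :
    fderiv ℝ (fnF A Q) p (fderiv ℝ Y p X) = -hess (fnF A Q) p X (Y p) := by
  have h1 := (h.contDiffAt_fderiv_fnF hp.1).differentiableAt (by simp)
  have h2 := hY.differentiableAt (by simp)
  have h3 := fderiv_eq_zero_of_mem_tangentSpaceAt (f := fun q => fderiv ℝ (fnF A Q) q (Y q))
    (h1.clm_apply h2) hc hX
  rw [fderiv_clm_apply h1 h2] at h3
  simp only [add_apply, ContinuousLinearMap.comp_apply, ContinuousLinearMap.flip_apply] at h3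
  rw [hess]
  linarith

/-- Every tangent vector extends to a tangent field. -/
theorem exists_isTangentField (h : SmoothData M A Q) (hd : ∀ u ∈ M, detA A u ≠ 0)
    (hp : p ∈ levelSet M (fnF A Q) t) {X : Space n}
    (hX : X ∈ tangentSpaceAt (levelSet M (fnF A Q) t) p) :
    ∃ Y, IsTangentField (levelSet M (fnF A Q) t) Y ∧ Y p = X := by
  refine ⟨fun q => X - (fderiv ℝ (fnF A Q) q X / fderiv ℝ (fnF A Q) q (fieldV A q)) • fieldV A q,
    fun q hq => ?_, ?_⟩
  · have hne : fderiv ℝ (fnF A Q) q (fieldV A q) ≠ 0 := by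
      rw [h.fderiv_fnF_fieldV hq.1]
      exact hd _ hq.1
    have h1 := h.contDiffAt_fderiv_fnF hq.1
    have h2 := h.contDiffAt_fieldV hq.1
    refine ⟨contDiffAt_const.sub (((h1.clm_apply contDiffAt_const).div (h1.clm_apply h2) hne).smul h2),
      ?_⟩
    rw [h.mem_tangentSpaceAt_iff hd hq, map_sub, map_smul, smul_eq_mul, div_mul_cancel₀ _ hne, sub_self]
  · simp [(h.mem_tangentSpaceAt_iff hd hp X).1 hX]

/-- The Hessian is nondegenerate on the tangent spaces of the level sets. -/
theorem eq_zero_of_hess_eq_zero (h : SmoothData M A Q) (hd : ∀ u ∈ M, detA A u ≠ 0)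
    (hp : p ∈ levelSet M (fnF A Q) t) {X : Space n}
    (hX : X ∈ tangentSpaceAt (levelSet M (fnF A Q) t) p)
    (h0 : ∀ Y ∈ tangentSpaceAt (levelSet M (fnF A Q) t) p, hess (fnF A Q) p X Y = 0) : X = 0 := by
  have hne : fderiv ℝ (fnF A Q) p (fieldV A p) ≠ 0 := by
    rw [h.fderiv_fnF_fieldV hp.1]
    exact hd _ hp.1
  -- Every `Y` becomes tangent after subtracting a multiple of `V`, which lies in the radical. So
  -- `X` is in the radical, hence a multiple of `V`, hence zero as `dF(V) ≠ 0`.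
  have h1 : ∀ Y, hess (fnF A Q) p X Y = 0 := fun Y => by
    have h2 := h0 (Y - (fderiv ℝ (fnF A Q) p Y / fderiv ℝ (fnF A Q) p (fieldV A p)) • fieldV A p) (by
      rw [h.mem_tangentSpaceAt_iff hd hp, map_sub, map_smul, smul_eq_mul, div_mul_cancel₀ _ hne,
        sub_self])
    have h3 := h.hess_fieldV_right hp.1 X
    rw [hess] at h2 h3 ⊢
    simpa [h3] using h2
  obtain ⟨c, rfl⟩ := (h.radical_hess hp.1 ((detA_ne_zero_iff A p.1).1 (hd _ hp.1)).1 X).1 h1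
  have h2 := (h.mem_tangentSpaceAt_iff hd hp _).1 hX
  rw [map_smul, smul_eq_mul, mul_eq_zero, or_iff_left hne] at h2
  rw [h2, zero_smul]

/-- `Ω` is nondegenerate on the tangent spaces of the level sets. -/
theorem eq_zero_of_formOmega_eq_zero (h : SmoothData M A Q) (hd : ∀ u ∈ M, detA A u ≠ 0)
    (hp : p ∈ levelSet M (fnF A Q) t) {X : Space n}
    (hX : X ∈ tangentSpaceAt (levelSet M (fnF A Q) t) p)
    (h0 : ∀ Y ∈ tangentSpaceAt (levelSet M (fnF A Q) t) p, formOmega A p ![X, Y] = 0) : X = 0 := by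
  have hinj := ((detA_ne_zero_iff A p.1).1 (hd _ hp.1)).1
  have hne : fderiv ℝ (fnF A Q) p (fieldV A p) ≠ 0 := by
    rw [h.fderiv_fnF_fieldV hp.1]
    exact hd _ hp.1
  -- The same reduction works because `V` also spans the kernel of `Ω`.
  have h1 : ∀ Y, formOmega A p ![X, Y] = 0 := fun Y => by
    have h2 := h0 (Y - (fderiv ℝ (fnF A Q) p Y / fderiv ℝ (fnF A Q) p (fieldV A p)) • fieldV A p) (by
      rw [h.mem_tangentSpaceAt_iff hd hp, map_sub, map_smul, smul_eq_mul, div_mul_cancel₀ _ hne,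
        sub_self])
    rw [h.formOmega_apply hp.1] at h2 ⊢
    simpa [fieldV_eq, dotProduct_sub, fderiv_dotProduct_minorVec] using h2
  simp only [h.formOmega_apply hp.1] at h1
  have h3 : X.1 = 0 := hinj (by
    rw [map_zero]
    exact dotProduct_eq_zero _ fun y => by simpa using h1 (0, y))
  obtain ⟨c, hc⟩ := eq_smul_minorVec ((injective_mulVec_jacobian A p.1).2 hinj) (y := X.2)
    fun v => by simpa [h3, jacobian_mulVec] using h1 (v, 0)
  obtain rfl : X = c • fieldV A p := Prod.ext (by simp [h3, fieldV_eq]) hc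
  have h2 := (h.mem_tangentSpaceAt_iff hd hp _).1 hX
  rw [map_smul, smul_eq_mul, mul_eq_zero, or_iff_left hne] at h2
  rw [h2, zero_smul]

theorem isSymplecticOn (h : SmoothData M A Q) (hd : ∀ u ∈ M, detA A u ≠ 0) (t : ℝ) :
    IsSymplecticOn (levelSet M (fnF A Q) t) (formOmega A) := fun p hp =>
  ⟨fun X _ Y _ Z _ => by rw [h.extDeriv_formOmega hp.1]; rfl,
    fun _ hX h0 => h.eq_zero_of_formOmega_eq_zero hd hp hX h0⟩

end SmoothData

/-- The second fundamental form of a level set of `F` with respect to `ξ`. -/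
def levelForm (F : Space n → ℝ) (S : Set (Space n)) (ξ : Space n → Space n) (p : Space n) :
    LinearMap.BilinForm ℝ (tangentSpaceAt S p) :=
  LinearMap.mk₂ ℝ (fun X Y => -(fderiv ℝ F p (ξ p))⁻¹ * hess F p X Y)
    (fun _ _ _ => by simp [hess]; ring) (fun _ _ _ => by simp [hess]; ring)
    (fun _ _ _ => by simp [hess]; ring) (fun _ _ _ => by simp [hess]; ring)

theorem levelForm_apply (F : Space n → ℝ) (S : Set (Space n)) (ξ : Space n → Space n) (p : Space n)
    (X Y : tangentSpaceAt S p) :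
    levelForm F S ξ p X Y = -(fderiv ℝ F p (ξ p))⁻¹ * hess F p X Y := rfl

namespace SmoothData

/-- Applying `dF` to `D_X Y = ∇_X Y + h(X, Y) ξ` kills the tangential part, and `dF(D_X Y) = -Hess
F(X, Y)` for `Y` tangent. This forces the factor `-1 / dF(ξ)`. -/
theorem isSecondFundamentalForm_levelForm (h : SmoothData M A Q) (hd : ∀ u ∈ M, detA A u ≠ 0)
    (t : ℝ) {ξ : Space n → Space n}
    (hξ : ∀ p ∈ levelSet M (fnF A Q) t, fderiv ℝ (fnF A Q) p (ξ p) ≠ 0) :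
    IsSecondFundamentalForm (levelSet M (fnF A Q) t) ξ
      (levelForm (fnF A Q) (levelSet M (fnF A Q) t) ξ) := by
  intro p hp X Y hY
  have h1 := h.fderiv_fnF_fderiv hp (hY p hp).1
    (fun q hq => (h.mem_tangentSpaceAt_iff hd hq _).1 (hY q hq).2) X.2
  rw [h.mem_tangentSpaceAt_iff hd hp, map_sub, map_smul, h1, levelForm_apply]
  have := hξ p hp
  simp only [smul_eq_mul]
  field_simp
  ring

theorem nondegenerate_levelForm (h : SmoothData M A Q) (hd : ∀ u ∈ M, detA A u ≠ 0)
    {ξ : Space n → Space n} (hp : p ∈ levelSet M (fnF A Q) t)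
    (hξ : fderiv ℝ (fnF A Q) p (ξ p) ≠ 0) :
    (levelForm (fnF A Q) (levelSet M (fnF A Q) t) ξ p).Nondegenerate := by
  have key : ∀ X Y, levelForm (fnF A Q) (levelSet M (fnF A Q) t) ξ p X Y = 0 ↔
      hess (fnF A Q) p X Y = 0 := fun X Y => by
    rw [levelForm_apply]
    simp [hξ]
  constructor
  · intro X hX
    exact Subtype.ext (h.eq_zero_of_hess_eq_zero hd hp X.2 fun Y hY => (key X ⟨Y, hY⟩).1 (hX ⟨Y, hY⟩))
  · intro X hX
    refine Subtype.ext (h.eq_zero_of_hess_eq_zero hd hp X.2 fun Y hY => ?_)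
    rw [h.hess_symm hp.1]
    exact (key ⟨Y, hY⟩ X).1 (hX ⟨Y, hY⟩)

theorem isNondegenerate (h : SmoothData M A Q) (hd : ∀ u ∈ M, detA A u ≠ 0) (t : ℝ) :
    IsNondegenerate (levelSet M (fnF A Q) t) := by
  have hV : ∀ p ∈ levelSet M (fnF A Q) t, fderiv ℝ (fnF A Q) p (fieldV A p) ≠ 0 := fun p hp => by
    rw [h.fderiv_fnF_fieldV hp.1]
    exact hd _ hp.1
  exact ⟨fieldV A, levelForm _ _ _, h.isTransversal_of hd t (fun p hp => h.contDiffAt_fieldV hp.1) hV,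
    h.isSecondFundamentalForm_levelForm hd t hV, fun p hp => h.nondegenerate_levelForm hd hp (hV p hp)⟩

/-- The second fundamental form is determined by the transversal. -/
theorem secondFundamentalForm_eq (h : SmoothData M A Q) (hd : ∀ u ∈ M, detA A u ≠ 0)
    (hp : p ∈ levelSet M (fnF A Q) t) {ξ : Space n → Space n}
    (hξ : fderiv ℝ (fnF A Q) p (ξ p) ≠ 0)
    {g : (p : Space n) → LinearMap.BilinForm ℝ (tangentSpaceAt (levelSet M (fnF A Q) t) p)}
    (hg : IsSecondFundamentalForm (levelSet M (fnF A Q) t) ξ g) :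
    g p = levelForm (fnF A Q) (levelSet M (fnF A Q) t) ξ p := by
  ext X Z
  obtain ⟨Y, hY, hYp⟩ := h.exists_isTangentField hd hp Z.2
  have h1 := h.fderiv_fnF_fderiv hp (hY p hp).1
    (fun q hq => (h.mem_tangentSpaceAt_iff hd hq _).1 (hY q hq).2) X.2
  have h2 := hg p hp X Y hY
  have h3 : (⟨Y p, (hY p hp).2⟩ : tangentSpaceAt (levelSet M (fnF A Q) t) p) = Z := Subtype.ext hYp
  rw [h.mem_tangentSpaceAt_iff hd hp, map_sub, map_smul, h1, h3, hYp, smul_eq_mul] at h2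
  rw [levelForm_apply]
  field_simp
  linarith

theorem isTransversal_fieldN (h : SmoothData M A Q) (hd : ∀ u ∈ M, detA A u ≠ 0) (t : ℝ) :
    IsTransversal (levelSet M (fnF A Q) t) (fieldN (fnF A Q)) := by
  refine h.isTransversal_of hd t (fun p hp => ?_) fun p hp => ?_
  · have h1 : ContDiffAt ℝ ∞ (fun q : Space n => ((-1) ^ n * detA A q.1) • fieldV A q) p := by
      simp only [detA_eq]
      exact (contDiffAt_const.mul (contDiffAt_dotProduct (h.contDiffAt_A_fst hp.1)
        (contDiffAt_snd.comp p (h.contDiffAt_fieldV hp.1)))).smul (h.contDiffAt_fieldV hp.1)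
    refine h1.congr_of_eventuallyEq ?_
    filter_upwards [h.eventually_mem hp.1] with q hq using h.fieldN_eq hq
  · rw [h.fieldN_eq hp.1, map_smul, h.fderiv_fnF_fieldV hp.1]
    simpa using hd _ hp.1

end SmoothData

end Tangent

/-! ### The equiaffine normal of the level sets -/

section Equiaffine

theorem det_gram {ι E : Type*} [Fintype ι] [DecidableEq ι] [AddCommGroup E] [Module ℝ E]
    (b : Module.Basis ι ℝ E) (B : E →ₗ[ℝ] E →ₗ[ℝ] ℝ) (Z : ι → E) :
    (Matrix.of fun i j => B (Z i) (Z j)).det =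
      b.det Z ^ 2 * (Matrix.of fun i j => B (b i) (b j)).det := by
  have hfac : (Matrix.of fun i j => B (Z i) (Z j)) =
      (b.toMatrix Z)ᵀ * (Matrix.of fun i j => B (b i) (b j)) * b.toMatrix Z := by
    ext i j
    rw [Matrix.of_apply]
    conv_lhs => rw [← b.sum_toMatrix_smul_self Z i, ← b.sum_toMatrix_smul_self Z j]
    simp only [map_sum, map_smul, LinearMap.sum_apply, LinearMap.smul_apply, smul_eq_mul,
      Matrix.mul_apply, Matrix.transpose_apply, Matrix.of_apply]
    rw [Finset.sum_congr rfl fun l _ => mul_comm _ _]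
  rw [hfac, Matrix.det_mul, Matrix.det_mul, Matrix.det_transpose, Module.Basis.det_apply]
  ring

variable {n : ℕ} {M : Set (Fin n → ℝ)} {A : (Fin n → ℝ) → Fin (n + 1) → ℝ} {Q : (Fin n → ℝ) → ℝ}
  {u : Fin n → ℝ} {p : Space n} {t : ℝ}

/-- The Gram determinant of `(V, X)` for `B = Hess F + α ⊗ α`, `α = ⟨A, dx⟩`, is computed twice. In
the coordinate frame `B` has determinant `(-1)ⁿ |A dA|²`, to be multiplied by `Υ(V, X)²`. Directly,
`V` being in the radical gives `B(V, ·) = |A dA| α`, and elimination leaves `|A dA|² det Hess F(Xᵢ,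
Xⱼ)`. -/
theorem SmoothData.sq_volumeForm_cons_fieldV (h : SmoothData M A Q) (hp : p.1 ∈ M)
    (hd : detA A p.1 ≠ 0) (X : Fin (n + n) → Space n) :
    (Matrix.of fun i j => hess (fnF A Q) p (X i) (X j)).det =
      (-1) ^ n * volumeForm n (Fin.cons (fieldV A p) X) ^ 2 := by
  let α : Space n → ℝ := fun X => A p.1 ⬝ᵥ X.2
  have hα : α (fieldV A p) = detA A p.1 := by rw [detA_eq]; rfl
  let B : Space n →ₗ[ℝ] Space n →ₗ[ℝ] ℝ :=
    LinearMap.mk₂ ℝ (fun X Y => hess (fnF A Q) p X Y + α X * α Y)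
      (fun _ _ _ => by simp [hess, α]; ring) (fun _ _ _ => by simp [hess, α]; ring)
      (fun _ _ _ => by simp [hess, α]; ring) (fun _ _ _ => by simp [hess, α]; ring)
  have hB : ∀ X Y, B X Y = hess (fnF A Q) p X Y + α X * α Y := fun X Y => rfl
  have h1 := det_gram ((frame n).reindex finSumFinEquiv) B
    (Fin.cons (fieldV A p) X : Fin (n + n + 1) → Space n)
  have h2 : (Matrix.of fun i j => B ((frame n).reindex finSumFinEquiv i)
      ((frame n).reindex finSumFinEquiv j)).det = (-1) ^ n * detA A p.1 ^ 2 := by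
    obtain ⟨H, hH, hM⟩ := h.hessMatrix_fnF hp
    have : (Matrix.of fun i j => B ((frame n).reindex finSumFinEquiv i)
      ((frame n).reindex finSumFinEquiv j)) = Matrix.reindex finSumFinEquiv finSumFinEquiv
        (Matrix.fromBlocks H (jacobian A p.1)ᵀ (jacobian A p.1) (Matrix.vecMulVec (A p.1) (A p.1))) := by
      ext i j
      obtain ⟨i, rfl⟩ := finSumFinEquiv.surjective i
      obtain ⟨j, rfl⟩ := finSumFinEquiv.surjective j
      have h3 := congrFun (congrFun hM i) j
      simp only [hessMatrix, Matrix.of_apply] at h3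
      rw [Matrix.of_apply, Module.Basis.reindex_apply, Module.Basis.reindex_apply,
        Equiv.symm_apply_apply, Equiv.symm_apply_apply, hB, h3]
      rcases i with i | i <;> rcases j with j | j <;>
        simp [α, frame_inl, frame_inr, Matrix.vecMulVec_apply]
    rw [this, Matrix.det_reindex_self, det_fromBlocks_vecMulVec]
    change _ * detA A p.1 * detA A p.1 = _
    ring
  rw [h2] at h1
  have h4 : (Matrix.of fun i j => B ((Fin.cons (fieldV A p) X : Fin (n + n + 1) → Space n) i)
      ((Fin.cons (fieldV A p) X : Fin (n + n + 1) → Space n) j)).det =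
      detA A p.1 ^ 2 * (Matrix.of fun i j => hess (fnF A Q) p (X i) (X j)).det := by
    -- Subtracting `α(Xᵢ) / |A dA|` times the `V`-row from the `Xᵢ`-row removes the `α ⊗ α` term and
    -- clears the first column below its top entry.
    rw [Matrix.det_eq_of_forall_row_eq_smul_add_const
      (B := Matrix.of fun i j => (Fin.cons (Fin.cons (detA A p.1 ^ 2) fun j => detA A p.1 * α (X j))
        (fun i => Fin.cons 0 fun j => hess (fnF A Q) p (X i) (X j)) :
          Fin (n + n + 1) → Fin (n + n + 1) → ℝ) i j)
      (Fin.cons 0 fun i => α (X i) / detA A p.1) 0 (by simp)]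
    · rw [Matrix.det_succ_column_zero, Finset.sum_eq_single 0]
      · simp only [Fin.val_zero, pow_zero, one_mul, Matrix.of_apply, Fin.cons_zero]
        congr 1
      · intro i _ hi
        obtain ⟨i, rfl⟩ := Fin.exists_succ_eq.2 hi
        simp
      · simp
    · intro i j
      refine Fin.cases ?_ (fun i => ?_) i <;> refine Fin.cases ?_ (fun j => ?_) j <;>
        simp [hB, h.hess_fieldV hp, h.hess_fieldV_right hp, hα]
      · ring
      · field_simp
      · field_simp
  have h5 : detA A p.1 ^ 2 ≠ 0 := pow_ne_zero _ hd
  apply mul_left_cancel₀ h5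
  refine (h4.symm.trans h1).trans ?_
  change volumeForm n _ ^ 2 * _ = _
  ring

theorem differentiableAt_fderiv_volumeForm {ξ : Space n → Space n} {Y : Fin (n + n) → Space n → Space n}
    (hξ : DifferentiableAt ℝ ξ p) (hY : ∀ i, DifferentiableAt ℝ (Y i) p) (X : Space n) :
    fderiv ℝ (fun q => volumeForm n (Fin.cons (ξ q) fun i => Y i q)) p X =
      volumeForm n (Fin.cons (fderiv ℝ ξ p X) fun i => Y i p) +
        ∑ i, volumeForm n (Fin.cons (ξ p) (Function.update (fun j => Y j p) i (fderiv ℝ (Y i) p X))) := by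
  let f : ContinuousMultilinearMap ℝ (fun _ : Fin (n + n + 1) => Space n) ℝ :=
    { (volumeForm n).toMultilinearMap with
      cont := by
        change Continuous fun v : Fin (n + n + 1) → Space n => volumeForm n v
        unfold volumeForm
        simp_rw [Module.Basis.det_apply]
        refine Continuous.matrix_det (continuous_matrix fun i j => ?_)
        exact (LinearMap.continuous_of_finiteDimensional
          (((frame n).reindex finSumFinEquiv).coord i)).comp (continuous_apply j) }
  have hg : ∀ i, HasFDerivAt ((Fin.cons ξ Y : Fin (n + n + 1) → Space n → Space n) i)
      ((Fin.cons (fderiv ℝ ξ p) fun i => fderiv ℝ (Y i) p :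
        Fin (n + n + 1) → Space n →L[ℝ] Space n) i) p := by
    intro i
    refine Fin.cases ?_ (fun i => ?_) i
    · exact hξ.hasFDerivAt
    · exact (hY i).hasFDerivAt
  have h1 := HasFDerivAt.multilinear_comp f hg
  have hcons : ∀ q, (fun i => (Fin.cons ξ Y : Fin (n + n + 1) → Space n → Space n) i q) =
      (Fin.cons (ξ q) fun i => Y i q) := fun q => by
    ext1 i
    refine Fin.cases ?_ (fun i => ?_) i <;> rfl
  simp only [hcons] at h1
  change fderiv ℝ (fun q => f (Fin.cons (ξ q) fun i => Y i q)) p X = _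
  rw [h1.fderiv, Fin.sum_univ_succ]
  simp only [add_apply, sum_apply, ContinuousLinearMap.comp_apply,
    ContinuousMultilinearMap.toContinuousLinearMap_apply, Fin.cons_zero, Fin.cons_succ,
    Fin.update_cons_zero, ← Fin.cons_update]
  rfl

theorem volumeForm_cons_update_sub_smul (ξ : Space n) (Y : Fin (n + n) → Space n) (i : Fin (n + n))
    (Z : Space n) (c : ℝ) :
    volumeForm n (Fin.cons ξ (Function.update Y i (Z - c • ξ))) =
      volumeForm n (Fin.cons ξ (Function.update Y i Z)) := by
  have h0 : volumeForm n (Fin.cons ξ (Function.update Y i ξ)) = 0 := by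
    refine (volumeForm n).map_eq_zero_of_eq _ (i := (0 : Fin (n + n + 1)))
      (j := (i.succ : Fin (n + n + 1))) ?_ (Fin.succ_ne_zero i).symm
    simp
  have h1 := (volumeForm n).map_update_sub (Fin.cons ξ Y : Fin (n + n + 1) → Space n)
    (i.succ : Fin (n + n + 1)) Z (c • ξ)
  have h2 := (volumeForm n).map_update_smul (Fin.cons ξ Y : Fin (n + n + 1) → Space n)
    (i.succ : Fin (n + n + 1)) c ξ
  rw [Fin.cons_update] at h0 ⊢
  rw [Fin.cons_update]
  refine h1.trans ?_
  rw [h2, h0]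
  simp

namespace SmoothData

theorem tangentSpaceAt_eq (h : SmoothData M A Q) (hd : ∀ u ∈ M, detA A u ≠ 0)
    (hp : p ∈ levelSet M (fnF A Q) t) :
    tangentSpaceAt (levelSet M (fnF A Q) t) p = LinearMap.ker (fderiv ℝ (fnF A Q) p).toLinearMap := by
  ext X
  exact h.mem_tangentSpaceAt_iff hd hp X

theorem finrank_tangentSpaceAt (h : SmoothData M A Q) (hd : ∀ u ∈ M, detA A u ≠ 0)
    (hp : p ∈ levelSet M (fnF A Q) t) :
    Module.finrank ℝ (tangentSpaceAt (levelSet M (fnF A Q) t) p) = 2 * n := by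
  have hne : (fderiv ℝ (fnF A Q) p).toLinearMap ≠ 0 := fun h0 => by
    apply hd _ hp.1
    rw [← h.fderiv_fnF_fieldV hp.1]
    exact LinearMap.congr_fun h0 _
  have h1 := Module.Dual.finrank_ker_add_one_of_ne_zero (f := (fderiv ℝ (fnF A Q) p).toLinearMap) hne
  have h2 : Module.finrank ℝ (Space n) = 2 * n + 1 := by
    simp; ring
  rw [h.tangentSpaceAt_eq hd hp]
  omega

theorem volumeForm_eq_zero (h : SmoothData M A Q) (hd : ∀ u ∈ M, detA A u ≠ 0)
    (hp : p ∈ levelSet M (fnF A Q) t) {Z : Space n} {X : Fin (n + n) → Space n}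
    (hZ : Z ∈ tangentSpaceAt (levelSet M (fnF A Q) t) p)
    (hX : ∀ i, X i ∈ tangentSpaceAt (levelSet M (fnF A Q) t) p) :
    volumeForm n (Fin.cons Z X) = 0 := by
  apply AlternatingMap.map_linearDependent
  intro hli
  let Z' : Fin (n + n + 1) → tangentSpaceAt (levelSet M (fnF A Q) t) p :=
    Fin.cons ⟨Z, hZ⟩ fun i => ⟨X i, hX i⟩
  have hZ' : LinearIndependent ℝ Z' := by
    apply LinearIndependent.of_comp (tangentSpaceAt (levelSet M (fnF A Q) t) p).subtype
    have : (tangentSpaceAt (levelSet M (fnF A Q) t) p).subtype ∘ Z' = Fin.cons Z X := by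
      ext1 i
      refine Fin.cases ?_ (fun i => ?_) i <;> rfl
    rw [this]
    exact hli
  have := hZ'.fintype_card_le_finrank
  rw [h.finrank_tangentSpaceAt hd hp, Fintype.card_fin] at this
  omega

theorem exists_tangent_frame (h : SmoothData M A Q) (hd : ∀ u ∈ M, detA A u ≠ 0)
    (hp : p ∈ levelSet M (fnF A Q) t) :
    ∃ X : Fin (n + n) → tangentSpaceAt (levelSet M (fnF A Q) t) p,
      ∀ ξ, ξ ∉ tangentSpaceAt (levelSet M (fnF A Q) t) p →
        volumeForm n (Fin.cons ξ fun i => (X i : Space n)) ≠ 0 := by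
  let b := Module.finBasisOfFinrankEq ℝ (tangentSpaceAt (levelSet M (fnF A Q) t) p)
    ((h.finrank_tangentSpaceAt hd hp).trans (two_mul n))
  refine ⟨b, fun ξ hξ => ?_⟩
  have hli : LinearIndependent ℝ (Fin.cons ξ fun i => (b i : Space n) : Fin (n + n + 1) → Space n) := by
    rw [linearIndependent_finCons]
    refine ⟨b.linearIndependent.map' (Submodule.subtype _) (Submodule.ker_subtype _), fun hs => hξ ?_⟩
    refine Submodule.span_le.2 ?_ hs
    rintro _ ⟨i, rfl⟩
    exact (b i).2
  have h2 : Fintype.card (Fin (n + n + 1)) = Module.finrank ℝ (Space n) := by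
    simp; ring
  exact (((frame n).reindex finSumFinEquiv).is_basis_iff_det.1
    ⟨hli, hli.span_eq_top_of_card_eq_finrank' h2⟩).ne_zero

end SmoothData

/-- The induced volume form of `ξ` is parallel exactly if `D ξ` is tangent. -/
theorem volumeForm_parallel_iff {ξ : Space n → Space n} (hξ : DifferentiableAt ℝ ξ p)
    {Y : Fin (n + n) → Space n → Space n} (hY : ∀ i, DifferentiableAt ℝ (Y i) p) (X : Space n)
    (c : Fin (n + n) → ℝ) :
    (fderiv ℝ (fun q => volumeForm n (Fin.cons (ξ q) fun i => Y i q)) p X =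
      ∑ i, volumeForm n (Fin.cons (ξ p) (Function.update (fun j => Y j p) i
        (fderiv ℝ (Y i) p X - c i • ξ p)))) ↔
      volumeForm n (Fin.cons (fderiv ℝ ξ p X) fun i => Y i p) = 0 := by
  -- The product rule reproduces the sum on the right, up to multiples of `ξ` which the form
  -- ignores; only the term differentiating `ξ` is left over.
  rw [differentiableAt_fderiv_volumeForm hξ hY]
  simp_rw [volumeForm_cons_update_sub_smul]
  simp

end Equiaffine

/-! ### Existence, uniqueness and shape operator of the equiaffine normal when `|A dA|` is constant.
-/

section EquiaffineNormal

variable {n : ℕ} {M : Set (Fin n → ℝ)} {A : (Fin n → ℝ) → Fin (n + 1) → ℝ} {Q : (Fin n → ℝ) → ℝ}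
  {u : Fin n → ℝ} {p : Space n} {t : ℝ} {κ c : ℝ}

/-- The shape operator of a level set of `F` with respect to `c • V`. -/
def levelShape (A : (Fin n → ℝ) → Fin (n + 1) → ℝ) (S : Set (Space n)) (c : ℝ) (p : Space n) :
    Module.End ℝ (tangentSpaceAt S p) :=
  open scoped Classical in
  if hT : ∀ X ∈ tangentSpaceAt S p, (fderiv ℝ (fieldV A) p).toLinearMap X ∈ tangentSpaceAt S p then
    -c • (fderiv ℝ (fieldV A) p).toLinearMap.restrict hT else 0

/-- Applied with `a = Υ(ξ, X)`, `b = Υ(V, X)`, `d = dF(ξ)`, `s = |det h(Xᵢ, Xⱼ)|^{1/2}` and `m = n`,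
it converts the volume condition into `|dF(ξ)|^(n+1) = |κ|`. -/
theorem abs_eq_iff_pow_succ_eq {a b s d : ℝ} {m : ℕ} (h1 : a * κ = d * b) (h2 : s * |d| ^ m = |b|)
    (hd : d ≠ 0) (ha : a ≠ 0) : |a| = s ↔ |d| ^ (m + 1) = |κ| := by
  have h3 := congrArg abs h1
  rw [abs_mul, abs_mul, ← h2] at h3
  have hd' := abs_ne_zero.2 hd
  have ha' := abs_ne_zero.2 ha
  constructor
  · rintro rfl
    apply mul_left_cancel₀ ha'
    rw [h3]
    ring
  · intro h
    rw [← h] at h3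
    apply mul_right_cancel₀ (pow_ne_zero (m + 1) hd')
    rw [h3]
    ring

namespace SmoothData

/-- `ξ - (dF(ξ) / |A dA|) V` is tangent, and `2n + 1` tangent vectors are dependent. -/
theorem volumeForm_cons_mul_detA (h : SmoothData M A Q) (hd : ∀ u ∈ M, detA A u ≠ 0)
    (hp : p ∈ levelSet M (fnF A Q) t) (ξ : Space n) {X : Fin (n + n) → Space n}
    (hX : ∀ i, X i ∈ tangentSpaceAt (levelSet M (fnF A Q) t) p) :
    volumeForm n (Fin.cons ξ X) * detA A p.1 =
      fderiv ℝ (fnF A Q) p ξ * volumeForm n (Fin.cons (fieldV A p) X) := by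
  have hne := hd _ hp.1
  set a := fderiv ℝ (fnF A Q) p ξ / detA A p.1 with ha
  have h0 := h.volumeForm_eq_zero hd hp (Z := ξ - a • fieldV A p) (X := X) (by
    rw [h.mem_tangentSpaceAt_iff hd hp, map_sub, map_smul, h.fderiv_fnF_fieldV hp.1, smul_eq_mul, ha,
      div_mul_cancel₀ _ hne, sub_self]) hX
  have h1 := (volumeForm n).map_update_sub (Fin.cons ξ X : Fin (n + n + 1) → Space n)
    (0 : Fin (n + n + 1)) ξ (a • fieldV A p)
  have h2 := (volumeForm n).map_update_smul (Fin.cons ξ X : Fin (n + n + 1) → Space n)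
    (0 : Fin (n + n + 1)) a (fieldV A p)
  rw [h2] at h1
  simp only [Fin.update_cons_zero] at h1
  have h3 := h0.symm.trans h1
  rw [smul_eq_mul] at h3
  have h4 : volumeForm n (Fin.cons ξ X) = a * volumeForm n (Fin.cons (fieldV A p) X) :=
    sub_eq_zero.1 h3.symm
  rw [h4, ha]
  field_simp

theorem sqrt_det_levelForm (h : SmoothData M A Q) (hd : ∀ u ∈ M, detA A u ≠ 0)
    (hp : p ∈ levelSet M (fnF A Q) t) {ξ : Space n → Space n}
    (hξ : fderiv ℝ (fnF A Q) p (ξ p) ≠ 0)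
    (X : Fin (n + n) → tangentSpaceAt (levelSet M (fnF A Q) t) p) :
    √|(Matrix.of fun i j => levelForm (fnF A Q) (levelSet M (fnF A Q) t) ξ p (X i) (X j)).det| *
      |fderiv ℝ (fnF A Q) p (ξ p)| ^ n =
        |volumeForm n (Fin.cons (fieldV A p) fun i => (X i : Space n))| := by
  set d := fderiv ℝ (fnF A Q) p (ξ p)
  have h1 : (Matrix.of fun i j => levelForm (fnF A Q) (levelSet M (fnF A Q) t) ξ p (X i) (X j)) =
      (-d⁻¹) • Matrix.of fun i j => hess (fnF A Q) p (X i) (X j) := rfl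
  rw [h1, Matrix.det_smul, h.sq_volumeForm_cons_fieldV hp.1 (hd _ hp.1) fun i => (X i : Space n),
    Fintype.card_fin]
  have h2 : |(-d⁻¹) ^ (n + n) * ((-1) ^ n *
      volumeForm n (Fin.cons (fieldV A p) fun i => (X i : Space n)) ^ 2)| =
      ((|d| ^ n)⁻¹ * |volumeForm n (Fin.cons (fieldV A p) fun i => (X i : Space n))|) ^ 2 := by
    simp only [abs_mul, abs_pow, abs_neg, abs_inv, abs_one, one_pow, one_mul, mul_pow]
    rw [← two_mul, pow_mul', inv_pow]
  refine (congrArg (fun r => √r * |d| ^ n) h2).trans ?_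
  rw [Real.sqrt_sq (by positivity)]
  have : |d| ^ n ≠ 0 := pow_ne_zero _ (abs_ne_zero.2 hξ)
  field_simp

/-- `V` depends only on `u` and has only `x`-components, so `DV` kills vectors with zero `u`-part
and takes values among them. Both `S² = 0` and the vanishing of `S` on the ruling rest on this. -/
theorem fderiv_fieldV (h : SmoothData M A Q) (hp : p.1 ∈ M) (X : Space n) :
    fderiv ℝ (fieldV A) p X = (0, fderiv ℝ (fun q => minorVec (jacobian A q)) p.1 X.1) := by
  have hw := (h.contDiffAt_minorVec hp).differentiableAt (by simp)
  have h1 : HasFDerivAt (fieldV A) ((0 : Space n →L[ℝ] (Fin n → ℝ)).prod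
      ((fderiv ℝ (fun q => minorVec (jacobian A q)) p.1).comp
        (ContinuousLinearMap.fst ℝ (Fin n → ℝ) (Fin (n + 1) → ℝ)))) p :=
    (hasFDerivAt_const 0 p).prodMk (HasFDerivAt.comp p hw.hasFDerivAt hasFDerivAt_fst)
  rw [h1.fderiv]
  rfl

/-- Differentiate `⟨A, w⟩ = |A dA| = κ` for the minor vector `w`: the other term `⟨dA(v), w⟩`
vanishes identically. This makes `DV` tangent to the level sets. -/
theorem dotProduct_fderiv_minorVec (h : SmoothData M A Q) (hdet : ∀ u ∈ M, detA A u = κ)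
    (hu : u ∈ M) (v : Fin n → ℝ) :
    A u ⬝ᵥ fderiv ℝ (fun q => minorVec (jacobian A q)) u v = 0 := by
  have hw := (h.contDiffAt_minorVec hu).differentiableAt (by simp)
  have hA := (h.contDiffAt_A hu).differentiableAt (by simp)
  have h1 := (differentiableAt_and_fderiv_dotProduct hA hw).2 v
  have h2 : (fun q => A q ⬝ᵥ minorVec (jacobian A q)) =ᶠ[𝓝 u] fun _ => κ := by
    filter_upwards [h.isOpen.mem_nhds hu] with q hq
    rw [← detA_eq, hdet q hq]
  rw [h2.fderiv_eq, fderiv_dotProduct_minorVec] at h1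
  simpa using h1.symm

theorem fderiv_fnF_fderiv_fieldV (h : SmoothData M A Q) (hdet : ∀ u ∈ M, detA A u = κ)
    (hp : p.1 ∈ M) (X : Space n) : fderiv ℝ (fnF A Q) p (fderiv ℝ (fieldV A) p X) = 0 := by
  rw [h.fderiv_fieldV hp, h.fderiv_fnF hp]
  simp [h.dotProduct_fderiv_minorVec hdet hp]

theorem levelShape_apply (h : SmoothData M A Q) (hκ : κ ≠ 0) (hdet : ∀ u ∈ M, detA A u = κ)
    (hp : p ∈ levelSet M (fnF A Q) t) (X : tangentSpaceAt (levelSet M (fnF A Q) t) p) :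
    (levelShape A (levelSet M (fnF A Q) t) c p X : Space n) = -c • fderiv ℝ (fieldV A) p X := by
  have hd : ∀ u ∈ M, detA A u ≠ 0 := fun u hu => by rwa [hdet u hu]
  rw [levelShape, dif_pos]
  · rfl
  · intro X _
    exact (h.mem_tangentSpaceAt_iff hd hp _).2 (h.fderiv_fnF_fderiv_fieldV hdet hp.1 X)

theorem levelShape_apply_eq_zero (h : SmoothData M A Q) (hκ : κ ≠ 0) (hdet : ∀ u ∈ M, detA A u = κ)
    (hp : p ∈ levelSet M (fnF A Q) t) (X : tangentSpaceAt (levelSet M (fnF A Q) t) p)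
    (hX : (X : Space n).1 = 0) : levelShape A (levelSet M (fnF A Q) t) c p X = 0 := by
  apply Subtype.ext
  rw [h.levelShape_apply hκ hdet hp, h.fderiv_fieldV hp.1, hX, map_zero]
  simp

theorem levelShape_comp_self (h : SmoothData M A Q) (hκ : κ ≠ 0) (hdet : ∀ u ∈ M, detA A u = κ)
    (hp : p ∈ levelSet M (fnF A Q) t) :
    levelShape A (levelSet M (fnF A Q) t) c p ∘ₗ levelShape A (levelSet M (fnF A Q) t) c p = 0 := by
  ext1 X
  apply h.levelShape_apply_eq_zero hκ hdet hp
  rw [h.levelShape_apply hκ hdet hp, h.fderiv_fieldV hp.1]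
  simp

theorem meanCurvature_levelShape (h : SmoothData M A Q) (hκ : κ ≠ 0)
    (hdet : ∀ u ∈ M, detA A u = κ) (hp : p ∈ levelSet M (fnF A Q) t) :
    meanCurvature (2 * n) (levelShape A (levelSet M (fnF A Q) t) c) p = 0 := by
  have : IsNilpotent (levelShape A (levelSet M (fnF A Q) t) c p) :=
    ⟨2, by rw [pow_two]; exact h.levelShape_comp_self hκ hdet hp⟩
  rw [meanCurvature, (LinearMap.isNilpotent_trace_of_isNilpotent this).eq_zero, mul_zero]

theorem fderiv_fnF_smul_fieldV (h : SmoothData M A Q) (hdet : ∀ u ∈ M, detA A u = κ)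
    (hp : p.1 ∈ M) (c : ℝ) : fderiv ℝ (fnF A Q) p (c • fieldV A p) = c * κ := by
  rw [map_smul, h.fderiv_fnF_fieldV hp, hdet _ hp, smul_eq_mul]

theorem isEquiaffineNormal (h : SmoothData M A Q) (hκ : κ ≠ 0) (hdet : ∀ u ∈ M, detA A u = κ)
    (hc0 : c ≠ 0) (hc : |c * κ| ^ (n + 1) = |κ|) (t : ℝ) :
    IsEquiaffineNormal (volumeForm n) (levelSet M (fnF A Q) t) (fun p => c • fieldV A p)
      (levelForm (fnF A Q) (levelSet M (fnF A Q) t) fun p => c • fieldV A p)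
      (levelShape A (levelSet M (fnF A Q) t) c) := by
  have hd : ∀ u ∈ M, detA A u ≠ 0 := fun u hu => by rwa [hdet u hu]
  have hdF : ∀ p : Space n, p.1 ∈ M → fderiv ℝ (fnF A Q) p (c • fieldV A p) ≠ 0 := fun p hp => by
    rw [h.fderiv_fnF_smul_fieldV hdet hp]
    exact mul_ne_zero hc0 hκ
  have hs : ∀ p : Space n, p.1 ∈ M → ContDiffAt ℝ ∞ (fun p => c • fieldV A p) p := fun p hp =>
    ContDiffAt.const_smul c (h.contDiffAt_fieldV hp)
  have hDξ : ∀ p : Space n, p.1 ∈ M → ∀ X, fderiv ℝ (fun p => c • fieldV A p) p X =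
      c • fderiv ℝ (fieldV A) p X := fun p hp X => by
    rw [fderiv_fun_const_smul ((h.contDiffAt_fieldV hp).differentiableAt (by simp))]
    rfl
  refine ⟨h.isTransversal_of hd t (fun p hp => hs p hp.1) fun p hp => hdF p hp.1,
    h.isSecondFundamentalForm_levelForm hd t fun p hp => hdF p hp.1, ⟨0, fun p hp X => ?_⟩,
    fun p hp X => ?_, fun p hp X Y hY => ?_⟩
  · rw [hDξ p hp.1, h.levelShape_apply hκ hdet hp]
    simp
  · have h1 := h.volumeForm_cons_mul_detA hd hp (c • fieldV A p) fun i => (X i).2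
    have h2 := h.sqrt_det_levelForm (ξ := fun p => c • fieldV A p) hd hp (hdF p hp.1) X
    simp only [h.fderiv_fnF_smul_fieldV hdet hp.1, hdet _ hp.1] at h1 h2
    -- The passage to powers divides by `Υ(W, X)`; when this is zero, both sides of the volume
    -- condition vanish.
    by_cases hb : volumeForm n (Fin.cons (c • fieldV A p) fun i => (X i : Space n)) = 0
    · have h3 : volumeForm n (Fin.cons (fieldV A p) fun i => (X i : Space n)) = 0 :=
        (mul_eq_zero.1 (((congrArg (· * κ) hb).trans (zero_mul _)).symm.trans h1).symm).resolve_left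
          (mul_ne_zero hc0 hκ)
      have h4 := h2.trans ((congrArg abs h3).trans abs_zero)
      exact (congrArg abs hb).trans (abs_zero.trans ((mul_eq_zero.1 h4).resolve_right
        (pow_ne_zero n (abs_ne_zero.2 (mul_ne_zero hc0 hκ)))).symm)
    · exact (abs_eq_iff_pow_succ_eq h1 h2 (mul_ne_zero hc0 hκ) hb).2 hc
  · rw [volumeForm_parallel_iff ((hs p hp.1).differentiableAt (by simp))
      fun i => (hY i p hp).1.differentiableAt (by simp)]
    refine h.volumeForm_eq_zero hd hp ?_ fun i => (hY i p hp).2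
    rw [h.mem_tangentSpaceAt_iff hd hp, hDξ p hp.1, map_smul, h.fderiv_fnF_fderiv_fieldV hdet hp.1,
      smul_zero]

/-- The volume condition and the co-orientation give `dF(W) = cκ`. Parallelism gives `dF(D_Y W) =
0`, so differentiating the constant `dF(W)` yields `Hess F(Y, W) = 0` for tangent `Y`. Then `W - c
V` is tangent and Hessian-orthogonal to the tangent space, hence zero. -/
theorem eq_of_isEquiaffineNormal (h : SmoothData M A Q) (hκ : κ ≠ 0)
    (hdet : ∀ u ∈ M, detA A u = κ) (hc0 : c ≠ 0) (hc : |c * κ| ^ (n + 1) = |κ|)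
    {W : Space n → Space n}
    {g : (p : Space n) → LinearMap.BilinForm ℝ (tangentSpaceAt (levelSet M (fnF A Q) t) p)}
    {S : (p : Space n) → Module.End ℝ (tangentSpaceAt (levelSet M (fnF A Q) t) p)}
    (hW : IsEquiaffineNormal (volumeForm n) (levelSet M (fnF A Q) t) W g S)
    (hco : SameCoorientation (levelSet M (fnF A Q) t) W fun p => c • fieldV A p)
    (hp : p ∈ levelSet M (fnF A Q) t) : W p = c • fieldV A p := by
  have hd : ∀ u ∈ M, detA A u ≠ 0 := fun u hu => by rwa [hdet u hu]
  have hdW : ∀ q ∈ levelSet M (fnF A Q) t, fderiv ℝ (fnF A Q) q (W q) = c * κ := by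
    intro q hq
    obtain ⟨l, hl, hlT⟩ := hco q hq
    rw [h.mem_tangentSpaceAt_iff hd hq, map_sub, map_smul, h.fderiv_fnF_smul_fieldV hdet hq.1,
      sub_eq_zero, smul_eq_mul] at hlT
    have hne : fderiv ℝ (fnF A Q) q (W q) ≠ 0 := by
      rw [hlT]
      exact mul_ne_zero hl.ne' (mul_ne_zero hc0 hκ)
    obtain ⟨X, hX⟩ := h.exists_tangent_frame hd hq
    have h1 := hW.volume q hq X
    rw [h.secondFundamentalForm_eq hd hq hne hW.secondForm] at h1
    have h2 := h.sqrt_det_levelForm hd hq hne X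
    have h3 := h.volumeForm_cons_mul_detA hd hq (W q) fun i => (X i).2
    rw [hdet _ hq.1] at h3
    have h5 := (abs_eq_iff_pow_succ_eq h3 h2 hne (hX _ (hW.transversal q hq).2)).1 h1
    rw [hlT, abs_mul l, mul_pow, abs_of_pos hl, hc] at h5
    -- The co-orientation supplies `dF(W) = l c κ` with `l > 0`; comparing `(n+1)`-st powers leaves
    -- only `l = 1`.
    have h6 : l ^ (n + 1) = 1 := by
      exact mul_right_cancel₀ (abs_ne_zero.2 hκ) (h5.trans (one_mul _).symm)
    rw [hlT, (pow_eq_one_iff_of_nonneg hl.le (Nat.succ_ne_zero n)).1 h6, one_mul]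
  have hs := (hW.transversal p hp).1
  have hZ : W p - c • fieldV A p ∈ tangentSpaceAt (levelSet M (fnF A Q) t) p := by
    rw [h.mem_tangentSpaceAt_iff hd hp, map_sub, hdW p hp, h.fderiv_fnF_smul_fieldV hdet hp.1, sub_self]
  rw [← sub_eq_zero]
  refine h.eq_zero_of_hess_eq_zero hd hp hZ fun Y hY => ?_
  obtain ⟨X, hX⟩ := h.exists_tangent_frame hd hp
  choose F hF hFp using fun i => h.exists_isTangentField hd hp (X i).2
  have h1 := (volumeForm_parallel_iff (hs.differentiableAt (by simp))
    (fun i => (hF i p hp).1.differentiableAt (by simp)) Y _).1 (hW.parallel p hp ⟨Y, hY⟩ F hF)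
  have h2 := h.volumeForm_cons_mul_detA hd hp (fderiv ℝ W p Y) fun i => (hF i p hp).2
  have h3 := hX (fieldV A p) fun hT => hd _ hp.1 (by
    rw [← h.fderiv_fnF_fieldV hp.1, (h.mem_tangentSpaceAt_iff hd hp _).1 hT])
  simp only [hFp] at h1 h2
  replace h2 := (mul_eq_zero.1
    (((congrArg (· * detA A p.1) h1).trans (zero_mul _)).symm.trans h2).symm).resolve_right h3
  rw [h.fderiv_fnF_fderiv hp hs hdW hY, neg_eq_zero] at h2
  rw [h.hess_symm hp.1]
  have h4 := h.hess_fieldV_right hp.1 Y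
  rw [hess] at h2 h4 ⊢
  rw [map_sub, map_smul, h2, h4]
  simp

/-- Tangent vectors with zero `u`-part form an isotropic subspace of dimension at least `n` in a
`2n`-dimensional space. So each of the two indices is at most `n`, and by nondegeneracy they add up
to `2n`. -/
theorem sig_levelForm (h : SmoothData M A Q) (hd : ∀ u ∈ M, detA A u ≠ 0)
    (hp : p ∈ levelSet M (fnF A Q) t) {ξ : Space n → Space n}
    (hξ : fderiv ℝ (fnF A Q) p (ξ p) ≠ 0) :
    sigPos (LinearMap.BilinMap.toQuadraticMap
      (levelForm (fnF A Q) (levelSet M (fnF A Q) t) ξ p)) = n ∧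
    sigNeg (LinearMap.BilinMap.toQuadraticMap
      (levelForm (fnF A Q) (levelSet M (fnF A Q) t) ξ p)) = n := by
  set B := levelForm (fnF A Q) (levelSet M (fnF A Q) t) ξ p with hB
  set q : QuadraticForm ℝ (tangentSpaceAt (levelSet M (fnF A Q) t) p) :=
    LinearMap.BilinMap.toQuadraticMap B with hq
  have hsymm : ∀ X Y, B X Y = B Y X := fun X Y => by
    rw [hB, levelForm_apply, levelForm_apply, h.hess_symm hp.1]
  have hfin := h.finrank_tangentSpaceAt hd hp
  let f : tangentSpaceAt (levelSet M (fnF A Q) t) p →ₗ[ℝ] (Fin n → ℝ) :=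
    LinearMap.fst ℝ (Fin n → ℝ) (Fin (n + 1) → ℝ) ∘ₗ Submodule.subtype _
  have hker : n ≤ Module.finrank ℝ (LinearMap.ker f) := by
    have h1 := f.finrank_range_add_finrank_ker
    have h2 := Submodule.finrank_le (LinearMap.range f)
    simp only [Module.finrank_fintype_fun_eq_card, Fintype.card_fin] at h2
    omega
  have hiso : ∀ X ∈ LinearMap.ker f, q X = 0 := by
    intro X hX
    have hX' : (X : Space n).1 = 0 := hX
    change B X X = 0
    rw [hB, levelForm_apply, h.hess_fnF hp.1, hX']
    simp [hessU]
  have hrad : q.radical = ⊥ := by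
    rw [eq_bot_iff]
    intro X hX
    rw [QuadraticMap.mem_radical_iff'] at hX
    have h1 : ∀ Y, B X Y = 0 := by
      intro Y
      have h2 : B (X + Y) (X + Y) = B Y Y := hX.2 Y
      have h3 : B X X = 0 := hX.1
      simp only [map_add, LinearMap.add_apply] at h2
      have := hsymm X Y
      linarith
    exact (h.nondegenerate_levelForm hd hp hξ).1 X h1
  have h1 := QuadraticForm.sigPos_add_finrank_le_of_nonpos (Q := q) (V := LinearMap.ker f)
    fun X hX => (hiso X hX).le
  have h2 := QuadraticForm.sigPos_add_finrank_le_of_nonpos (Q := -q) (V := LinearMap.ker f)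
    fun X hX => by simp [hiso X hX]
  have h3 := QuadraticForm.sigPos_add_sigNeg_add_radical (Q := q)
  rw [hrad, finrank_bot] at h3
  rw [sigPos_neg] at h2
  omega

end SmoothData

end EquiaffineNormal

/-! ### The ruling of the level sets -/

section Ruling

variable {n : ℕ} {M : Set (Fin n → ℝ)} {A : (Fin n → ℝ) → Fin (n + 1) → ℝ} {Q : (Fin n → ℝ) → ℝ}
  {u : Fin n → ℝ} {p : Space n} {t : ℝ} {κ : ℝ}

/-- The hyperplane of all `(0, y)` with `⟨a, y⟩ = 0`. -/
def rulingDirection (a : Fin (n + 1) → ℝ) : Submodule ℝ (Space n) where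
  carrier := {X | X.1 = 0 ∧ a ⬝ᵥ X.2 = 0}
  add_mem' := by
    rintro X Y ⟨h1, h2⟩ ⟨h3, h4⟩
    exact ⟨by simp [h1, h3], by simp [dotProduct_add, h2, h4]⟩
  zero_mem' := by simp
  smul_mem' := by
    rintro c X ⟨h1, h2⟩
    exact ⟨by simp [h1], by simp [h2]⟩

theorem mem_rulingDirection {a : Fin (n + 1) → ℝ} {X : Space n} :
    X ∈ rulingDirection a ↔ X.1 = 0 ∧ a ⬝ᵥ X.2 = 0 := Iff.rfl

/-- The vectors `aᵢ eⱼ - aⱼ eᵢ`, `j ≠ i`. -/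
def rulingFrame (a : Fin (n + 1) → ℝ) (i : Fin (n + 1)) (j : Fin n) : Space n :=
  (0, a i • Pi.single (i.succAbove j) 1 - a (i.succAbove j) • Pi.single i 1)

theorem rulingFrame_mem (a : Fin (n + 1) → ℝ) (i : Fin (n + 1)) (j : Fin n) :
    rulingFrame a i j ∈ rulingDirection a := by
  refine mem_rulingDirection.2 ⟨rfl, ?_⟩
  simp [rulingFrame, dotProduct_sub]
  ring

theorem sum_smul_rulingFrame {a : Fin (n + 1) → ℝ} {i : Fin (n + 1)} (ha : a i ≠ 0) {X : Space n}
    (hX : X ∈ rulingDirection a) :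
    ∑ j, (X.2 (i.succAbove j) / a i) • rulingFrame a i j = X := by
  obtain ⟨h1, h2⟩ := mem_rulingDirection.1 hX
  refine Prod.ext ?_ ?_
  · rw [h1, Prod.fst_sum]
    simp [rulingFrame]
  · rw [Prod.snd_sum]
    ext k
    rw [Finset.sum_apply]
    refine Fin.succAboveCases i ?_ (fun j => ?_) k
    · rw [dotProduct, Fin.sum_univ_succAbove _ i] at h2
      have h3 : X.2 i = -∑ j, X.2 (i.succAbove j) / a i * a (i.succAbove j) := by
        rw [eq_neg_iff_add_eq_zero]
        apply mul_left_cancel₀ ha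
        rw [mul_zero, ← h2, mul_add, Finset.mul_sum]
        congr 1
        refine Finset.sum_congr rfl fun j _ => ?_
        field_simp
      rw [h3, ← Finset.sum_neg_distrib]
      refine Finset.sum_congr rfl fun j _ => ?_
      simp [rulingFrame, (Fin.succAbove_ne i j).symm]
    · rw [Finset.sum_eq_single j]
      · simp [rulingFrame, Fin.succAbove_ne i j]
        field_simp
      · intro j' _ hj'
        have : i.succAbove j ≠ i.succAbove j' := fun h => hj' (Fin.succAbove_right_injective h).symm
        simp [rulingFrame, Fin.succAbove_ne i j, this]
      · simp

theorem span_rulingFrame {a : Fin (n + 1) → ℝ} {i : Fin (n + 1)} (ha : a i ≠ 0) :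
    Submodule.span ℝ (range fun j => rulingFrame a i j) = rulingDirection a := by
  apply le_antisymm
  · rw [Submodule.span_le]
    rintro _ ⟨j, rfl⟩
    exact rulingFrame_mem a i j
  · intro X hX
    rw [← sum_smul_rulingFrame ha hX]
    exact Submodule.sum_mem _ fun j _ => Submodule.smul_mem _ _ (Submodule.subset_span ⟨j, rfl⟩)

theorem finrank_rulingDirection {a : Fin (n + 1) → ℝ} (ha : a ≠ 0) :
    Module.finrank ℝ (rulingDirection a) = n := by
  obtain ⟨i, hi⟩ := Function.ne_iff.1 ha
  have hi' : a i ≠ 0 := hi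
  rw [← span_rulingFrame hi', finrank_span_eq_card, Fintype.card_fin]
  rw [Fintype.linearIndependent_iff]
  intro g hg j
  have h1 := congrFun (congrArg Prod.snd hg) (i.succAbove j)
  rw [Prod.snd_sum, Finset.sum_apply, Finset.sum_eq_single j] at h1
  · simpa [rulingFrame, Fin.succAbove_ne i j, hi'] using h1
  · intro j' _ hj'
    have : i.succAbove j ≠ i.succAbove j' := fun h => hj' (Fin.succAbove_right_injective h).symm
    simp [rulingFrame, Fin.succAbove_ne i j, this]
  · simp

/-- The leaf through `p`. -/
def rulingLeaf (A : (Fin n → ℝ) → Fin (n + 1) → ℝ) (p : Space n) : AffineSubspace ℝ (Space n) :=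
  AffineSubspace.mk' p (rulingDirection (A p.1))

theorem rulingLeaf_direction (A : (Fin n → ℝ) → Fin (n + 1) → ℝ) (p : Space n) :
    (rulingLeaf A p).direction = rulingDirection (A p.1) :=
  AffineSubspace.direction_mk' _ _

theorem mem_rulingLeaf {q : Space n} :
    q ∈ rulingLeaf A p ↔ q.1 = p.1 ∧ A p.1 ⬝ᵥ q.2 = A p.1 ⬝ᵥ p.2 := by
  rw [rulingLeaf, AffineSubspace.mem_mk', vsub_eq_sub, mem_rulingDirection]
  simp [sub_eq_zero, dotProduct_sub]

namespace SmoothData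

theorem isRuling (h : SmoothData M A Q) (hd : ∀ u ∈ M, detA A u ≠ 0) (t : ℝ) :
    IsRuling n (levelSet M (fnF A Q) t) (rulingLeaf A) := by
  have hA0 : ∀ u ∈ M, A u ≠ 0 := fun u hu h0 => hd u hu (by rw [detA_eq, h0, zero_dotProduct])
  refine ⟨fun p _ => AffineSubspace.self_mem_mk' _ _, fun p hp q hq => ?_, fun p hp => ?_,
    fun p _ q hq => ?_, fun p hp => ?_⟩
  · obtain ⟨h1, h2⟩ := mem_rulingLeaf.1 hq
    refine ⟨by rw [h1]; exact hp.1, ?_⟩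
    rw [← hp.2, fnF, fnF, h1, h2]
  · rw [rulingLeaf_direction, finrank_rulingDirection (hA0 _ hp.1)]
  · obtain ⟨h1, h2⟩ := mem_rulingLeaf.1 hq
    ext x
    rw [mem_rulingLeaf, mem_rulingLeaf, h1, h2]
  · obtain ⟨i, hi⟩ := Function.ne_iff.1 (hA0 _ hp.1)
    have hAi := fun i => (contDiffAt_pi.1 (h.contDiffAt_A_fst hp.1)) i
    refine ⟨fun j q => rulingFrame (A q.1) i j, fun j => ?_, ?_⟩
    · exact contDiffAt_const.prodMk (((hAi _).smul contDiffAt_const).sub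
        ((hAi _).smul contDiffAt_const))
    · filter_upwards [mem_nhdsWithin_of_mem_nhds ((hAi i).continuousAt.eventually_ne hi)] with q hq
      rw [rulingLeaf_direction]
      exact span_rulingFrame hq

/-- If `X` is `Ω`-orthogonal to the leaf, then `dA(X.1)` annihilates everything that `A`
annihilates, so it is a multiple of `A`. Transversality of `A` to the image of `dA` makes it zero,
whence `X.1 = 0`. -/
theorem isLagrangian (h : SmoothData M A Q) (hd : ∀ u ∈ M, detA A u ≠ 0)
    (hp : p ∈ levelSet M (fnF A Q) t) :
    IsLagrangian (formOmega A p) (tangentSpaceAt (levelSet M (fnF A Q) t) p)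
      (rulingLeaf A p).direction := by
  obtain ⟨hinj, hA⟩ := (detA_ne_zero_iff A p.1).1 (hd _ hp.1)
  have hA0 : A p.1 ≠ 0 := fun h0 => hA ⟨0, by rw [h0, map_zero]⟩
  rw [rulingLeaf_direction]
  refine ⟨fun X hX => ?_, fun X hX => ⟨fun hX' Y hY => ?_, fun hX' => ?_⟩⟩
  · obtain ⟨h1, h2⟩ := mem_rulingDirection.1 hX
    rw [h.mem_tangentSpaceAt_iff hd hp, h.fderiv_fnF hp.1, h1, h2]
    simp
  · rw [h.formOmega_apply hp.1, (mem_rulingDirection.1 hX').1, (mem_rulingDirection.1 hY).1]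
    simp
  · obtain ⟨c, hc⟩ := eq_smul_of_orthogonal hA0 (b := fderiv ℝ A p.1 X.1) fun y hy => by
      have := hX' (0, y) (mem_rulingDirection.2 ⟨rfl, hy⟩)
      rw [h.formOmega_apply hp.1] at this
      simpa using this
    have hc0 : c = 0 := by
      by_contra hne
      refine hA ⟨c⁻¹ • X.1, ?_⟩
      rw [map_smul, hc, smul_smul, inv_mul_cancel₀ hne, one_smul]
    have hX1 : X.1 = 0 := hinj (by rw [hc, hc0, zero_smul, map_zero])
    rw [h.mem_tangentSpaceAt_iff hd hp, h.fderiv_fnF hp.1, hX1] at hX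
    exact mem_rulingDirection.2 ⟨hX1, by simpa using hX⟩

theorem exists_mem_levelSet (hd : ∀ u ∈ M, detA A u ≠ 0) (t : ℝ) (hu : u ∈ M) :
    ∃ x, (u, x) ∈ levelSet M (fnF A Q) t := by
  refine ⟨((t - Q u) / detA A u) • minorVec (jacobian A u), hu, ?_⟩
  rw [fnF, dotProduct_smul, ← detA_eq, smul_eq_mul, div_mul_cancel₀ _ (hd u hu)]
  ring

/-- Parallel leaves would mean that all `A(u)` have the same annihilator. Differentiating, a nonzero
`dA(v)` would be a multiple of `A`, against transversality; `1 ≤ n` provides the `v ≠ 0`. -/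
theorem not_isCylindrical (h : SmoothData M A Q) (hn : 1 ≤ n) (hd : ∀ u ∈ M, detA A u ≠ 0)
    (hne : (levelSet M (fnF A Q) t).Nonempty) :
    ¬ IsCylindrical (levelSet M (fnF A Q) t) (rulingLeaf A) := by
  intro hcyl
  obtain ⟨p, hp⟩ := hne
  obtain ⟨hinj, hA⟩ := (detA_ne_zero_iff A p.1).1 (hd _ hp.1)
  have hA0 : A p.1 ≠ 0 := fun h0 => hA ⟨0, by rw [h0, map_zero]⟩
  have h1 : ∀ y, A p.1 ⬝ᵥ y = 0 → ∀ v ∈ M, A v ⬝ᵥ y = 0 := by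
    intro y hy v hv
    obtain ⟨x, hx⟩ := exists_mem_levelSet (Q := Q) hd t hv
    have h2 := (hcyl p hp _ hx).direction_eq
    rw [rulingLeaf_direction, rulingLeaf_direction] at h2
    have h3 : ((0, y) : Space n) ∈ rulingDirection (A p.1) := mem_rulingDirection.2 ⟨rfl, hy⟩
    rw [h2] at h3
    exact (mem_rulingDirection.1 h3).2
  let v : Fin n → ℝ := Pi.single ⟨0, hn⟩ 1
  obtain ⟨c, hc⟩ := eq_smul_of_orthogonal hA0 (b := fderiv ℝ A p.1 v) fun y hy => by
    have h2 := (differentiableAt_and_fderiv_dotProduct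
      ((h.contDiffAt_A hp.1).differentiableAt (by simp)) (differentiableAt_const y)).2 v
    have h3 : (fun q => A q ⬝ᵥ y) =ᶠ[𝓝 p.1] fun _ => 0 := by
      filter_upwards [h.isOpen.mem_nhds hp.1] with q hq using h1 y hy q hq
    rw [h3.fderiv_eq] at h2
    simpa using h2.symm
  have hc0 : c = 0 := by
    by_contra hne
    refine hA ⟨c⁻¹ • v, ?_⟩
    rw [map_smul, hc, smul_smul, inv_mul_cancel₀ hne, one_smul]
  have hv : v = 0 := hinj (by rw [hc, hc0, zero_smul, map_zero])
  have := congrFun hv ⟨0, hn⟩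
  simp [v] at this

/-- The kernel of `Ω` is the line of `V`, and `β(V) = |A dA|` fixes the multiple. -/
theorem isReebOn_iff (h : SmoothData M A Q) (hd : ∀ u ∈ M, detA A u ≠ 0) (R : Space n → Space n) :
    IsReebOn {p : Space n | p.1 ∈ M} (formBeta A) R ↔
      ∀ p : Space n, p.1 ∈ M → R p = (detA A p.1)⁻¹ • fieldV A p := by
  refine forall₂_congr fun p hp => ?_
  have hp' : p.1 ∈ M := hp
  obtain ⟨hinj, -⟩ := (detA_ne_zero_iff A p.1).1 (hd _ hp')
  have hΩ : ∀ X Y, extDeriv (formBeta A) p ![X, Y] = _ := fun X Y => h.formOmega_apply hp' X Y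
  simp only [hΩ, formBeta_apply, Matrix.cons_val_fin_one]
  constructor
  · rintro ⟨h1, h2⟩
    have h3 : (R p).1 = 0 := hinj (by
      rw [map_zero]
      exact dotProduct_eq_zero _ fun y => by simpa using h2 (0, y))
    obtain ⟨c, hc⟩ := eq_smul_minorVec ((injective_mulVec_jacobian A p.1).2 hinj) (y := (R p).2)
      fun v => by simpa [h3, jacobian_mulVec] using h2 (v, 0)
    rw [hc, dotProduct_smul, ← detA_eq, smul_eq_mul] at h1
    rw [← eq_inv_of_mul_eq_one_left h1]
    exact Prod.ext (by simp [h3, fieldV_eq]) hc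
  · intro hR
    rw [hR]
    refine ⟨?_, fun Y => ?_⟩
    · rw [fieldV_eq, Prod.smul_snd, dotProduct_smul, ← detA_eq, smul_eq_mul,
        inv_mul_cancel₀ (hd _ hp')]
    · simp [fieldV_eq, fderiv_dotProduct_minorVec]

end SmoothData

end Ruling

/-! ### The parameterization -/

section Parameterization

variable {n : ℕ} {M : Set (Fin n → ℝ)} {A : (Fin n → ℝ) → Fin (n + 1) → ℝ} {Q : (Fin n → ℝ) → ℝ}
  {u : Fin n → ℝ} {p : Space n} {t : ℝ} {κ : ℝ}

/-- The matrix with columns `a^(I+1) e_I - a^I e_(I+1)`. -/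
def ruleMatrix (a : Fin (n + 1) → ℝ) : Matrix (Fin (n + 1)) (Fin n) ℝ :=
  Matrix.of fun i I => a I.succ * (Pi.single I.castSucc 1 : Fin (n + 1) → ℝ) i -
    a I.castSucc * (Pi.single I.succ 1 : Fin (n + 1) → ℝ) i

theorem ruleMatrix_mulVec (a : Fin (n + 1) → ℝ) (s : Fin n → ℝ) :
    ruleMatrix a *ᵥ s = ∑ I : Fin n,
      s I • (a I.succ • Pi.single I.castSucc 1 - a I.castSucc • Pi.single I.succ 1) := by
  ext i
  rw [Finset.sum_apply, Matrix.mulVec, dotProduct]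
  refine Finset.sum_congr rfl fun I _ => ?_
  simp only [ruleMatrix, Matrix.of_apply, Pi.smul_apply, Pi.sub_apply, smul_eq_mul]
  ring

theorem dotProduct_ruleMatrix_mulVec (a : Fin (n + 1) → ℝ) (s : Fin n → ℝ) :
    a ⬝ᵥ (ruleMatrix a *ᵥ s) = 0 := by
  rw [ruleMatrix_mulVec, dotProduct_sum]
  refine Finset.sum_eq_zero fun I _ => ?_
  simp [dotProduct_sub]
  right
  ring

/-- The matrix is bidiagonal: the first row gives `s₀ a₁ = 0`, and each middle row determines the
next coefficient from the previous one. Nonvanishing interior components kill all coefficients but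
the last by induction, and the last row kills that one. For `n = 1` there are no interior components
and `a ≠ 0` is used instead. -/
theorem ruleMatrix_injective {a : Fin (n + 1) → ℝ} (ha : a ≠ 0)
    (hne : ∀ i : Fin (n + 1), i ≠ 0 → i ≠ Fin.last n → a i ≠ 0) :
    ∀ s, ruleMatrix a *ᵥ s = 0 → s = 0 := by
  intro s hs
  rcases n with _ | m
  · exact Subsingleton.elim _ _
  have hrow : ∀ i, (∑ I : Fin (m + 1), s I * (a I.succ * (if i = I.castSucc then 1 else 0))) -
      ∑ I : Fin (m + 1), s I * (a I.castSucc * (if i = I.succ then 1 else 0)) = 0 := by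
    intro i
    rw [← Finset.sum_sub_distrib]
    refine Eq.trans ?_ (congrFun hs i)
    rw [Matrix.mulVec, dotProduct]
    refine Finset.sum_congr rfl fun I _ => ?_
    simp only [ruleMatrix, Matrix.of_apply, Pi.single_apply]
    ring
  have h0 : s 0 * a 1 = 0 := by
    have := hrow (0 : Fin (m + 1)).castSucc
    rw [Finset.sum_eq_single 0 (by
        intro I _ hI
        have : (0 : Fin (m + 1)).castSucc ≠ I.castSucc := fun h => hI (Fin.castSucc_injective _ h).symm
        rw [if_neg this]
        simp) (by simp)] at this
    simpa [(Fin.succ_ne_zero _).symm] using this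
  have hlast : s (Fin.last m) * a (Fin.last m).castSucc = 0 := by
    have := hrow (Fin.last m).succ
    rw [Finset.sum_eq_zero (by
      intro I _
      have : (Fin.last m).succ ≠ I.castSucc := by
        rw [Fin.succ_last]; exact (Fin.castSucc_ne_last I).symm
      rw [if_neg this]
      simp), Finset.sum_eq_single (Fin.last m) (by
        intro I _ hI
        have : (Fin.last m).succ ≠ I.succ := fun h => hI (Fin.succ_injective _ h).symm
        rw [if_neg this]
        simp) (by simp)] at this
    simpa using this
  have hmid : ∀ K : Fin m, s K.succ * a K.succ.succ = s K.castSucc * a K.castSucc.castSucc := by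
    intro K
    have := hrow K.succ.castSucc
    rw [Finset.sum_eq_single K.succ (by
        intro I _ hI
        have : K.succ.castSucc ≠ I.castSucc := fun h => hI (Fin.castSucc_injective _ h).symm
        rw [if_neg this]
        simp) (by simp), ← Fin.succ_castSucc, Finset.sum_eq_single K.castSucc (by
        intro I _ hI
        have : K.castSucc.succ ≠ I.succ := fun h => hI (Fin.succ_injective _ h).symm
        rw [if_neg this]
        simp) (by simp)] at this
    simpa [sub_eq_zero] using this
  have hint : ∀ k (hk : k < m), s ⟨k, by omega⟩ = 0 := by
    intro k
    induction k with
    | zero =>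
      intro hk
      refine (mul_eq_zero.1 h0).resolve_right (hne 1 ?_ ?_)
      · simp
      · simp [Fin.ext_iff]
        omega
    | succ k ih =>
      intro hk
      have h1 := hmid ⟨k, by omega⟩
      have h2 : s (Fin.castSucc ⟨k, by omega⟩) = 0 := ih (by omega)
      rw [h2, zero_mul] at h1
      refine (mul_eq_zero.1 h1).resolve_right (hne _ ?_ ?_)
      · simp [Fin.ext_iff]
      · simp [Fin.ext_iff]
        omega
  have hl : s (Fin.last m) = 0 := by
    rcases m with _ | m
    · by_contra h1
      apply ha
      ext i
      fin_cases i
      · exact (mul_eq_zero.1 hlast).resolve_left h1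
      · exact (mul_eq_zero.1 h0).resolve_left h1
    · refine (mul_eq_zero.1 hlast).resolve_right (hne _ ?_ (Fin.castSucc_ne_last _))
      simp [Fin.ext_iff]
  ext I
  refine Fin.lastCases hl (fun K => hint K K.2) I

/-- The columns of the rule matrix are independent and orthogonal to `a`, so `a` completes them to a
basis. -/
theorem det_consCol_ruleMatrix_ne_zero {a : Fin (n + 1) → ℝ} (ha : a ≠ 0)
    (hne : ∀ i : Fin (n + 1), i ≠ 0 → i ≠ Fin.last n → a i ≠ 0) :
    (consCol a (ruleMatrix a)).det ≠ 0 := by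
  rw [det_consCol_ne_zero_iff]
  constructor
  · intro s s' hs
    rw [← sub_eq_zero]
    refine ruleMatrix_injective ha hne _ ?_
    rw [Matrix.mulVec_sub, sub_eq_zero]
    exact hs
  · intro s hs
    apply ha
    rw [← dotProduct_self_eq_zero]
    conv_lhs => rw [← hs]
    rw [dotProduct_comm, hs]
    conv_lhs => arg 2; rw [← hs]
    exact dotProduct_ruleMatrix_mulVec a s

theorem mapPhi_eq (A : (Fin n → ℝ) → Fin (n + 1) → ℝ) (Q : (Fin n → ℝ) → ℝ) (κ t : ℝ)
    (r s : Fin n → ℝ) : mapPhi A Q κ t r s =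
      (r, (κ⁻¹ * (t - Q r)) • minorVec (jacobian A r) + ruleMatrix (A r) *ᵥ s) := by
  rw [ruleMatrix_mulVec]
  rfl

theorem fnF_mapPhi (hκ : κ ≠ 0) (hdet : detA A u = κ) (Q : (Fin n → ℝ) → ℝ) (t : ℝ) (s : Fin n → ℝ) :
    fnF A Q (mapPhi A Q κ t u s) = t := by
  rw [mapPhi_eq, fnF, dotProduct_add, dotProduct_ruleMatrix_mulVec, dotProduct_smul, ← detA_eq, hdet,
    smul_eq_mul]
  field_simp
  ring

theorem hasDerivAt_mapPhi (A : (Fin n → ℝ) → Fin (n + 1) → ℝ) (Q : (Fin n → ℝ) → ℝ) (κ b t : ℝ)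
    (r s : Fin n → ℝ) :
    HasDerivAt (fun t' => mapPhi A Q κ (b * t') r s)
      ((κ⁻¹ * b) • ((0, minorVec (jacobian A r)) : Space n)) t := by
  have h1 : HasDerivAt (fun t' => κ⁻¹ * (b * t' - Q r)) (κ⁻¹ * b) t := by
    simpa using (((hasDerivAt_id t).const_mul b).sub_const (Q r)).const_mul κ⁻¹
  have h2 := (hasDerivAt_const t r).prodMk
    ((h1.smul_const (minorVec (jacobian A r))).add_const (ruleMatrix (A r) *ᵥ s))
  simp only [mapPhi_eq]
  convert h2 using 1
  simp

namespace SmoothData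

theorem isOpen_goodSet (h : SmoothData M A Q) : IsOpen (goodSet M A) := by
  rw [isOpen_iff_mem_nhds]
  rintro u ⟨hu, hne⟩
  have h1 : ∀ᶠ v in 𝓝 u, ∀ i : Fin (n + 1), i ≠ 0 → i ≠ Fin.last n → A v i ≠ 0 := by
    rw [eventually_all]
    intro i
    rw [eventually_imp_distrib_left]
    intro hi
    rw [eventually_imp_distrib_left]
    intro hi'
    exact ((contDiffAt_pi.1 (h.contDiffAt_A hu)) i).continuousAt.eventually_ne (hne i hi hi')
  filter_upwards [h.isOpen.mem_nhds hu, h1] with v hv hv' using ⟨hv, hv'⟩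

/-- Were a component of `A` zero on an open set, its derivatives would vanish there too, giving `(A
| dA)` a zero row. -/
theorem exists_mem_ne_zero (h : SmoothData M A Q) (hd : ∀ u ∈ M, detA A u ≠ 0) {O : Set (Fin n → ℝ)}
    (hO : IsOpen O) (hOM : O ⊆ M) (hne : O.Nonempty) (i : Fin (n + 1)) : ∃ u ∈ O, A u i ≠ 0 := by
  by_contra! h0
  obtain ⟨u, hu⟩ := hne
  apply hd u (hOM hu)
  rw [detA]
  apply Matrix.det_eq_zero_of_row_eq_zero i
  have hdA := (h.contDiffAt_A (hOM hu)).differentiableAt (by simp)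
  have h1 : (fun q => A q i) =ᶠ[𝓝 u] fun _ => 0 := by
    filter_upwards [hO.mem_nhds hu] with q hq using h0 q hq
  intro j
  refine Fin.cases ?_ (fun j => ?_) j
  · simpa using h0 u hu
  · have h2 := fderiv_pi (differentiableAt_pi.1 hdA)
    have h3 : jacobian A u i j = fderiv ℝ (fun q => A q i) u (Pi.single j 1) := by
      simp only [jacobian, Matrix.of_apply]
      change fderiv ℝ (fun x i => A x i) u _ i = _
      rw [h2]
      rfl
    simp only [Matrix.of_apply, Fin.cons_succ]
    rw [h3, h1.fderiv_eq]
    simp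

theorem subset_closure_goodSet (h : SmoothData M A Q) (hd : ∀ u ∈ M, detA A u ≠ 0) :
    M ⊆ closure (goodSet M A) := by
  -- Finitely many open dense conditions are imposed one at a time, shrinking the open set at each
  -- stage.
  have key : ∀ (s : Finset (Fin (n + 1))) (O : Set (Fin n → ℝ)), IsOpen O → O ⊆ M → O.Nonempty →
      ∃ u ∈ O, ∀ i ∈ s, A u i ≠ 0 := by
    intro s
    induction s using Finset.induction_on with
    | empty => exact fun O _ _ ⟨u, hu⟩ => ⟨u, hu, by simp⟩
    | insert i s _ ih =>
      intro O hO hOM hne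
      have hO' : IsOpen (O ∩ {u | A u i ≠ 0}) := by
        have : ContinuousOn (fun u => A u i) O :=
          (continuousOn_pi.1 (h.smoothA.continuousOn.mono hOM)) i
        exact this.isOpen_inter_preimage hO isOpen_ne
      obtain ⟨u, hu, hui⟩ := h.exists_mem_ne_zero hd hO hOM hne i
      obtain ⟨v, hv, hvs⟩ := ih _ hO' (inter_subset_left.trans hOM) ⟨u, hu, hui⟩
      refine ⟨v, hv.1, fun j hj => ?_⟩
      rcases Finset.mem_insert.1 hj with rfl | hj
      · exact hv.2
      · exact hvs j hj
  intro u hu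
  rw [mem_closure_iff]
  intro O hO huO
  obtain ⟨v, hv, hvs⟩ := key Finset.univ (O ∩ M) (hO.inter h.isOpen) inter_subset_right ⟨u, huO, hu⟩
  exact ⟨v, hv.1, hv.2, fun i _ _ => hvs i (Finset.mem_univ i)⟩

theorem isParameterization (h : SmoothData M A Q) (hκ : κ ≠ 0) (hdet : ∀ u ∈ M, detA A u = κ)
    (t : ℝ) :
    IsParameterization (goodSet M A ×ˢ (univ : Set (Fin n → ℝ))) (levelSet (goodSet M A) (fnF A Q) t)
      fun z => mapPhi A Q κ t z.1 z.2 := by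
  have hA0 : ∀ u ∈ M, A u ≠ 0 := fun u hu h0 => hκ (by
    rw [← hdet u hu, detA_eq, h0, zero_dotProduct])
  let C : (Fin n → ℝ) → Matrix (Fin (n + 1)) (Fin (n + 1)) ℝ := fun u => consCol (A u) (ruleMatrix (A u))
  have hC : ∀ u ∈ goodSet M A, (C u).det ≠ 0 := fun u hu =>
    det_consCol_ruleMatrix_ne_zero (hA0 u hu.1) hu.2
  have hAs : ∀ u ∈ M, ∀ i, ContDiffAt ℝ ∞ (fun u => A u i) u := fun u hu i =>
    (contDiffAt_pi.1 (h.contDiffAt_A hu)) i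
  have hBs : ∀ u ∈ M, ∀ i I, ContDiffAt ℝ ∞ (fun u => ruleMatrix (A u) i I) u := fun u hu i I =>
    ((hAs u hu _).mul contDiffAt_const).sub ((hAs u hu _).mul contDiffAt_const)
  have hCs : ∀ u ∈ M, ∀ i j, ContDiffAt ℝ ∞ (fun u => C u i j) u := by
    intro u hu i j
    refine Fin.cases ?_ (fun j => ?_) j
    · exact hAs u hu i
    · exact hBs u hu i j
  let y : Space n → Fin (n + 1) → ℝ := fun q =>
    q.2 - (κ⁻¹ * (t - Q q.1)) • minorVec (jacobian A q.1)
  -- The inverse solves `x - κ⁻¹ (t - Q) V = z₀ A + ∑ s^I (…)` by Cramer's rule, which makes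
  -- smoothness in `(u, x)` evident. It is defined off the level set as well, as a smooth extension
  -- requires.
  let z : Space n → Fin (n + 1) → ℝ := fun q => (C q.1).det⁻¹ • ((C q.1).adjugate *ᵥ y q)
  have hys : ∀ q : Space n, q.1 ∈ M → ContDiffAt ℝ ∞ y q := fun q hq =>
    contDiffAt_snd.sub ((contDiffAt_const.mul (contDiffAt_const.sub (h.contDiffAt_Q_fst hq))).smul
      ((h.contDiffAt_minorVec hq).comp q contDiffAt_fst))
  have hzs : ∀ q : Space n, q.1 ∈ goodSet M A → ContDiffAt ℝ ∞ z q := by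
    intro q hq
    have hCs' : ∀ i j, ContDiffAt ℝ ∞ (fun q : Space n => C q.1 i j) q := fun i j =>
      (hCs q.1 hq.1 i j).comp q contDiffAt_fst
    exact ((contDiffAt_det hCs').inv (hC _ hq)).smul (contDiffAt_adjugate_mulVec hCs' (hys q hq.1))
  have hz : ∀ q : Space n, q.1 ∈ goodSet M A → ∀ x, C q.1 *ᵥ x = y q ↔ z q = x := by
    intro q hq x
    have hu : IsUnit (C q.1).det := isUnit_iff_ne_zero.2 (hC _ hq)
    have hzq : z q = (C q.1)⁻¹ *ᵥ y q := by
      simp only [z]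
      rw [Matrix.inv_def, Ring.inverse_eq_inv, Matrix.smul_mulVec]
    rw [hzq]
    constructor
    · intro hx
      rw [← hx, Matrix.mulVec_mulVec, Matrix.nonsing_inv_mul _ hu, Matrix.one_mulVec]
    · rintro rfl
      rw [Matrix.mulVec_mulVec, Matrix.mul_nonsing_inv _ hu, Matrix.one_mulVec]
  refine ⟨h.isOpen_goodSet.prod isOpen_univ, ?_, ?_, fun q => (q.1, fun I => z q I.succ), ?_, ?_⟩
  · rintro ⟨r, s⟩ ⟨hr, -⟩
    refine ContDiffAt.contDiffWithinAt ?_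
    have hfst : ContDiffAt ℝ ∞ (Prod.fst : (Fin n → ℝ) × (Fin n → ℝ) → Fin n → ℝ) (r, s) :=
      contDiffAt_fst
    simp only [mapPhi_eq]
    refine hfst.prodMk (ContDiffAt.add ?_ ?_)
    · exact (contDiffAt_const.mul (contDiffAt_const.sub ((h.contDiffAt_Q hr.1).comp (r, s) hfst))).smul
        ((h.contDiffAt_minorVec hr.1).comp (r, s) hfst)
    · rw [contDiffAt_pi]
      intro i
      refine contDiffAt_dotProduct (contDiffAt_pi.2 fun I => ?_) contDiffAt_snd
      exact (hBs r hr.1 i I).comp (r, s) hfst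
  · ext q
    constructor
    · rintro ⟨⟨r, s⟩, ⟨hr, -⟩, rfl⟩
      exact ⟨hr, fnF_mapPhi hκ (hdet r hr.1) Q t s⟩
    · rintro ⟨hq, hqt⟩
      refine ⟨(q.1, fun I => z q I.succ), ⟨hq, mem_univ _⟩, ?_⟩
      have h1 := (hz q hq (z q)).2 rfl
      rw [consCol_mulVec] at h1
      have hAy : A q.1 ⬝ᵥ y q = 0 := by
        simp only [y]
        rw [dotProduct_sub, dotProduct_smul, ← detA_eq, hdet _ hq.1, smul_eq_mul]
        rw [fnF] at hqt
        field_simp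
        linarith
      -- On the level set `⟨A, y⟩ = 0`, and the rule vectors are orthogonal to `A`, so the
      -- `A`-component of `y` vanishes.
      have hz0 : z q 0 = 0 := by
        rw [← h1, dotProduct_add, dotProduct_ruleMatrix_mulVec, add_zero, dotProduct_smul,
          smul_eq_mul, mul_eq_zero] at hAy
        exact hAy.resolve_right fun h0 => hA0 _ hq.1 (dotProduct_self_eq_zero.1 h0)
      rw [hz0, zero_smul, zero_add] at h1
      simp only [mapPhi_eq]
      rw [h1]
      simp [y]
  · rintro q ⟨hq, -⟩
    refine contDiffAt_fst.prodMk (contDiffAt_pi.2 fun I => ?_)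
    exact (contDiffAt_pi.1 (hzs q hq)) _
  · rintro ⟨r, s⟩ ⟨hr, -⟩
    have h1 : z (mapPhi A Q κ t r s) = Fin.cons 0 s := by
      refine (hz _ (by rw [mapPhi_eq]; exact hr) _).1 ?_
      rw [consCol_mulVec, mapPhi_eq]
      simp [y]
    simp only [h1, Fin.cons_succ]
    rw [mapPhi_eq]

end SmoothData

end Parameterization

/-! ### The condition `A^*(μ) = κ ω` and the constants in the equiaffine normal. -/

section Constants

theorem pullbackMu_eq {n : ℕ} (A : (Fin n → ℝ) → Fin (n + 1) → ℝ) (u : Fin n → ℝ) :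
    pullbackMu A u = detA A u • (Pi.basisFun ℝ (Fin n)).det := by
  rw [AlternatingMap.eq_smul_basis_det (Pi.basisFun ℝ (Fin n)) (pullbackMu A u)]
  congr 1
  change (Pi.basisFun ℝ (Fin (n + 1))).det
    (Fin.cons (A u) fun I => fderiv ℝ A u (Pi.basisFun ℝ (Fin n) I)) = _
  rw [Module.Basis.det_apply, detA]
  congr 1
  ext i j
  refine Fin.cases ?_ (fun j => ?_) j <;> simp [Module.Basis.toMatrix_apply, jacobian]

theorem forall_pullbackMu_eq_iff {n : ℕ} (M : Set (Fin n → ℝ)) (A : (Fin n → ℝ) → Fin (n + 1) → ℝ)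
    (κ : ℝ) : (∀ u ∈ M, pullbackMu A u = κ • (Pi.basisFun ℝ (Fin n)).det) ↔ ∀ u ∈ M, detA A u = κ := by
  refine forall₂_congr fun u _ => ?_
  rw [pullbackMu_eq]
  refine ⟨fun h => ?_, fun h => by rw [h]⟩
  have := congrArg (fun f : (Fin n → ℝ) [⋀^Fin n]→ₗ[ℝ] ℝ => f (Pi.basisFun ℝ (Fin n))) h
  simp only [AlternatingMap.smul_apply, Module.Basis.det_self, smul_eq_mul, mul_one] at this
  exact this

theorem volumeForm_ne_zero (n : ℕ) : volumeForm n ≠ 0 := by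
  intro h0
  have h1 : volumeForm n ((frame n).reindex finSumFinEquiv) = 1 := Module.Basis.det_self _
  rw [h0] at h1
  simp at h1

theorem volumeForm_domDomCongr_ne_zero (n : ℕ) (hn : n + (n + 1) = 1 + 2 * n) :
    (volumeForm n).domDomCongr (finCongr hn) ≠ 0 := by
  rw [Ne, AlternatingMap.domDomCongr_eq_zero_iff]
  exact volumeForm_ne_zero n

variable {n : ℕ} {κ : ℝ}

/-- The factor `c` of the equiaffine normal `W = c V`. -/
def normalFactor (n : ℕ) (κ : ℝ) : ℝ := -(Real.sign κ) * |κ| ^ (-n / (n + 1) : ℝ)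

theorem sign_mul_abs_eq (κ : ℝ) : Real.sign κ * |κ| = κ := by
  rcases lt_trichotomy κ 0 with h | rfl | h
  · rw [Real.sign_of_neg h, abs_of_neg h]; ring
  · simp
  · rw [Real.sign_of_pos h, abs_of_pos h]; ring

theorem sign_mul_sign_eq (hκ : κ ≠ 0) : Real.sign κ * Real.sign κ = 1 := by
  rcases Real.sign_apply_eq_of_ne_zero κ hκ with h | h <;> rw [h] <;> norm_num

theorem rpow_mul_abs (hκ : κ ≠ 0) (a b : ℝ) (h : a + 1 = b) : |κ| ^ a * |κ| = |κ| ^ b := by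
  rw [← h, Real.rpow_add (abs_pos.2 hκ), Real.rpow_one]

/-- This number is `dF(W)`. Its absolute value meets the volume condition, and it is the rate at
which the flow changes the level `t`. -/
theorem normalFactor_mul (hκ : κ ≠ 0) : normalFactor n κ * κ = -|κ| ^ (1 / (n + 1) : ℝ) := by
  have hn : (n : ℝ) + 1 ≠ 0 := by positivity
  rw [← rpow_mul_abs hκ (-n / (n + 1) : ℝ) (1 / (n + 1) : ℝ) (by field_simp; ring)]
  conv_lhs => rw [normalFactor]; arg 2; rw [← sign_mul_abs_eq κ]
  linear_combination (-(|κ| ^ (-n / (n + 1) : ℝ) * |κ|)) * sign_mul_sign_eq hκ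

theorem normalFactor_ne_zero (n : ℕ) (hκ : κ ≠ 0) : normalFactor n κ ≠ 0 := by
  intro h0
  have h1 := normalFactor_mul (n := n) hκ
  rw [h0, zero_mul, eq_comm, neg_eq_zero] at h1
  exact (Real.rpow_pos_of_pos (abs_pos.2 hκ) _).ne' h1

theorem abs_normalFactor_mul_pow (n : ℕ) (hκ : κ ≠ 0) :
    |normalFactor n κ * κ| ^ (n + 1) = |κ| := by
  have hn : (n : ℝ) + 1 ≠ 0 := by positivity
  rw [normalFactor_mul hκ, abs_neg, abs_of_pos (Real.rpow_pos_of_pos (abs_pos.2 hκ) _),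
    ← Real.rpow_natCast, ← Real.rpow_mul (abs_nonneg κ)]
  push_cast
  rw [one_div, inv_mul_cancel₀ hn, Real.rpow_one]

/-- The last factor is that of `N = (-1)ⁿ κ V`, so this matches the two expressions for `W`. -/
theorem normalFactor_eq (hκ : κ ≠ 0) : normalFactor n κ =
    (-1) ^ (n + 1) * |κ| ^ (-(2 * n + 1) / (n + 1) : ℝ) * ((-1) ^ n * κ) := by
  have hn : (n : ℝ) + 1 ≠ 0 := by positivity
  rw [normalFactor, ← rpow_mul_abs hκ (-(2 * n + 1) / (n + 1) : ℝ) (-n / (n + 1) : ℝ)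
    (by field_simp; ring)]
  have h1 : (-1 : ℝ) ^ (n + 1) * (-1) ^ n = -1 := by
    rw [pow_succ, mul_right_comm, ← mul_pow]
    norm_num
  linear_combination (-(|κ| ^ (-(2 * n + 1) / (n + 1) : ℝ))) * sign_mul_abs_eq κ -
    |κ| ^ (-(2 * n + 1) / (n + 1) : ℝ) * κ * h1

theorem sign_neg_one_pow_mul_sq (n : ℕ) (hκ : κ ≠ 0) :
    Real.sign ((-1) ^ n * κ ^ 2) = (-1) ^ n := by
  have h2 : 0 < κ ^ 2 := by positivity
  rcases neg_one_pow_eq_or ℝ n with h | h <;> rw [h]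
  · exact Real.sign_of_pos (by linarith)
  · exact Real.sign_of_neg (by linarith)

theorem SmoothData.sameCoorientation {M : Set (Fin n → ℝ)} {A : (Fin n → ℝ) → Fin (n + 1) → ℝ}
    {Q : (Fin n → ℝ) → ℝ} (h : SmoothData M A Q) (hκ : κ ≠ 0) (hdet : ∀ u ∈ M, detA A u = κ)
    (t : ℝ) :
    SameCoorientation (levelSet M (fnF A Q) t) (fun p => normalFactor n κ • fieldV A p)
      fun p => -(Real.sign (fnU (fnF A Q) p)) • fieldN (fnF A Q) p := by
  intro p hp
  have hpos := abs_pos.2 hκ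
  -- Here `-sign(𝒰(F)) N = -κ V` and `W = -sign(κ) |κ|^(-n/(n+1)) V`; this is their ratio, so the
  -- difference is not merely tangent but zero.
  refine ⟨|κ| ^ (-n / (n + 1) : ℝ) / |κ|, div_pos (Real.rpow_pos_of_pos hpos _) hpos, ?_⟩
  convert Submodule.zero_mem _
  beta_reduce
  rw [h.fnU_eq hp.1, h.fieldN_eq hp.1, hdet _ hp.1, sign_neg_one_pow_mul_sq n hκ, smul_smul, smul_smul,
    ← sub_smul]
  have h1 : (-1 : ℝ) ^ n * (-1) ^ n = 1 := by
    rw [← mul_pow]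
    norm_num
  have h2 : normalFactor n κ - |κ| ^ (-n / (n + 1) : ℝ) / |κ| * -(-1) ^ n * ((-1) ^ n * κ) = 0 := by
    rw [normalFactor]
    have h3 : Real.sign κ = κ / |κ| := by
      rw [eq_div_iff hpos.ne', sign_mul_abs_eq]
    rw [h3]
    linear_combination |κ| ^ (-n / (n + 1) : ℝ) * κ * |κ|⁻¹ * h1
  rw [h2, zero_smul]

end Constants

end

end RuledHypersurface

/-! ### Assembly of the theorem. -/

theorem lemma3p1 (n : ℕ) (hn : 1 ≤ n) (M : Set (Fin n → ℝ)) (hMo : IsOpen M) (hMc : IsConnected M)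
    (A : (Fin n → ℝ) → Fin (n + 1) → ℝ) (hA : ContDiffOn ℝ ∞ A M)
    (Q : (Fin n → ℝ) → ℝ) (hQ : ContDiffOn ℝ ∞ Q M) :
    -- `V` lies in the radical of the Hessian
    (∀ p : Space n, p.1 ∈ M → ∀ Y, hess (fnF A Q) p (fieldV A p) Y = 0) ∧
    -- the adjugate of the Hessian, `N` and `𝒰(F)`
    (∀ p : Space n, p.1 ∈ M →
      (hessMatrix (fnF A Q) p).adjugate = (-1 : ℝ) ^ n •
        Matrix.vecMulVec ((frame n).equivFun (fieldV A p)) ((frame n).equivFun (fieldV A p)) ∧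
      fieldN (fnF A Q) p = ((-1) ^ n * detA A p.1) • fieldV A p ∧
      fnU (fnF A Q) p = (-1) ^ n * detA A p.1 ^ 2) ∧
    -- immersions
    (IsImmersionOn M A ↔ ∀ p : Space n, p.1 ∈ M → (hessMatrix (fnF A Q) p).rank = 2 * n) ∧
    (IsImmersionOn M A → ∀ p : Space n, p.1 ∈ M → ∀ X,
      (∀ Y, hess (fnF A Q) p X Y = 0) ↔ ∃ c : ℝ, X = c • fieldV A p) ∧
    -- centroaffine immersions
    (IsCentroaffineOn M A ↔ ∀ p : Space n, p.1 ∈ M → fnU (fnF A Q) p ≠ 0) ∧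
    (IsCentroaffineOn M A ↔ IsContactOn n {p : Space n | p.1 ∈ M} (formBeta A)) ∧
    (IsCentroaffineOn M A →
      (∀ p : Space n, p.1 ∈ M →
        (hessMatrix (fnF A Q) p).adjugate = ((-1) ^ n * (detA A p.1 ^ 2)⁻¹) •
          Matrix.vecMulVec ((frame n).equivFun (fieldN (fnF A Q) p))
            ((frame n).equivFun (fieldN (fnF A Q) p))) ∧
      ∀ t : ℝ, (levelSet M (fnF A Q) t).Nonempty →
        IsSmoothHypersurface (levelSet M (fnF A Q) t) ∧
        IsNondegenerate (levelSet M (fnF A Q) t) ∧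
        IsTransversal (levelSet M (fnF A Q) t) (fieldN (fnF A Q)) ∧
        IsSymplecticOn (levelSet M (fnF A Q) t) (formOmega A)) ∧
    -- the equation `A^*(μ) = κ ω`
    (∀ κ : ℝ, κ ≠ 0 →
      ((∀ u ∈ M, pullbackMu A u = κ • (Pi.basisFun ℝ (Fin n)).det) ↔
        ∀ p : Space n, p.1 ∈ M →
          wedge (formBeta A p).toAlternatingMap (wedgePow (formOmega A p).toAlternatingMap n) =
            ((-1) ^ (n * (n + 1) / 2) * (n.factorial : ℝ) * κ) •
              (volumeForm n).domDomCongr (finCongr (by omega)))) ∧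
    (∀ κ : ℝ, κ ≠ 0 → (∀ u ∈ M, pullbackMu A u = κ • (Pi.basisFun ℝ (Fin n)).det) →
      IsCentroaffineOn M A ∧
      -- every nonempty level set has equiaffine normal `W`, a constant multiple of `N` and of `V`
      (∃ W : Space n → Space n,
        (∀ p : Space n, p.1 ∈ M →
          W p = ((-1) ^ (n + 1) * |κ| ^ (-(2 * n + 1) / (n + 1) : ℝ)) • fieldN (fnF A Q) p ∧
          W p = (-(Real.sign κ) * |κ| ^ (-n / (n + 1) : ℝ)) • fieldV A p) ∧
        (∀ t : ℝ, (levelSet M (fnF A Q) t).Nonempty →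
          SameCoorientation (levelSet M (fnF A Q) t) W
            (fun p => -(Real.sign (fnU (fnF A Q) p)) • fieldN (fnF A Q) p) ∧
          (∃ h S, IsEquiaffineNormal (volumeForm n) (levelSet M (fnF A Q) t) W h S ∧
            (∀ p ∈ levelSet M (fnF A Q) t,
              -- zero equiaffine mean curvature, shape operator of square zero
              meanCurvature (2 * n) S p = 0 ∧ S p ∘ₗ S p = 0 ∧
              -- split signature of the equiaffine metric
              Module.finrank ℝ (tangentSpaceAt (levelSet M (fnF A Q) t) p) = 2 * n ∧
              sigPos (LinearMap.BilinMap.toQuadraticMap (h p)) = n ∧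
              sigNeg (LinearMap.BilinMap.toQuadraticMap (h p)) = n) ∧
            -- the Lagrangian ruling
            ∃ L : Space n → AffineSubspace ℝ (Space n),
              IsRuling n (levelSet M (fnF A Q) t) L ∧
              (∀ p ∈ levelSet M (fnF A Q) t,
                IsLagrangian (formOmega A p) (tangentSpaceAt (levelSet M (fnF A Q) t) p)
                  (L p).direction ∧
                ∀ X : tangentSpaceAt (levelSet M (fnF A Q) t) p,
                  (X : Space n) ∈ (L p).direction → S p X = 0) ∧
              ¬ IsCylindrical (levelSet M (fnF A Q) t) L) ∧
          -- uniqueness of the equiaffine normal with this co-orientation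
          (∀ W' h' S', IsEquiaffineNormal (volumeForm n) (levelSet M (fnF A Q) t) W' h' S' →
            SameCoorientation (levelSet M (fnF A Q) t) W' W →
            ∀ p ∈ levelSet M (fnF A Q) t, W' p = W p)) ∧
        -- the affine normal flow
        ∀ r ∈ M, ∀ (s : Fin n → ℝ) (t : ℝ),
          HasDerivAt (fun t' => mapPhi A Q κ (-|κ| ^ (1 / (n + 1) : ℝ) * t') r s)
            (W (mapPhi A Q κ (-|κ| ^ (1 / (n + 1) : ℝ) * t) r s)) t) ∧
      -- the Reeb field
      (∀ R : Space n → Space n, IsReebOn {p : Space n | p.1 ∈ M} (formBeta A) R ↔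
        ∀ p : Space n, p.1 ∈ M → R p = κ⁻¹ • fieldV A p) ∧
      -- the parameterization
      (∀ r ∈ M, ∀ (s : Fin n → ℝ) (t : ℝ), fnF A Q (mapPhi A Q κ t r s) = t) ∧
      M ⊆ closure (goodSet M A) ∧
      ∀ t : ℝ, IsParameterization (goodSet M A ×ˢ (univ : Set (Fin n → ℝ)))
        (levelSet (goodSet M A) (fnF A Q) t) (fun z => mapPhi A Q κ t z.1 z.2)) := by
  have h : SmoothData M A Q := ⟨hMo, hA, hQ⟩
  -- Conditions depending only on `u` may be tested at any point of the fibre, here `x = 0`.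
  have hfst : ∀ {P : (Fin n → ℝ) → Prop}, (∀ u ∈ M, P u) ↔ ∀ p : Space n, p.1 ∈ M → P p.1 :=
    fun {P} => ⟨fun h p hp => h p.1 hp, fun h u hu => h (u, 0) hu⟩
  refine ⟨fun p hp Y => h.hess_fieldV hp Y,
    fun p hp => ⟨h.adjugate_hessMatrix hp, h.fieldN_eq hp, h.fnU_eq hp⟩, ?_, ?_, ?_, ?_, ?_, ?_, ?_⟩
  · rw [IsImmersionOn, hfst]
    exact forall₂_congr fun p hp => (h.rank_hessMatrix hp).symm
  · exact fun hI p hp X => h.radical_hess hp (hI p.1 hp) X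
  · rw [isCentroaffineOn_iff, hfst]
    refine forall₂_congr fun p hp => ?_
    rw [h.fnU_eq hp]
    simp
  · rw [isCentroaffineOn_iff, hfst]
    refine forall₂_congr fun p hp => ?_
    change _ ↔ wedge _ (wedgePow (formOmega A p).toAlternatingMap n) ≠ 0
    rw [h.wedge_formBeta_wedgePow_formOmega hp (by omega)]
    simp [smul_eq_zero, volumeForm_ne_zero, Nat.factorial_ne_zero]
  · intro hC
    rw [isCentroaffineOn_iff] at hC
    refine ⟨fun p hp => ?_, fun t _ => ⟨h.isSmoothHypersurface hC t, h.isNondegenerate hC t,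
      h.isTransversal_fieldN hC t, h.isSymplecticOn hC t⟩⟩
    rw [h.adjugate_hessMatrix hp, h.fieldN_eq hp, map_smul, Matrix.smul_vecMulVec,
      Matrix.vecMulVec_smul, smul_smul, smul_smul]
    congr 1
    have h1 : (-1 : ℝ) ^ n * (-1) ^ n = 1 := by
      rw [← mul_pow]
      norm_num
    have h2 := hC _ hp
    field_simp
    linear_combination -h1
  · intro κ hκ
    rw [forall_pullbackMu_eq_iff, hfst]
    refine forall₂_congr fun p hp => ?_
    rw [h.wedge_formBeta_wedgePow_formOmega hp (by omega),
      (smul_left_injective ℝ (volumeForm_domDomCongr_ne_zero n _)).eq_iff]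
    simp [Nat.factorial_ne_zero]
  · intro κ hκ hdet
    rw [forall_pullbackMu_eq_iff] at hdet
    have hd : ∀ u ∈ M, detA A u ≠ 0 := fun u hu => by rwa [hdet u hu]
    have hc0 := normalFactor_ne_zero n hκ
    have hc := abs_normalFactor_mul_pow n hκ
    refine ⟨(isCentroaffineOn_iff M A).2 hd, ⟨fun p => normalFactor n κ • fieldV A p, ?_, ?_, ?_⟩,
      fun R => ?_, fun r hr s t => fnF_mapPhi hκ (hdet r hr) Q t s, h.subset_closure_goodSet hd,
      fun t => h.isParameterization hκ hdet t⟩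
    · intro p hp
      refine ⟨?_, rfl⟩
      rw [h.fieldN_eq hp, hdet _ hp, smul_smul, ← normalFactor_eq hκ]
    · intro t ht
      refine ⟨h.sameCoorientation hκ hdet t, ⟨_, _, h.isEquiaffineNormal hκ hdet hc0 hc t, ?_, ?_⟩, ?_⟩
      · intro p hp
        refine ⟨h.meanCurvature_levelShape hκ hdet hp, h.levelShape_comp_self hκ hdet hp,
          h.finrank_tangentSpaceAt hd hp, h.sig_levelForm hd hp ?_⟩
        rw [h.fderiv_fnF_smul_fieldV hdet hp.1]
        exact mul_ne_zero hc0 hκ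
      · refine ⟨rulingLeaf A, h.isRuling hd t, fun p hp => ⟨h.isLagrangian hd hp, fun X hX => ?_⟩,
          h.not_isCylindrical hn hd ht⟩
        rw [rulingLeaf_direction] at hX
        exact h.levelShape_apply_eq_zero hκ hdet hp X (mem_rulingDirection.1 hX).1
      · intro W' h' S' hW' hco p hp
        exact h.eq_of_isEquiaffineNormal hκ hdet hc0 hc hW' hco hp
    · intro r hr s t
      have h1 := hasDerivAt_mapPhi A Q κ (-|κ| ^ (1 / (n + 1) : ℝ)) t r s
      -- With the time scale written as `c κ`, the velocity `κ⁻¹ (c κ) V` of the curve is `c V = W`.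
      rw [← normalFactor_mul hκ] at h1 ⊢
      convert h1 using 1
      beta_reduce
      rw [mapPhi_eq, fieldV_eq, mul_comm _ κ, inv_mul_cancel_left₀ hκ]
    · rw [h.isReebOn_iff hd]
      refine forall₂_congr fun p hp => ?_
      rw [hdet _ hp]
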